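/- Fix an integer $n\ge 1$. Let $\Theta=\{\theta\in\mathbb R:\tan\theta\in\mathbb Q\cup\{\infty\}\}$; for $\theta\in\Theta$ let $v_\theta=(x_\theta,y_\theta)\in\mathbb Z^2$ be the primitive integer vector that is a positive multiple of $(\cos\theta,\sin\theta)$. Let $p:\mathbb R\to\mathbb R/2\pi n\mathbb Z$ be the projection. **Paths.** A *(periodic) admissible path* of rotation number $n$ and period $\Gamma\in\mathbb Z^2$ is a locally constant map $\Lambda:\mathbb R\setminus p^{-1}(T)\to\mathbb Z^2$, where $T\subset p(\Theta)$ is a finite set (of *edges*) with multiplicities $m:T\to\mathbb Z_{>0}$, such that $\Lambda$ jumps by $m(p(\theta))\,v_\theta$ at each $\theta\in p^{-1}(T)$ and $\Lambda(t+2\pi n)=\Lambda(t)+\Gamma$. Write $\Lambda'\le\Lambda$ if $\det\big((\cos t,\sin t),\Lambda'(t)-\Lambda(t)\big)\ge 0$ for all $t$. If $\theta_1<\theta_2$ are consecutive edges (in $\mathbb R$) with $\theta_2-\theta_1\le\pi$, and $c$ is the corner between them, the path $\Lambda\setminus c$ obtained by *rounding* $c$ has the same period, equals $\Lambda$ off $p^{-1}(p[\theta_1,\theta_2])$,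 has the multiplicities of $\theta_1$ and $\theta_2$ lowered by $1$, and on $(\theta_1,\theta_2)$ traverses counterclockwise, parametrized by tangent direction, the boundary of the convex hull of $W\setminus\{\Lambda(c)\}$ except for the edge from $\Lambda(c)+v_{\theta_2}$ to $\Lambda(c)-v_{\theta_1}$. Here $W$ is the set of lattice points of the triangle (or 2-gon) with corners $\Lambda(c)-v_{\theta_1},\ \Lambda(c),\ \Lambda(c)+v_{\theta_2}$. **Chain module.** A *generator* is a triple $(\Lambda,l,o)$: an admissible path $\Lambda$ of rotation number $n$ and some period, a labeling $l$ of its edges by $e$ or $h$, and an ordering $o$ of the $h$ edges. $\widetilde C_*(2\pi n)=\bigoplus_{\Gamma\in\mathbb Z^2}\widetilde C_*(2\pi n;\Gamma)$ is the $\mathbb Z$-module generated by these triples, where reordering the $h$ edges multiplies a triple by the sign of the permutation; it is free, with one basis element up to sign for each $(\Lambda,l)$. It is a $\mathbb Z[\mathbb Z^2]$-module by translation in the plane. $\langle x,\beta\rangle$ denotes the coefficient of the generator $\beta$ in $x$. For generators $\alpha,\beta$ of the same period $\Gamma$, with paths $\lambda,\mu$, the relative index is $$I(\alpha,\beta)=2\int_P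 x\,dy+(\ell(\alpha)-\#h(\alpha))-(\ell(\beta)-\#h(\beta)),$$ where $\ell$ is the sum of the multiplicities of the edges, $\#h$ is the number of $h$ edges, and $P=\lambda|_{[t,t+2\pi n]}+(\eta+\Gamma)-\mu|_{[t,t+2\pi n]}-\eta$ for a non-edge $t$ and a path $\eta$ from $\lambda(t)$ to $\mu(t)$ ($I$ does not depend on these choices). **Combinatorial differential.** $\delta\alpha=\sum_\beta\langle\delta\alpha,\beta\rangle\beta$ (over generators $\beta$ up to sign), where $\langle\delta\alpha,\beta\rangle\ne 0$ iff $\beta$ has path $\lambda\setminus c$ for a corner $c$ of $\lambda$ between consecutive edges $\theta_1,\theta_2$ with $\theta_2-\theta_1\in(0,\pi]$, the labels of $\alpha$ and $\beta$ are the same outside $[\theta_1,\theta_2]$, and either exactly one of $\theta_1,\theta_2$ is labeled $h$ in $\alpha$ and no edge of $\beta$ in $[\theta_1,\theta_2]$ is, or both are and exactly one edge of $\beta$ in $[\theta_1,\theta_2]$ is. In this case let $\theta\in\{\theta_1,\theta_2\}$ be an $h$ edge of $\alpha$, put last in its ordering, with the other $h$ edges of $\alpha$ ordered as the $h$ edges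 of $\beta$ under the obvious bijection; then $\langle\delta\alpha,\beta\rangle=+1$ if $\theta=\theta_2$ and $-1$ if $\theta=\theta_1$. The rounding is *simple* if exactly one edge is created, i.e. $\beta$ has exactly one edge in $(\theta_1,\theta_2)$, and its multiplicity is one; it is *degenerate* if $\theta_2-\theta_1=\pi$. **Agreement.** Edges of $\alpha$ and $\beta$ (of the same period) at the same angle *agree* if their adjacent corners map to the same points, and *partially agree* if these map to points on the same line. $D(\alpha,\beta)\subset\mathbb R/2\pi n\mathbb Z$ is the closure of the set of $t$ at which $\lambda,\mu$ are defined and unequal. The pair satisfies *Nesting* if $\mu\le\lambda$. It satisfies *Label Matching* if agreeing edges have equal labels and, whenever partially agreeing edges have label $h$ in $\beta$, they have label $h$ in $\alpha$. For a pair satisfying both, the *reduced pairs* $(\alpha',\beta')$ are obtained as follows: agreeing edges are removed from both; for each pair of edges that partially agree but do not agree, the edge of $\beta$ is removed and that of $\alpha$ is shortened by the same amount, and is labeled $h$ in $\alpha'$ iff it is labeled $h$ in $\alpha$ and $e$ in $\beta$; all other edges and labels are kept; the paths satisfy $\lambda'-\mu'=\lambda-\mu$ (which fixes them up to simultaneous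 translation); and, with the $h$ edges of $\alpha$ and $\beta$ ordered so that those common to a (partially) agreeing pair come first and in the same order, those of $\alpha'$ and $\beta'$ are ordered as the remaining ones. **Proposition.** Let $\partial:\widetilde C_*(2\pi n)\to\widetilde C_*(2\pi n)$ be a $\mathbb Z[\mathbb Z^2]$-linear map with $\partial^2=0$ such that, for all generators $\alpha,\beta$ of $\widetilde C_*(2\pi n)$: 1. (Index) if $\langle\partial\alpha,\beta\rangle\ne0$, then $\alpha,\beta$ have the same period and $I(\alpha,\beta)=1$; 2. (Nesting, Label Matching) if $\langle\partial\alpha,\beta\rangle\neq0$, then $(\alpha,\beta)$ satisfies Nesting and Label Matching; 3. (Connectedness) if $\langle\partial\alpha,\beta\rangle\ne0$, then $D(\alpha,\beta)$ is connected (the empty set counting as connected); 4. (No Double Rounding) if $\langle\partial\alpha,\beta\rangle\ne0$, then $\alpha$ does not have exactly three edges in $D(\alpha,\beta)$; 5. (Locality) if $\alpha,\beta$ have the same period and satisfy Nesting and Label Matching, then $\langle\partial\alpha,\beta\rangle=\langle\partial\alpha',\beta'\rangle$ for every reduced pair $(\alpha',\beta')$; 6. (Simple and Degenerate Rounding) if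 $\beta$ is obtained from $\alpha$ by simple or by degenerate rounding with $\langle\delta\alpha,\beta\rangle\ne0$, then $\langle\partial\alpha,\beta\rangle=\langle\delta\alpha,\beta\rangle$. Then $\partial=\delta$. -/

import Mathlib

open Real
open scoped Classical

noncomputable section

namespace PolygonComplex

/-! ### Angles, directions and admissible paths -/

/-- The circle `ℝ / 2πnℤ` in which the angles of edges live. -/
abbrev Angle (n : ℕ) : Type := AddCircle (2 * π * n)

instance instFactAngle (n : ℕ) [NeZero n] : Fact ((0 : ℝ) < 2 * π * n) :=
  ⟨mul_pos Real.two_pi_pos (Nat.cast_pos.mpr (Nat.pos_of_ne_zero (NeZero.ne n)))⟩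

/-- The set `Θ` of angles: `tan θ ∈ ℚ ∪ {∞}`. -/
def IsRationalAngle (θ : ℝ) : Prop :=
  Real.cos θ = 0 ∨ ∃ q : ℚ, Real.tan θ = (q : ℝ)

/-- `v` is a primitive integer vector and `(cos θ, sin θ)` is a positive multiple of `v`. -/
def IsDirection (θ : ℝ) (v : ℤ × ℤ) : Prop :=
  IsCoprime v.1 v.2 ∧ ∃ r : ℝ, 0 < r ∧ Real.cos θ = r * v.1 ∧ Real.sin θ = r * v.2

theorem IsRationalAngle.exists_isDirection {θ : ℝ} (h : IsRationalAngle θ) :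
    ∃ v, IsDirection θ v := by
  by_cases hc : Real.cos θ = 0
  · have hs : Real.sin θ = 1 ∨ Real.sin θ = -1 := by
      have := Real.sin_sq_add_cos_sq θ
      rw [hc] at this
      exact mul_self_eq_one_iff.mp (by nlinarith)
    rcases hs with hs | hs
    · exact ⟨(0, 1), isCoprime_one_right, 1, one_pos, by simp [hc], by simp [hs]⟩
    · exact ⟨(0, -1), isCoprime_one_right.neg_right, 1, one_pos, by simp [hc], by simp [hs]⟩
  · obtain ⟨q, hq⟩ := h.resolve_left hc
    have hsin : Real.sin θ = q * Real.cos θ := by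
      rw [← hq, Real.tan_mul_cos hc]
    have hd : (0 : ℝ) < q.den := Nat.cast_pos.mpr q.den_pos
    have hqd : (q : ℝ) = q.num / q.den := Rat.cast_def q
    have hco : IsCoprime (q.den : ℤ) q.num := by
      rw [Int.isCoprime_iff_gcd_eq_one, Int.gcd_comm]
      exact q.reduced
    rcases lt_or_gt_of_ne hc with hneg | hpos
    · refine ⟨(-(q.den : ℤ), -q.num), hco.neg_neg, -Real.cos θ / q.den,
        div_pos (by linarith) hd, ?_, ?_⟩
      · push_cast; field_simp
      · rw [hsin, hqd]; push_cast; field_simp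
    · refine ⟨((q.den : ℤ), q.num), hco, Real.cos θ / q.den, div_pos hpos hd, ?_, ?_⟩
      · push_cast; field_simp
      · rw [hsin, hqd]; field_simp

/-- The primitive integer vector `(x_θ, y_θ)` in the direction of `θ`, for `θ ∈ Θ`. -/
def dirVec (θ : ℝ) : ℤ × ℤ :=
  if h : ∃ v, IsDirection θ v then h.choose else 0

/-- A periodic admissible path `Λ` of rotation number `n` and period `period` (closed if the period
is `0`).  The locally constant map `Λ`, defined off the edges, is represented by its
right-continuous extension `pos` to all of `ℝ`: `pos t` is the value of `Λ` just after time `t`.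
The multiplicity function is extended by `0` to the angles that are not edges. -/
structure AdmissiblePath (n : ℕ) where
  period : ℤ × ℤ
  mult : Angle n →₀ ℕ
  rational : ∀ θ : ℝ, mult (θ : Angle n) ≠ 0 → IsRationalAngle θ
  pos : ℝ → ℤ × ℤ
  /-- The jumping condition `dΛ/dt = ∑ m(θ) (x_θ, y_θ) δ_θ`, integrated over `(s, t]`. -/
  jump : ∀ s t : ℝ, s ≤ t →
    pos t - pos s = ∑ᶠ θ ∈ Set.Ioc s t, mult (θ : Angle n) • dirVec θ
  periodic : ∀ t : ℝ, pos (t + 2 * π * n) = pos t + period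

namespace AdmissiblePath

variable {n : ℕ}

/-- The angle `θ` is an edge of `Λ`. -/
def IsEdge (Λ : AdmissiblePath n) (θ : ℝ) : Prop := Λ.mult (θ : Angle n) ≠ 0

/-- The value of `Λ` just before time `θ`. -/
def left (Λ : AdmissiblePath n) (θ : ℝ) : ℤ × ℤ :=
  Λ.pos θ - Λ.mult (θ : Angle n) • dirVec θ

/-- `det ((cos t, sin t), v)`. -/
def detDir (t : ℝ) (v : ℤ × ℤ) : ℝ := Real.cos t * v.2 - Real.sin t * v.1

/-- `Λ'` is to the left of `Λ`.  (The determinant extends continuously over the edges, and the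
right-continuous representatives compute this extension.) -/
def IsLeftOf (Λ' Λ : AdmissiblePath n) : Prop :=
  ∀ t : ℝ, 0 ≤ detDir t (Λ'.pos t - Λ.pos t)

/-- The translate of a path by `w ∈ ℤ²`. -/
def translate (w : ℤ × ℤ) (Λ : AdmissiblePath n) : AdmissiblePath n where
  period := Λ.period
  mult := Λ.mult
  rational := Λ.rational
  pos t := Λ.pos t + w
  jump s t hst := by rw [← Λ.jump s t hst]; abel
  periodic t := by rw [Λ.periodic t]; abel

/-! ### Rounding corners -/

/-- `θ₁ < θ₂` are (lifts to `ℝ` of) consecutive edges of `Λ`, and the corner between them is not a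
kink.  The path sits at this corner during `(θ₁, θ₂)`, at the point `Λ.pos θ₁`. -/
structure IsCorner (Λ : AdmissiblePath n) (θ₁ θ₂ : ℝ) : Prop where
  edge_left : Λ.IsEdge θ₁
  edge_right : Λ.IsEdge θ₂
  lt : θ₁ < θ₂
  le_pi : θ₂ - θ₁ ≤ π
  consecutive : ∀ θ ∈ Set.Ioo θ₁ θ₂, ¬ Λ.IsEdge θ

/-- The inclusion `ℤ² ⊂ ℝ²`. -/
def toPlane (v : ℤ × ℤ) : ℝ × ℝ := ((v.1 : ℝ), (v.2 : ℝ))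

/-- The image of `[θ₁, θ₂]` in the circle `ℝ / 2πnℤ`. -/
def arc (n : ℕ) (θ₁ θ₂ : ℝ) : Set (Angle n) := (fun t : ℝ => (t : Angle n)) '' Set.Icc θ₁ θ₂

/-- The lattice points other than `c` of the triangle (or 2-gon) with corners
`c - (x_θ₁, y_θ₁)`, `c`, `c + (x_θ₂, y_θ₂)`. -/
def roundingPoints (c : ℤ × ℤ) (θ₁ θ₂ : ℝ) : Set (ℤ × ℤ) :=
  {w | w ≠ c ∧ toPlane w ∈
    convexHull ℝ {toPlane (c - dirVec θ₁), toPlane c, toPlane (c + dirVec θ₂)}}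

/-- `Λ'` is obtained from `Λ` by rounding the corner between the consecutive edges `θ₁`, `θ₂`.
The field `inside` says that, during `(θ₁, θ₂)`, `Λ'` traverses counterclockwise the boundary of
the convex hull of the set `W` of `roundingPoints`, except for the edge from the last corner of the
triangle to the first: a convex polygon is traversed, with the parametrization by tangent
direction, by being at time `t` at a lattice point of `W` such that `W` lies to the left of the
oriented line through this point in the direction `(cos t, sin t)`. -/
structure IsRounding (Λ : AdmissiblePath n) (θ₁ θ₂ : ℝ) (Λ' : AdmissiblePath n) : Prop where
  corner : Λ.IsCorner θ₁ θ₂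
  period : Λ'.period = Λ.period
  outside : ∀ t : ℝ, (t : Angle n) ∉ arc n θ₁ θ₂ → Λ'.pos t = Λ.pos t
  mult_left : Λ'.mult (θ₁ : Angle n) + 1 = Λ.mult (θ₁ : Angle n)
  mult_right : Λ'.mult (θ₂ : Angle n) + 1 = Λ.mult (θ₂ : Angle n)
  inside : ∀ t ∈ Set.Ioo θ₁ θ₂, Λ'.pos t ∈ roundingPoints (Λ.pos θ₁) θ₁ θ₂ ∧
    ∀ w ∈ roundingPoints (Λ.pos θ₁) θ₁ θ₂, 0 ≤ detDir t (w - Λ'.pos t)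

end AdmissiblePath

/-! ### Generators and the chain module -/

/-- A triple `(Λ, l, o)`: an admissible path, a labeling of its edges by `e` or `h`, and an ordering
of the edges labeled `h`.  The list `order` is the list of the `h` edges in the order `o`, and all
other edges are labeled `e`. -/
structure Generator (n : ℕ) where
  path : AdmissiblePath n
  order : List (Angle n)
  nodup : order.Nodup
  edges : ∀ θ ∈ order, θ ∈ path.mult.support

/-- A pair `(Λ, l)`: an admissible path with the set of its edges labeled `h`. -/
structure LabeledPath (n : ℕ) where
  path : AdmissiblePath n
  hEdges : Finset (Angle n)
  edges : hEdges ⊆ path.mult.support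

/-- The representative in `[0, 2πn)` of an angle. -/
def rep {n : ℕ} [NeZero n] (θ : Angle n) : ℝ := (AddCircle.equivIco (2 * π * n) 0 θ : ℝ)

/-- The sign of the permutation that sorts a list of distinct angles, that is `(-1)` to the number
of its inversions, with respect to a fixed auxiliary ordering of the circle. -/
def orderSign {n : ℕ} [NeZero n] : List (Angle n) → ℤ
  | [] => 1
  | a :: l => (-1) ^ (l.countP fun b => decide (rep b < rep a)) * orderSign l

/-- For two orderings `o`, `o'` of the same set, the sign of the permutation relating them. -/
def reorderSign {n : ℕ} [NeZero n] (o o' : List (Angle n)) : ℤ := orderSign o * orderSign o'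

theorem rep_injective {n : ℕ} [NeZero n] : Function.Injective (rep (n := n)) := fun _ _ h =>
  (AddCircle.equivIco (2 * π * n) 0).injective (Subtype.ext h)

/-- An adjacent transposition changes the sign. -/
theorem orderSign_swap {n : ℕ} [NeZero n] (l r : List (Angle n)) {a b : Angle n} (hab : a ≠ b) :
    orderSign (l ++ a :: b :: r) = -orderSign (l ++ b :: a :: r) := by
  induction l with
  | nil =>
    rcases lt_or_gt_of_ne (fun h => hab (rep_injective h)) with h | h
    · simp [orderSign, h, h.not_gt, pow_succ]; ring
    · simp [orderSign, h, h.not_gt, pow_succ]; ring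
  | cons c l ih =>
    have hc : ∀ p : Angle n → Bool,
        (l ++ a :: b :: r).countP p = (l ++ b :: a :: r).countP p := fun p =>
      ((List.Perm.swap b a r).append_left l).countP_eq p
    simp only [List.cons_append, orderSign, ih, hc]; ring

/-- The module `C̃_*(2πn) = ⨁_Γ C̃_*(2πn; Γ)`: the free `ℤ`-module with one basis element for each
pair `(Λ, l)`, for admissible paths `Λ` of rotation number `n` and any period.  The triple
`(Λ, l, o)` is `±` the basis element, see `Generator.toChain`. -/
abbrev Chain (n : ℕ) : Type := LabeledPath n →₀ ℤ

namespace Generator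

variable {n : ℕ}

/-- The underlying pair `(Λ, l)`. -/
def labeled (α : Generator n) : LabeledPath n where
  path := α.path
  hEdges := α.order.toFinset
  edges _ hθ := α.edges _ (List.mem_toFinset.mp hθ)

/-- The element of the chain module given by `(Λ, l, o)`.  By `orderSign_swap`, an odd reordering of
the `h` edges changes its sign and an even one does not change it. -/
def toChain [NeZero n] (α : Generator n) : Chain n :=
  Finsupp.single α.labeled (orderSign α.order)

/-- The coefficient `⟨x, β⟩` of the generator `β` in the chain `x`. -/
def coeff [NeZero n] (x : Chain n) (β : Generator n) : ℤ := orderSign β.order * x β.labeled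

end Generator

namespace LabeledPath

variable {n : ℕ}

/-- A triple `(Λ, l, o)` over the pair `(Λ, l)`, with an arbitrarily chosen ordering `o`. -/
def toGenerator (a : LabeledPath n) : Generator n where
  path := a.path
  order := a.hEdges.toList
  nodup := a.hEdges.nodup_toList
  edges θ hθ := a.edges (Finset.mem_toList.mp hθ)

/-- Translation by `w ∈ ℤ²`. -/
def translate (w : ℤ × ℤ) (a : LabeledPath n) : LabeledPath n where
  path := a.path.translate w
  hEdges := a.hEdges
  edges := a.edges

end LabeledPath

/-- The action of `ℤ²` on the chain module by translation in the plane. -/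
def translation (n : ℕ) : Multiplicative (ℤ × ℤ) →* Module.End ℤ (Chain n) where
  toFun w := Finsupp.lmapDomain ℤ ℤ (LabeledPath.translate w.toAdd)
  map_one' := by
    have h : LabeledPath.translate (n := n) (Multiplicative.toAdd 1) = id := by
      funext a; simp [LabeledPath.translate, AdmissiblePath.translate]
    rw [h, Finsupp.lmapDomain_id]; rfl
  map_mul' v w := by
    have h : LabeledPath.translate (n := n) (v * w).toAdd =
        LabeledPath.translate v.toAdd ∘ LabeledPath.translate w.toAdd := by
      funext a
      simp [LabeledPath.translate, AdmissiblePath.translate, add_assoc,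
        add_comm (Multiplicative.toAdd v)]
    rw [h, Finsupp.lmapDomain_comp]; rfl

/-- The `ℤ[ℤ²]`-module structure on `C̃_*(2πn)`: the group element `w` acts by translation. -/
instance instGroupRingModule (n : ℕ) : Module (AddMonoidAlgebra ℤ (ℤ × ℤ)) (Chain n) :=
  Module.compHom (Chain n)
    (AddMonoidAlgebra.lift ℤ (Module.End ℤ (Chain n)) (ℤ × ℤ) (translation n)).toRingHom

theorem single_smul {n : ℕ} (w : ℤ × ℤ) (x : Chain n) :
    (AddMonoidAlgebra.single w 1 : AddMonoidAlgebra ℤ (ℤ × ℤ)) • x =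
      Finsupp.mapDomain (LabeledPath.translate w) x := by
  change (AddMonoidAlgebra.lift ℤ (Module.End ℤ (Chain n)) (ℤ × ℤ) (translation n)
    (AddMonoidAlgebra.single w 1)) x = _
  rw [AddMonoidAlgebra.lift_single]
  simp [translation]

/-! ### The combinatorial differential -/

open AdmissiblePath

variable {n : ℕ} [NeZero n]

/-- `β` is obtained from `α` by rounding the corner between `θ₁` and `θ₂` and locally losing one
`h`, and `s = ±1` is the sign of this contribution to the differential.  Here `r` lists the `h`
edges outside `[θ₁, θ₂]`, which are common to `α` and `β`.
* If only `θ₁` (resp. only `θ₂`) is labeled `h` in `α`, then no edge of `β` in `[θ₁, θ₂]` is labeled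
  `h`; when the `h` edges of `α` are ordered as `r, θ₁` (resp. `r, θ₂`) and those of `β` as `r`,
  the sign is `-1` (resp. `+1`).
* If both are labeled `h` in `α`, then exactly one edge `η` of `β` in `[θ₁, θ₂]` is labeled `h`;
  when the `h` edges of `α` are ordered as `r, θ₁, θ₂` and those of `β` as `r, η`, the sign
  is `+1`. -/
def IsDeltaTerm (α β : Generator n) (θ₁ θ₂ : ℝ) (s : ℤ) : Prop :=
  IsRounding α.path θ₁ θ₂ β.path ∧
  ∃ r : List (Angle n), (∀ η ∈ r, η ∉ arc n θ₁ θ₂) ∧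
    ((α.order.Perm (r ++ [(θ₁ : Angle n)]) ∧ β.order.Perm r ∧
        s = -(reorderSign α.order (r ++ [(θ₁ : Angle n)]) * reorderSign β.order r)) ∨
      (α.order.Perm (r ++ [(θ₂ : Angle n)]) ∧ β.order.Perm r ∧
        s = reorderSign α.order (r ++ [(θ₂ : Angle n)]) * reorderSign β.order r) ∨
      (∃ η ∈ arc n θ₁ θ₂,
        α.order.Perm (r ++ [(θ₁ : Angle n), (θ₂ : Angle n)]) ∧ β.order.Perm (r ++ [η]) ∧
        s = reorderSign α.order (r ++ [(θ₁ : Angle n), (θ₂ : Angle n)]) *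
          reorderSign β.order (r ++ [η])))

/-- The differential coefficient `⟨δα, β⟩ ∈ {1, -1, 0}`. -/
def deltaCoeff (α β : Generator n) : ℤ :=
  (if ∃ θ₁ θ₂, IsDeltaTerm α β θ₁ θ₂ 1 then 1 else 0) -
    (if ∃ θ₁ θ₂, IsDeltaTerm α β θ₁ θ₂ (-1) then 1 else 0)

variable (n) in
/-- The combinatorial differential: `δα = ∑ ⟨δα, β⟩ β`, the sum over all generators `β` up to sign.
Only finitely many terms are nonzero.  The definition is on the basis element `a` of `Chain n`,
which is `orderSign` times the generator `a.toGenerator`. -/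
def delta : Chain n →ₗ[ℤ] Chain n :=
  Finsupp.linearCombination ℤ fun a : LabeledPath n =>
    orderSign a.toGenerator.order •
      ∑ᶠ b : LabeledPath n, deltaCoeff a.toGenerator b.toGenerator • b.toGenerator.toChain

/-! ### The relative grading -/

/-- `2 ∫ x dy` along the straight segment from `p` to `q`. -/
def twiceSegment (p q : ℤ × ℤ) : ℤ := (p.1 + q.1) * (q.2 - p.2)

/-- `2 ∫ x dy` along the polygonal path `Λ` restricted to `[0, 2πn]`, from `Λ.pos 0` to
`Λ.pos (2πn) = Λ.pos 0 + Γ`. -/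
def twicePath (Λ : AdmissiblePath n) : ℤ :=
  ∑ᶠ θ ∈ Set.Ioc (0 : ℝ) (2 * π * n), twiceSegment (Λ.left θ) (Λ.pos θ)

/-- The relative index `I(α, β) = 2 ∫_P x dy + (ℓ(α) - #h(α)) - (ℓ(β) - #h(β))` of generators of
the same period `Γ`.  The loop `P = Λ(α)|[t, t+2πn] + η' - Λ(β)|[t, t+2πn] - η` is formed with `t`
just after `0` and with `η` the straight segment; the index does not depend on these choices. -/
def relIndex (α β : Generator n) : ℤ :=
  (twicePath α.path
    + twiceSegment (α.path.pos 0 + α.path.period) (β.path.pos 0 + β.path.period)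
    - twicePath β.path
    - twiceSegment (α.path.pos 0) (β.path.pos 0))
  + (((α.path.mult.sum fun _ m => m : ℕ) : ℤ) - α.order.length)
  - (((β.path.mult.sum fun _ m => m : ℕ) : ℤ) - β.order.length)

/-! ### The axioms -/

/-- The edges of `α` and `β` at angle `θ` agree: their adjacent corners map to the same points. -/
def Agree (α β : Generator n) (θ : ℝ) : Prop :=
  α.path.IsEdge θ ∧ β.path.IsEdge θ ∧
    α.path.left θ = β.path.left θ ∧ α.path.pos θ = β.path.pos θ

/-- The edges of `α` and `β` at angle `θ` partially agree: their adjacent corners map to points on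
the same line (which then has direction `(x_θ, y_θ)`). -/
def PartiallyAgree (α β : Generator n) (θ : ℝ) : Prop :=
  α.path.IsEdge θ ∧ β.path.IsEdge θ ∧
    (dirVec θ).1 * (β.path.pos θ - α.path.pos θ).2
      - (dirVec θ).2 * (β.path.pos θ - α.path.pos θ).1 = 0

/-- The set `D(α, β)`. -/
def disagreement (α β : Generator n) : Set (Angle n) :=
  closure {x | ∃ t : ℝ, (t : Angle n) = x ∧ ¬ α.path.IsEdge t ∧ ¬ β.path.IsEdge t ∧
    α.path.pos t ≠ β.path.pos t}

/-- The Label Matching condition on a pair of generators. -/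
def LabelsMatch (α β : Generator n) : Prop :=
  ∀ θ : ℝ,
    (Agree α β θ → ((θ : Angle n) ∈ α.order ↔ (θ : Angle n) ∈ β.order)) ∧
    (PartiallyAgree α β θ → (θ : Angle n) ∈ β.order → (θ : Angle n) ∈ α.order)

/-- `α'`, `β'` are obtained from `α`, `β` by removing matching edges: if the edges at `θ` (partially)
agree, then the edge of `β` is removed and that of `α` is shortened by the same amount (so that it
is removed too if they agree).  The list `L` consists of the `h` edges of `β` that (partially) agree
with an `h` edge of `α`; they are ordered first and in the same order, and the rest of the orderings
of `α` and `β` are the orderings, and hence give the labels, of `α'` and `β'`. -/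
structure IsLocalReduction (α β α' β' : Generator n) : Prop where
  mult_match : ∀ θ : ℝ, PartiallyAgree α β θ →
    α'.path.mult (θ : Angle n) + β.path.mult (θ : Angle n) = α.path.mult (θ : Angle n) ∧
      β'.path.mult (θ : Angle n) = 0
  mult_other : ∀ θ : ℝ, ¬ PartiallyAgree α β θ →
    α'.path.mult (θ : Angle n) = α.path.mult (θ : Angle n) ∧
      β'.path.mult (θ : Angle n) = β.path.mult (θ : Angle n)
  pos : ∀ t : ℝ, α.path.pos t - β.path.pos t = α'.path.pos t - β'.path.pos t
  order : ∃ L : List (Angle n),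
    (∀ x ∈ L, ∃ θ : ℝ, (θ : Angle n) = x ∧ PartiallyAgree α β θ) ∧
      α.order = L ++ α'.order ∧ β.order = L ++ β'.order

/-- `β` is obtained from `α` by simple rounding: exactly one edge is created by the rounding, and it
has multiplicity one. -/
def IsSimpleRounding (α β : Generator n) : Prop :=
  ∃ θ₁ θ₂ : ℝ, (∃ s, IsDeltaTerm α β θ₁ θ₂ s) ∧
    ∃ θ ∈ Set.Ioo θ₁ θ₂, β.path.mult (θ : Angle n) = 1 ∧
      ∀ θ' ∈ Set.Ioo θ₁ θ₂, β.path.IsEdge θ' → θ' = θ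

/-- `β` is obtained from `α` by degenerate rounding: `α` turns by angle `π` at the rounded
corner. -/
def IsDegenerateRounding (α β : Generator n) : Prop :=
  ∃ θ₁ θ₂ : ℝ, (∃ s, IsDeltaTerm α β θ₁ θ₂ s) ∧ θ₂ - θ₁ = π

/-- The differential coefficient `⟨∂α, β⟩`. -/
def diffCoeff (d : Chain n →ₗ[AddMonoidAlgebra ℤ (ℤ × ℤ)] Chain n) (α β : Generator n) : ℤ :=
  Generator.coeff (d α.toChain) β

variable (d : Chain n →ₗ[AddMonoidAlgebra ℤ (ℤ × ℤ)] Chain n)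

/-- Index: `d` respects the decomposition over the periods and has degree `-1`. -/
def AxiomIndex : Prop :=
  ∀ α β : Generator n, diffCoeff d α β ≠ 0 →
    α.path.period = β.path.period ∧ relIndex α β = 1

/-- Nesting. -/
def AxiomNesting : Prop :=
  ∀ α β : Generator n, α.path.period = β.path.period → diffCoeff d α β ≠ 0 →
    IsLeftOf β.path α.path

/-- Label Matching. -/
def AxiomLabelMatching : Prop :=
  ∀ α β : Generator n, α.path.period = β.path.period → diffCoeff d α β ≠ 0 → LabelsMatch α β

/-- Connectedness (the empty set counts as connected). -/
def AxiomConnectedness : Prop :=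
  ∀ α β : Generator n, α.path.period = β.path.period → diffCoeff d α β ≠ 0 →
    IsPreconnected (disagreement α β)

/-- No Double Rounding. -/
def AxiomNoDoubleRounding : Prop :=
  ∀ α β : Generator n, α.path.period = β.path.period → diffCoeff d α β ≠ 0 →
    (α.path.mult.support.filter (· ∈ disagreement α β)).card ≠ 3

/-- Locality. -/
def AxiomLocality : Prop :=
  ∀ α β α' β' : Generator n, α.path.period = β.path.period →
    IsLeftOf β.path α.path → LabelsMatch α β → IsLocalReduction α β α' β' →
    diffCoeff d α β = diffCoeff d α' β'

/-- Simple Rounding. -/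
def AxiomSimpleRounding : Prop :=
  ∀ α β : Generator n, IsSimpleRounding α β → diffCoeff d α β = deltaCoeff α β

/-- Degenerate Rounding. -/
def AxiomDegenerateRounding : Prop :=
  ∀ α β : Generator n, IsDegenerateRounding α β → diffCoeff d α β = deltaCoeff α β

end PolygonComplex

end

/-!
The proof has two halves: every nonzero coefficient `⟨∂α, β⟩` belongs to a term of the combinatorial
differential, and every such term has the prescribed coefficient. Since a linear map is determined
by its coefficients (`eq_delta_of_diffCoeff_eq`), this suffices.

**Nonzero coefficients.** Summation by parts writes the index `I(α, β)` as a sum over the angles of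
the edges (`relIndex_eq_sum`). The contribution of the angle `θ` is governed by the height, the
determinant of the direction of `θ` with `μ - λ`; Nesting makes the heights nonnegative and Label
Matching then makes all contributions nonnegative (`indexTerm_nonneg`). An edge of `λ` with
`μ ≠ λ` on both sides contributes at least one, so index one allows at most one such edge, and No
Double Rounding and Connectedness exclude it: the paths differ at exactly one corner of `λ`
(`exists_component`). There, index one forces every new edge to have height one and both edges
adjacent to the corner to be shortened by one unit. Having height one, i.e. lying on lines at lattice
distance one from the corner, characterizes the boundary of the convex hull of the other lattice
points of the triangle (`IsRounding.isUnimodularCut`, `IsUnimodularCut.isRounding`): a line at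
distance at least two could be moved inwards past a lattice point. Hence `μ` is the rounding, and the
contributions of the labels say that exactly one `h` is lost (`exists_isDeltaTerm`).

**Prescribed coefficients.** The coefficient for rounding a corner between edges `x` and `y` is
computed by induction on their determinant (`diffCoeff_of_isDeltaTerm`). Determinant zero is
degenerate rounding, and determinant one is simple rounding. Otherwise Locality reduces to the path
`P` with the two edges `x`, `y` only and its rounding `Q` (`diffCoeff_eq_of_reduction`). Let `g` be
the last edge of `Q`, and add to `P` and `Q` an edge `z` opposite to `g`. From `P + z` one gets to
`Q - g` by rounding the corner `x, y` and then the two-gon `g, z`, or by rounding the corner `y, z`,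
which has determinant one because `g` has height one, and then the corner between `x` and the new
edge `r = y - g`, whose determinant is smaller (`exists_isSquare`). There is no other way
(`diffCoeff_square`): rounding the remaining corner of `P + z` would leave the region between the two
paths. As `∂² = 0`, the two contributions cancel, and all coefficients but the wanted one are known;
the four possible labelings are treated in `diffCoeff_of_isSquare`.
-/

noncomputable section

set_option linter.unusedSectionVars false

namespace PolygonComplex

open AdmissiblePath

variable {n : ℕ}

/-! ### Determinants and directions -/

/-- The determinant of two integer vectors. -/
def cross (v w : ℤ × ℤ) : ℤ := v.1 * w.2 - v.2 * w.1

/-- The determinant as a function of its second argument. -/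
def crossHom (v : ℤ × ℤ) : ℤ × ℤ →+ ℤ where
  toFun := cross v
  map_zero' := by simp [cross]
  map_add' x y := by simp only [cross, Prod.fst_add, Prod.snd_add]; ring

/-- `detDir t` as a homomorphism. -/
def detDirHom (t : ℝ) : ℤ × ℤ →+ ℝ where
  toFun := detDir t
  map_zero' := by simp [detDir]
  map_add' x y := by simp only [detDir, Prod.fst_add, Prod.snd_add]; push_cast; ring

@[simp] theorem crossHom_apply (v w : ℤ × ℤ) : crossHom v w = cross v w := rfl

@[simp] theorem detDirHom_apply (t : ℝ) (w : ℤ × ℤ) : detDirHom t w = detDir t w := rfl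

theorem cross_add (v x y : ℤ × ℤ) : cross v (x + y) = cross v x + cross v y :=
  (crossHom v).map_add x y

theorem cross_sub (v x y : ℤ × ℤ) : cross v (x - y) = cross v x - cross v y :=
  (crossHom v).map_sub x y

theorem cross_neg (v x : ℤ × ℤ) : cross v (-x) = -cross v x := (crossHom v).map_neg x

theorem cross_zsmul (v x : ℤ × ℤ) (k : ℤ) : cross v (k • x) = k * cross v x := by
  simpa using (crossHom v).map_zsmul k x

theorem cross_nsmul (v x : ℤ × ℤ) (k : ℕ) : cross v (k • x) = k * cross v x := by
  simpa using (crossHom v).map_nsmul k x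

@[simp] theorem cross_zero (v : ℤ × ℤ) : cross v 0 = 0 := (crossHom v).map_zero

@[simp] theorem cross_self (v : ℤ × ℤ) : cross v v = 0 := by simp [cross, mul_comm]

theorem cross_swap (v w : ℤ × ℤ) : cross v w = -cross w v := by simp only [cross]; ring

theorem add_cross (x y v : ℤ × ℤ) : cross (x + y) v = cross x v + cross y v := by
  rw [cross_swap, cross_add, cross_swap v x, cross_swap v y]; ring

theorem neg_cross (x v : ℤ × ℤ) : cross (-x) v = -cross x v := by
  rw [cross_swap, cross_neg, cross_swap v x, neg_neg]

theorem detDir_add (t : ℝ) (x y : ℤ × ℤ) : detDir t (x + y) = detDir t x + detDir t y :=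
  (detDirHom t).map_add x y

theorem detDir_sub (t : ℝ) (x y : ℤ × ℤ) : detDir t (x - y) = detDir t x - detDir t y :=
  (detDirHom t).map_sub x y

theorem detDir_neg (t : ℝ) (x : ℤ × ℤ) : detDir t (-x) = -detDir t x := (detDirHom t).map_neg x

@[simp] theorem detDir_zero (t : ℝ) : detDir t 0 = 0 := (detDirHom t).map_zero

theorem detDir_zsmul (t : ℝ) (x : ℤ × ℤ) (k : ℤ) : detDir t (k • x) = k * detDir t x := by
  simpa using (detDirHom t).map_zsmul k x

theorem detDir_add_pi (t : ℝ) (x : ℤ × ℤ) : detDir (t + π) x = -detDir t x := by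
  simp only [detDir, cos_add_pi, sin_add_pi]; ring

/-- An integer vector parallel to a primitive one is an integer multiple of it. -/
theorem exists_zsmul_of_cross_eq_zero {v w : ℤ × ℤ} (hv : IsCoprime v.1 v.2)
    (h : cross v w = 0) : ∃ k : ℤ, w = k • v := by
  obtain ⟨a, b, hab⟩ := hv
  refine ⟨a * w.1 + b * w.2, Prod.ext ?_ ?_⟩
  · simp only [cross] at h
    simp only [Prod.smul_fst, smul_eq_mul]
    linear_combination (-w.1) * hab + (-b) * h
  · simp only [cross] at h
    simp only [Prod.smul_snd, smul_eq_mul]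
    linear_combination (-w.2) * hab + a * h

theorem isCoprime_of_cross_eq_one_right {v w : ℤ × ℤ} (h : cross v w = 1) :
    IsCoprime w.1 w.2 :=
  ⟨-v.2, v.1, by simp only [cross] at h; linear_combination h⟩

/-- Rotating a ray through an angle less than `π` keeps a vector on its left if this holds at
both ends. -/
theorem detDir_nonneg_of_mem_Icc {a b t : ℝ} {v : ℤ × ℤ} (hab : b - a < π) (hat : a ≤ t)
    (htb : t ≤ b) (ha : 0 ≤ detDir a v) (hb : 0 ≤ detDir b v) : 0 ≤ detDir t v := by
  rcases hat.eq_or_lt with rfl | hat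
  · exact ha
  have hs : 0 < sin (b - a) := sin_pos_of_pos_of_lt_pi (by linarith) hab
  have h1 : 0 ≤ sin (b - t) := sin_nonneg_of_nonneg_of_le_pi (by linarith) (by linarith)
  have h2 : 0 ≤ sin (t - a) := sin_nonneg_of_nonneg_of_le_pi (by linarith) (by linarith)
  have key : sin (b - a) * detDir t v = sin (b - t) * detDir a v + sin (t - a) * detDir b v := by
    simp only [detDir, sin_sub]
    ring
  have := add_nonneg (mul_nonneg h1 ha) (mul_nonneg h2 hb)
  rw [← key] at this
  exact nonneg_of_mul_nonneg_right this hs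

theorem eq_zero_of_detDir_eq_zero {s t : ℝ} {v : ℤ × ℤ} (hst : s < t) (hpi : t - s < π)
    (hs : detDir s v = 0) (ht : detDir t v = 0) : v = 0 := by
  have hsin : sin (t - s) ≠ 0 := (sin_pos_of_pos_of_lt_pi (by linarith) hpi).ne'
  simp only [detDir] at hs ht
  have h1 : sin (t - s) * (v.1 : ℝ) = 0 := by
    rw [sin_sub]; linear_combination cos t * hs - cos s * ht
  have h2 : sin (t - s) * (v.2 : ℝ) = 0 := by
    rw [sin_sub]; linear_combination sin t * hs - sin s * ht
  refine Prod.ext ?_ ?_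
  · exact_mod_cast (mul_eq_zero.mp h1).resolve_left hsin
  · exact_mod_cast (mul_eq_zero.mp h2).resolve_left hsin

theorem IsDirection.isRationalAngle {θ : ℝ} {v : ℤ × ℤ} (h : IsDirection θ v) :
    IsRationalAngle θ := by
  obtain ⟨-, r, hr, hc, hs⟩ := h
  by_cases h0 : Real.cos θ = 0
  · exact Or.inl h0
  · refine Or.inr ⟨(v.2 : ℚ) / v.1, ?_⟩
    have hv : (v.1 : ℝ) ≠ 0 := fun h => h0 (by rw [hc, h, mul_zero])
    rw [tan_eq_sin_div_cos, hc, hs]; push_cast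
    field_simp

theorem IsDirection.unique {θ : ℝ} {v w : ℤ × ℤ} (hv : IsDirection θ v) (hw : IsDirection θ w) :
    v = w := by
  obtain ⟨hvc, r, hr, hrc, hrs⟩ := hv
  obtain ⟨hwc, s, hs, hsc, hss⟩ := hw
  have hx : cross v w = 0 := by
    have : (r * s) * (cross v w : ℝ) = 0 := by
      simp only [cross]; push_cast
      have h1 : r * v.1 = s * w.1 := hrc.symm.trans hsc
      have h2 : r * v.2 = s * w.2 := hrs.symm.trans hss
      linear_combination (s * w.2) * h1 - (s * w.1) * h2
    exact_mod_cast (mul_eq_zero.mp this).resolve_left (mul_pos hr hs).ne'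
  obtain ⟨k, hk⟩ := exists_zsmul_of_cross_eq_zero hvc hx
  have hk1 : IsUnit k := by
    rw [hk] at hwc
    exact hwc.isUnit_of_dvd' ⟨v.1, rfl⟩ ⟨v.2, rfl⟩
  rcases Int.isUnit_iff.mp hk1 with rfl | rfl
  · rw [hk, one_smul]
  · exfalso
    rw [hk] at hsc hss
    simp only [neg_smul, one_smul, Prod.fst_neg, Prod.snd_neg, Int.cast_neg] at hsc hss
    have h1 : (r + s) * v.1 = 0 := by linear_combination hsc - hrc
    have h2 : (r + s) * v.2 = 0 := by linear_combination hss - hrs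
    have h3 := (mul_eq_zero.mp h1).resolve_left (by positivity)
    have h4 := (mul_eq_zero.mp h2).resolve_left (by positivity)
    have := sin_sq_add_cos_sq θ
    rw [hrc, hrs, h3, h4] at this
    simp at this

theorem isDirection_dirVec {θ : ℝ} (h : IsRationalAngle θ) : IsDirection θ (dirVec θ) := by
  have := h.exists_isDirection
  rw [dirVec, dif_pos this]
  exact this.choose_spec

theorem IsDirection.dirVec_eq {θ : ℝ} {v : ℤ × ℤ} (h : IsDirection θ v) : dirVec θ = v :=
  (isDirection_dirVec h.isRationalAngle).unique h

theorem dirVec_isCoprime {θ : ℝ} (h : IsRationalAngle θ) :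
    IsCoprime (dirVec θ).1 (dirVec θ).2 := (isDirection_dirVec h).1

theorem isDirection_add_pi {θ : ℝ} (h : IsRationalAngle θ) :
    IsDirection (θ + π) (-dirVec θ) := by
  obtain ⟨hc, r, hr, h1, h2⟩ := isDirection_dirVec h
  refine ⟨hc.neg_neg, r, hr, ?_, ?_⟩
  · rw [cos_add_pi, h1]; simp
  · rw [sin_add_pi, h2]; simp

theorem dirVec_add_pi {θ : ℝ} (h : IsRationalAngle θ) : dirVec (θ + π) = -dirVec θ :=
  (isDirection_add_pi h).dirVec_eq

theorem isDirection_add_int_mul (θ : ℝ) (n : ℕ) (k : ℤ) :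
    IsDirection (θ + k * (2 * π * n)) = IsDirection θ := by
  funext v
  have : θ + k * (2 * π * n) = θ + ((k * n : ℤ) : ℝ) * (2 * π) := by push_cast; ring
  rw [this]
  simp only [IsDirection, cos_add_int_mul_two_pi, sin_add_int_mul_two_pi]

theorem dirVec_add_int_mul (θ : ℝ) (n : ℕ) (k : ℤ) : dirVec (θ + k * (2 * π * n)) = dirVec θ := by
  simp only [dirVec, isDirection_add_int_mul]

theorem detDir_add_int_mul (θ : ℝ) (n : ℕ) (k : ℤ) (v : ℤ × ℤ) :
    detDir (θ + k * (2 * π * n)) v = detDir θ v := by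
  have : θ + k * (2 * π * n) = θ + ((k * n : ℤ) : ℝ) * (2 * π) := by push_cast; ring
  rw [this]
  simp only [detDir, cos_add_int_mul_two_pi, sin_add_int_mul_two_pi]

theorem exists_detDir_dirVec {θ : ℝ} (h : IsRationalAngle θ) :
    ∃ ρ : ℝ, 0 < ρ ∧ ∀ t, detDir t (dirVec θ) = ρ * sin (θ - t) := by
  obtain ⟨-, r, hr, h1, h2⟩ := isDirection_dirVec h
  refine ⟨r⁻¹, inv_pos.mpr hr, fun t => ?_⟩
  rw [sin_sub, h1, h2, detDir]; field_simp

theorem exists_detDir_eq_mul_cross {θ : ℝ} (h : IsRationalAngle θ) :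
    ∃ r : ℝ, 0 < r ∧ ∀ v, detDir θ v = r * cross (dirVec θ) v := by
  obtain ⟨-, r, hr, h1, h2⟩ := isDirection_dirVec h
  refine ⟨r, hr, fun v => ?_⟩
  rw [detDir, h1, h2, cross]; push_cast; ring

theorem detDir_dirVec_pos {θ t : ℝ} (h : IsRationalAngle θ) (h1 : t < θ) (h2 : θ < t + π) :
    0 < detDir t (dirVec θ) := by
  obtain ⟨ρ, hρ, e⟩ := exists_detDir_dirVec h
  rw [e]; exact mul_pos hρ (sin_pos_of_pos_of_lt_pi (by linarith) (by linarith))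

theorem detDir_dirVec_neg {θ t : ℝ} (h : IsRationalAngle θ) (h1 : θ < t) (h2 : t < θ + π) :
    detDir t (dirVec θ) < 0 := by
  obtain ⟨ρ, hρ, e⟩ := exists_detDir_dirVec h
  rw [e]
  exact mul_neg_of_pos_of_neg hρ (sin_neg_of_neg_of_neg_pi_lt (by linarith) (by linarith))

theorem detDir_dirVec_self {θ : ℝ} (h : IsRationalAngle θ) : detDir θ (dirVec θ) = 0 := by
  obtain ⟨ρ, -, e⟩ := exists_detDir_dirVec h
  rw [e]; simp

theorem cross_pos_iff {θ : ℝ} (h : IsRationalAngle θ) (v : ℤ × ℤ) :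
    0 < cross (dirVec θ) v ↔ 0 < detDir θ v := by
  obtain ⟨r, hr, e⟩ := exists_detDir_eq_mul_cross h
  rw [e, mul_pos_iff_of_pos_left hr, Int.cast_pos]

theorem cross_nonneg_iff {θ : ℝ} (h : IsRationalAngle θ) (v : ℤ × ℤ) :
    0 ≤ cross (dirVec θ) v ↔ 0 ≤ detDir θ v := by
  obtain ⟨r, hr, e⟩ := exists_detDir_eq_mul_cross h
  rw [e, mul_nonneg_iff_of_pos_left hr, Int.cast_nonneg_iff]

theorem cross_dirVec_pos {θ φ : ℝ} (hθ : IsRationalAngle θ) (hφ : IsRationalAngle φ)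
    (h1 : θ < φ) (h2 : φ < θ + π) : 0 < cross (dirVec θ) (dirVec φ) :=
  (cross_pos_iff hθ _).mpr (detDir_dirVec_pos hφ h1 h2)

theorem dirVec_ne_zero {θ : ℝ} (h : IsRationalAngle θ) : dirVec θ ≠ 0 := fun h0 => by
  have := dirVec_isCoprime h
  rw [h0] at this
  exact not_isCoprime_zero_zero this

/-- A primitive vector in the open cone spanned by two directions has an angle between theirs. -/
theorem exists_isDirection_of_cross_pos {a b : ℝ} {w : ℤ × ℤ} (ha : IsRationalAngle a)
    (hb : IsRationalAngle b) (hab : a < b) (hw : IsCoprime w.1 w.2)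
    (h1 : 0 < cross (dirVec a) w) (h2 : 0 < cross w (dirVec b)) :
    ∃ θ ∈ Set.Ioo a b, IsDirection θ w := by
  have h1' : 0 < detDir a w := (cross_pos_iff ha w).mp h1
  set z : ℂ := ⟨cos a * w.1 + sin a * w.2, detDir a w⟩ with hz
  have hz0 : z ≠ 0 := fun h => by
    have := congrArg Complex.im h
    simp [hz] at this; linarith
  have habs : 0 < ‖z‖ := norm_pos_iff.mpr hz0
  have hcos : ‖z‖ * cos z.arg = cos a * w.1 + sin a * w.2 := Complex.norm_mul_cos_arg z
  have hsin : ‖z‖ * sin z.arg = cos a * w.2 - sin a * w.1 := Complex.norm_mul_sin_arg z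
  have hcs := sin_sq_add_cos_sq a
  have hdir : IsDirection (a + z.arg) w := by
    refine ⟨hw, ‖z‖⁻¹, inv_pos.mpr habs, ?_, ?_⟩
    · rw [cos_add]; field_simp
      linear_combination cos a * hcos - sin a * hsin + w.1 * hcs
    · rw [sin_add]; field_simp
      linear_combination sin a * hcos + cos a * hsin + w.2 * hcs
  have harg0 : 0 < z.arg := by
    rcases lt_or_ge 0 z.arg with h | h
    · exact h
    · have : sin z.arg ≤ 0 := sin_nonpos_of_nonpos_of_neg_pi_le h (Complex.neg_pi_lt_arg z).le
      have h' : ‖z‖ * sin z.arg ≤ 0 := mul_nonpos_of_nonneg_of_nonpos habs.le this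
      rw [hsin] at h'
      exact absurd h1' (not_lt.mpr h')
  have hargpi := Complex.arg_le_pi z
  refine ⟨a + z.arg, ⟨by linarith, ?_⟩, hdir⟩
  by_contra hcon
  push Not at hcon
  have hr := hdir.isRationalAngle
  rw [← hdir.dirVec_eq] at h2
  have h3 := (cross_pos_iff hr _).mp h2
  obtain ⟨ρ, hρ, e⟩ := exists_detDir_dirVec hb
  rw [e] at h3
  have : sin (b - (a + z.arg)) ≤ 0 :=
    sin_nonpos_of_nonpos_of_neg_pi_le (by linarith) (by linarith)
  nlinarith

/-! ### Edges and jumps of admissible paths -/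

theorem two_pi_le_period (n : ℕ) [NeZero n] : 2 * π ≤ 2 * π * n := by
  have : (1 : ℝ) ≤ n := by exact_mod_cast NeZero.one_le
  nlinarith [Real.pi_pos]

theorem coe_add_int_mul {n : ℕ} (θ : ℝ) (k : ℤ) :
    ((θ + k * (2 * π * n) : ℝ) : Angle n) = (θ : Angle n) := by
  rw [AddCircle.coe_add, ← zsmul_eq_mul, AddCircle.coe_zsmul, AddCircle.coe_period, smul_zero,
    add_zero]

theorem coe_eq_coe_iff {n : ℕ} {θ φ : ℝ} :
    (θ : Angle n) = (φ : Angle n) ↔ ∃ k : ℤ, φ = θ + k * (2 * π * n) := by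
  constructor
  · intro h
    have h0 : ((φ - θ : ℝ) : Angle n) = 0 := by rw [AddCircle.coe_sub, h, sub_self]
    obtain ⟨k, hk⟩ := (AddCircle.coe_eq_zero_iff _).mp h0
    exact ⟨k, by rw [zsmul_eq_mul] at hk; linarith⟩
  · rintro ⟨k, rfl⟩
    exact (coe_add_int_mul θ k).symm

/-- Two reals in a half-open interval of length `2πn` with the same class are equal. -/
theorem eq_of_coe_eq_coe {n : ℕ} [NeZero n] {a θ φ : ℝ} (h : (θ : Angle n) = (φ : Angle n))
    (h1 : a ≤ θ) (h2 : θ < a + 2 * π * n) (h3 : a ≤ φ) (h4 : φ < a + 2 * π * n) : θ = φ :=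
  (AddCircle.coe_eq_coe_iff_of_mem_Ico (hp := instFactAngle n) (a := a) ⟨h1, h2⟩ ⟨h3, h4⟩).mp h

/-- Every angle has a representative in a given half-open interval of length `2πn`. -/
theorem exists_int_add_mem_Ico (n : ℕ) [NeZero n] (a t : ℝ) :
    ∃ k : ℤ, a ≤ t + k * (2 * π * n) ∧ t + k * (2 * π * n) < a + 2 * π * n := by
  obtain ⟨k, hk, -⟩ := existsUnique_add_zsmul_mem_Ico (instFactAngle n).out t a
  rw [zsmul_eq_mul] at hk
  exact ⟨k, hk.1, hk.2⟩

theorem exists_coe_eq_mem_Ico {n : ℕ} [NeZero n] (a : ℝ) (x : Angle n) :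
    ∃ t : ℝ, (t : Angle n) = x ∧ a ≤ t ∧ t < a + 2 * π * n := by
  obtain ⟨t, rfl⟩ := QuotientAddGroup.mk_surjective x
  obtain ⟨k, h1, h2⟩ := exists_int_add_mem_Ico n a t
  exact ⟨_, coe_add_int_mul t k, h1, h2⟩

theorem mem_arc_iff {n : ℕ} {θ₁ θ₂ t : ℝ} :
    (t : Angle n) ∈ arc n θ₁ θ₂ ↔ ∃ k : ℤ, t + k * (2 * π * n) ∈ Set.Icc θ₁ θ₂ := by
  constructor
  · rintro ⟨s, hs, hst⟩
    obtain ⟨k, rfl⟩ := coe_eq_coe_iff.mp hst.symm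
    exact ⟨k, hs⟩
  · rintro ⟨k, hk⟩
    exact ⟨_, hk, coe_add_int_mul t k⟩

/-- Membership in an arc, for a representative in the period that starts with the arc. -/
theorem mem_arc_iff_of_mem_Ico {n : ℕ} [NeZero n] {θ₁ θ₂ t : ℝ} (h : θ₂ < θ₁ + 2 * π * n)
    (h1 : θ₁ ≤ t) (h2 : t < θ₁ + 2 * π * n) : (t : Angle n) ∈ arc n θ₁ θ₂ ↔ t ≤ θ₂ := by
  constructor
  · rintro ⟨s, hs, hst⟩
    have := eq_of_coe_eq_coe (a := θ₁) hst hs.1 (hs.2.trans_lt h) h1 h2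
    rw [← this]; exact hs.2
  · intro h
    exact ⟨t, ⟨h1, h⟩, rfl⟩

theorem arc_add_int_mul (n : ℕ) (θ₁ θ₂ : ℝ) (k : ℤ) :
    arc n (θ₁ + k * (2 * π * n)) (θ₂ + k * (2 * π * n)) = arc n θ₁ θ₂ := by
  ext x
  obtain ⟨t, rfl⟩ := QuotientAddGroup.mk_surjective x
  change (t : Angle n) ∈ _ ↔ (t : Angle n) ∈ _
  rw [mem_arc_iff, mem_arc_iff]
  constructor
  · rintro ⟨j, h1, h2⟩
    exact ⟨j - k, by push_cast; linarith, by push_cast; linarith⟩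
  · rintro ⟨j, h1, h2⟩
    exact ⟨j + k, by push_cast; linarith, by push_cast; linarith⟩

/-- A step function changes by the sum of its jumps. -/
theorem sum_jumps_eq {M : Type*} [AddCommGroup M] (K : Finset ℝ) (R L : ℝ → M) {a b : ℝ}
    (hR : ∀ s t, a ≤ s → s ≤ t → t ≤ b → (∀ θ ∈ Set.Ioc s t, θ ∉ K) → R t = R s)
    (hL : ∀ s t, a ≤ s → s < t → t ≤ b → (∀ θ ∈ Set.Ioo s t, θ ∉ K) → L t = R s) (t : ℝ)
    (htb : t ≤ b) : ∀ s, a ≤ s → s ≤ t → ∑ θ ∈ K with s < θ ∧ θ ≤ t, (R θ - L θ) = R t - R s := by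
  induction h : (K.filter fun θ => θ ≤ t).card using Nat.strong_induction_on generalizing t with
  | _ N ih =>
  intro s has hst
  by_cases hne : (K.filter fun θ => s < θ ∧ θ ≤ t).Nonempty
  · -- split off the last jump `m`
    obtain ⟨m, hm, hmax⟩ := Finset.exists_max_image _ id hne
    simp only [Finset.mem_filter, id] at hm hmax
    -- `u` is a time before `m` with no jumps in between
    obtain ⟨u, hsu, hum, hu⟩ : ∃ u, s ≤ u ∧ u < m ∧ ∀ θ ∈ Set.Ioo u m, θ ∉ K := by
      by_cases hne' : (K.filter fun θ => s < θ ∧ θ < m).Nonempty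
      · obtain ⟨u, hu, humax⟩ := Finset.exists_max_image _ id hne'
        simp only [Finset.mem_filter, id] at hu humax
        exact ⟨u, hu.2.1.le, hu.2.2, fun θ hθ hK =>
          absurd (humax θ ⟨hK, hu.2.1.trans hθ.1, hθ.2⟩) (not_le.mpr hθ.1)⟩
      · rw [Finset.not_nonempty_iff_eq_empty, Finset.filter_eq_empty_iff] at hne'
        exact ⟨s, le_rfl, hm.2.1, fun θ hθ hK => hne' hK ⟨hθ.1, hθ.2⟩⟩
    have hcard : (K.filter fun θ => θ ≤ u).card < N := by
      rw [← h]
      refine Finset.card_lt_card (Finset.ssubset_iff_subset_ne.mpr ⟨?_, ?_⟩)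
      · intro θ hθ
        simp only [Finset.mem_filter] at hθ ⊢
        exact ⟨hθ.1, hθ.2.trans (hum.le.trans hm.2.2)⟩
      · intro he
        have : m ∈ K.filter fun θ => θ ≤ u := by
          rw [he]; simp only [Finset.mem_filter]; exact ⟨hm.1, hm.2.2⟩
        exact absurd (Finset.mem_filter.mp this).2 (not_le.mpr hum)
    have hih := ih _ hcard u ((hum.le.trans hm.2.2).trans htb) rfl s has hsu
    have hset : (K.filter fun θ => s < θ ∧ θ ≤ t) =
        insert m (K.filter fun θ => s < θ ∧ θ ≤ u) := by
      ext θ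
      simp only [Finset.mem_filter, Finset.mem_insert]
      constructor
      · rintro ⟨hK, h1, h2⟩
        rcases (hmax θ ⟨hK, h1, h2⟩).eq_or_lt with h3 | h3
        · exact Or.inl h3
        · refine Or.inr ⟨hK, h1, ?_⟩
          by_contra hc
          exact hu θ ⟨not_le.mp hc, h3⟩ hK
      · rintro (rfl | ⟨hK, h1, h2⟩)
        · exact hm
        · exact ⟨hK, h1, h2.trans (hum.le.trans hm.2.2)⟩
    rw [hset, Finset.sum_insert (by simp [hum]), hih, hL u m (has.trans hsu) hum (hm.2.2.trans htb) hu,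
      hR m t (has.trans hm.2.1.le) hm.2.2 htb fun θ hθ hK => absurd (hmax θ ⟨hK, hm.2.1.trans hθ.1, hθ.2⟩)
        (not_le.mpr hθ.1)]
    abel
  · rw [Finset.not_nonempty_iff_eq_empty] at hne
    rw [hne, Finset.sum_empty, hR s t has hst htb, sub_self]
    intro θ hθ hK
    exact absurd hne (Finset.ne_empty_of_mem (a := θ) (by simp [hK, hθ.1, hθ.2]))

namespace AdmissiblePath

theorem mult_add_int_mul (Λ : AdmissiblePath n) (θ : ℝ) (k : ℤ) :
    Λ.mult ((θ + k * (2 * π * n) : ℝ) : Angle n) = Λ.mult (θ : Angle n) := by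
  rw [coe_add_int_mul]

theorem isEdge_add_int_mul {Λ : AdmissiblePath n} {θ : ℝ} (k : ℤ) :
    Λ.IsEdge (θ + k * (2 * π * n)) ↔ Λ.IsEdge θ := by
  simp only [IsEdge, mult_add_int_mul]

theorem IsEdge.isRationalAngle {Λ : AdmissiblePath n} {θ : ℝ} (h : Λ.IsEdge θ) :
    IsRationalAngle θ := Λ.rational θ h

theorem isEdge_iff_mem_support {Λ : AdmissiblePath n} {θ : ℝ} :
    Λ.IsEdge θ ↔ (θ : Angle n) ∈ Λ.mult.support := Finsupp.mem_support_iff.symm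

theorem pos_add_int_mul (Λ : AdmissiblePath n) (t : ℝ) (k : ℤ) :
    Λ.pos (t + k * (2 * π * n)) = Λ.pos t + k • Λ.period := by
  induction k using Int.induction_on with
  | zero => simp
  | succ i ih =>
    have : t + ((i + 1 : ℤ) : ℝ) * (2 * π * n) = (t + (i : ℤ) * (2 * π * n)) + 2 * π * n := by
      push_cast; ring
    rw [this, Λ.periodic, ih, add_smul, one_smul, add_assoc]
  | pred i ih =>
    have : t + ((-i : ℤ) : ℝ) * (2 * π * n) =
        (t + ((-i - 1 : ℤ) : ℝ) * (2 * π * n)) + 2 * π * n := by push_cast; ring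
    rw [this, Λ.periodic] at ih
    rw [sub_smul, one_smul, ← add_sub_assoc, ← ih, add_sub_cancel_right]

/-- For paths of the same period, the difference of positions is `2πn`-periodic. -/
theorem pos_sub_pos_add_int_mul {Λ Λ' : AdmissiblePath n} (h : Λ'.period = Λ.period) (t : ℝ)
    (k : ℤ) : Λ'.pos (t + k * (2 * π * n)) - Λ.pos (t + k * (2 * π * n)) =
      Λ'.pos t - Λ.pos t := by
  rw [pos_add_int_mul, pos_add_int_mul, h]; abel

theorem left_add_dirVec (Λ : AdmissiblePath n) (θ : ℝ) :
    Λ.left θ + Λ.mult (θ : Angle n) • dirVec θ = Λ.pos θ := sub_add_cancel _ _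

theorem left_eq_pos {Λ : AdmissiblePath n} {θ : ℝ} (h : ¬ Λ.IsEdge θ) :
    Λ.left θ = Λ.pos θ := by
  rw [IsEdge, not_not] at h
  rw [left, h, zero_smul, sub_zero]

variable [NeZero n]

theorem finite_edges (Λ : AdmissiblePath n) (s t : ℝ) : {θ ∈ Set.Icc s t | Λ.IsEdge θ}.Finite := by
  have hT : (0 : ℝ) < 2 * π * n := (instFactAngle n).out
  refine (Λ.mult.support.finite_toSet.biUnion (t := fun x => {θ ∈ Set.Icc s t | (θ : Angle n) = x})
    fun x _ => ?_).subset ?_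
  · obtain ⟨θ₀, rfl⟩ := QuotientAddGroup.mk_surjective x
    refine ((Set.finite_Icc ⌊(s - θ₀) / (2 * π * n)⌋ ⌈(t - θ₀) / (2 * π * n)⌉).image
      fun k : ℤ => θ₀ + k * (2 * π * n)).subset ?_
    rintro θ ⟨⟨h1, h2⟩, h⟩
    obtain ⟨k, rfl⟩ := coe_eq_coe_iff.mp h.symm
    refine ⟨k, ⟨?_, ?_⟩, rfl⟩
    · refine Int.floor_le_iff.mpr (lt_of_le_of_lt ?_ (lt_add_one (k : ℝ)))
      rw [div_le_iff₀ hT]; linarith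
    · refine Int.le_ceil_iff.mpr (lt_of_lt_of_le (sub_one_lt (k : ℝ)) ?_)
      rw [le_div_iff₀ hT]; linarith
  · rintro θ ⟨h1, h2⟩
    exact Set.mem_biUnion (x := (θ : Angle n)) (isEdge_iff_mem_support.mp h2) ⟨h1, rfl⟩

/-- The edges of `Λ` in `[s, t]`. -/
def edgesIcc (Λ : AdmissiblePath n) (s t : ℝ) : Finset ℝ := (Λ.finite_edges s t).toFinset

@[simp] theorem mem_edgesIcc {Λ : AdmissiblePath n} {s t θ : ℝ} :
    θ ∈ Λ.edgesIcc s t ↔ (s ≤ θ ∧ θ ≤ t) ∧ Λ.IsEdge θ := by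
  simp [edgesIcc]

/-- The edges of `Λ` in `(s, t]`. -/
def edgesIoc (Λ : AdmissiblePath n) (s t : ℝ) : Finset ℝ := (Λ.edgesIcc s t).filter fun θ => s < θ

@[simp] theorem mem_edgesIoc {Λ : AdmissiblePath n} {s t θ : ℝ} :
    θ ∈ Λ.edgesIoc s t ↔ (s < θ ∧ θ ≤ t) ∧ Λ.IsEdge θ := by
  simp only [edgesIoc, Finset.mem_filter, mem_edgesIcc]
  constructor
  · rintro ⟨⟨⟨-, h2⟩, h3⟩, h1⟩; exact ⟨⟨h1, h2⟩, h3⟩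
  · rintro ⟨⟨h1, h2⟩, h3⟩; exact ⟨⟨⟨h1.le, h2⟩, h3⟩, h1⟩

theorem pos_sub_pos (Λ : AdmissiblePath n) {s t : ℝ} (h : s ≤ t) :
    Λ.pos t - Λ.pos s = ∑ θ ∈ Λ.edgesIoc s t, Λ.mult (θ : Angle n) • dirVec θ := by
  rw [Λ.jump s t h]
  refine finsum_mem_eq_sum_of_inter_support_eq _ ?_
  ext θ
  simp only [Set.mem_inter_iff, Set.mem_Ioc, Function.mem_support, Finset.mem_coe, mem_edgesIoc]
  constructor
  · rintro ⟨h1, h2⟩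
    exact ⟨⟨h1, fun h0 => h2 (by rw [h0, zero_smul])⟩, h2⟩
  · rintro ⟨⟨h1, _⟩, h2⟩
    exact ⟨h1, h2⟩

theorem map_pos_sub_map_pos (Λ : AdmissiblePath n) {M : Type*} [AddCommGroup M]
    (f : ℤ × ℤ →+ M) {s t : ℝ} (h : s ≤ t) :
    f (Λ.pos t) - f (Λ.pos s) =
      ∑ θ ∈ Λ.edgesIoc s t, Λ.mult (θ : Angle n) • f (dirVec θ) := by
  rw [← map_sub, Λ.pos_sub_pos h, map_sum]
  exact Finset.sum_congr rfl fun θ _ => map_nsmul f _ _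

section
variable {M : Type*} [AddCommGroup M] [LinearOrder M] [IsOrderedAddMonoid M]

/-- A linear functional does not decrease along a path whose edges do not decrease it. -/
theorem map_pos_le (Λ : AdmissiblePath n) (f : ℤ × ℤ →+ M) {s t : ℝ} (h : s ≤ t)
    (hf : ∀ θ, s < θ → θ ≤ t → Λ.IsEdge θ → 0 ≤ f (dirVec θ)) : f (Λ.pos s) ≤ f (Λ.pos t) := by
  rw [← sub_nonneg, Λ.map_pos_sub_map_pos f h]
  refine Finset.sum_nonneg fun θ hθ => ?_
  rw [mem_edgesIoc] at hθ
  exact nsmul_nonneg (hf θ hθ.1.1 hθ.1.2 hθ.2) _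

theorem map_pos_lt (Λ : AdmissiblePath n) (f : ℤ × ℤ →+ M) {s t θ₀ : ℝ}
    (hf : ∀ θ, s < θ → θ ≤ t → Λ.IsEdge θ → 0 ≤ f (dirVec θ)) (h1 : s < θ₀) (h2 : θ₀ ≤ t)
    (he : Λ.IsEdge θ₀) (h0 : 0 < f (dirVec θ₀)) : f (Λ.pos s) < f (Λ.pos t) := by
  rw [← sub_pos, Λ.map_pos_sub_map_pos f (h1.le.trans h2)]
  refine Finset.sum_pos' (fun θ hθ => ?_) ⟨θ₀, mem_edgesIoc.mpr ⟨⟨h1, h2⟩, he⟩, nsmul_pos h0 he⟩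
  rw [mem_edgesIoc] at hθ
  exact nsmul_nonneg (hf θ hθ.1.1 hθ.1.2 hθ.2) _

end

theorem pos_eq_of_not_isEdge (Λ : AdmissiblePath n) {s t : ℝ} (h : s ≤ t)
    (hn : ∀ θ, s < θ → θ ≤ t → ¬ Λ.IsEdge θ) : Λ.pos t = Λ.pos s := by
  rw [← sub_eq_zero, Λ.pos_sub_pos h]
  refine Finset.sum_eq_zero fun θ hθ => ?_
  rw [mem_edgesIoc] at hθ
  exact absurd hθ.2 (hn θ hθ.1.1 hθ.1.2)

theorem left_eq_of_not_isEdge (Λ : AdmissiblePath n) {s t : ℝ} (h : s < t)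
    (hn : ∀ θ, s < θ → θ < t → ¬ Λ.IsEdge θ) : Λ.left t = Λ.pos s := by
  by_cases he : Λ.IsEdge t
  · have hs : Λ.edgesIoc s t = {t} := by
      ext θ
      rw [mem_edgesIoc, Finset.mem_singleton]
      constructor
      · rintro ⟨⟨h1, h2⟩, h3⟩
        by_contra h4
        exact hn θ h1 (lt_of_le_of_ne h2 h4) h3
      · rintro rfl
        exact ⟨⟨h, le_rfl⟩, he⟩
    have := Λ.pos_sub_pos h.le
    rw [hs, Finset.sum_singleton] at this
    rw [left, ← this, sub_sub_cancel]
  · rw [left_eq_pos he]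
    refine Λ.pos_eq_of_not_isEdge h.le fun θ h1 h2 h3 => ?_
    rcases h2.eq_or_lt with rfl | h2
    · exact he h3
    · exact hn θ h1 h2 h3

/-- The edges are isolated. -/
theorem exists_isolating (Λ : AdmissiblePath n) (t : ℝ) {B : ℝ} (hB : 0 < B) :
    ∃ ε, 0 < ε ∧ ε < B ∧ ∀ θ, t - ε ≤ θ → θ ≤ t + ε → θ ≠ t → ¬ Λ.IsEdge θ := by
  set S := (Λ.edgesIcc (t - B) (t + B)).erase t with hS
  have hmem : ∀ θ, t - B ≤ θ → θ ≤ t + B → θ ≠ t → Λ.IsEdge θ → θ ∈ S := fun θ h1 h2 h3 h4 => by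
    rw [hS, Finset.mem_erase, mem_edgesIcc]; exact ⟨h3, ⟨h1, h2⟩, h4⟩
  by_cases hne : S.Nonempty
  · obtain ⟨m, hm, hmin⟩ := S.exists_min_image (fun θ => |θ - t|) hne
    have hmt : 0 < |m - t| := abs_pos.mpr (sub_ne_zero.mpr (Finset.mem_erase.mp hm).1)
    refine ⟨min (B / 2) (|m - t| / 2), by positivity, by
      have := min_le_left (B / 2) (|m - t| / 2); linarith, fun θ h1 h2 h3 h4 => ?_⟩
    have h5 := min_le_left (B / 2) (|m - t| / 2)
    have h6 := min_le_right (B / 2) (|m - t| / 2)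
    have h7 := hmin θ (hmem θ (by linarith) (by linarith) h3 h4)
    have h8 : |θ - t| ≤ |m - t| / 2 := abs_le.mpr ⟨by linarith, by linarith⟩
    linarith
  · refine ⟨B / 2, by positivity, by linarith, fun θ h1 h2 h3 h4 => hne ⟨θ, hmem θ ?_ ?_ h3 h4⟩⟩
    · linarith
    · linarith

/-- The edges of two paths are jointly isolated. -/
theorem exists_isolating₂ (Λ Λ' : AdmissiblePath n) (t : ℝ) {B : ℝ} (hB : 0 < B) :
    ∃ ε, 0 < ε ∧ ε < B ∧ (∀ θ, t - ε ≤ θ → θ ≤ t + ε → θ ≠ t → ¬ Λ.IsEdge θ) ∧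
      ∀ θ, t - ε ≤ θ → θ ≤ t + ε → θ ≠ t → ¬ Λ'.IsEdge θ := by
  obtain ⟨ε, h0, hB', h⟩ := Λ.exists_isolating t hB
  obtain ⟨ε', h0', hε, h'⟩ := Λ'.exists_isolating t h0
  exact ⟨ε', h0', hε.trans hB', fun θ h1 h2 => h θ (by linarith) (by linarith), h'⟩

theorem exists_first_edge (Λ : AdmissiblePath n) {s θ : ℝ} (h : s < θ) (he : Λ.IsEdge θ) :
    ∃ b, s < b ∧ b ≤ θ ∧ Λ.IsEdge b ∧ ∀ φ, s < φ → φ < b → ¬ Λ.IsEdge φ := by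
  obtain ⟨b, hb, hmin⟩ := (Λ.edgesIoc s θ).exists_min_image id ⟨θ, by simp [h, he]⟩
  rw [mem_edgesIoc] at hb
  refine ⟨b, hb.1.1, hb.1.2, hb.2, fun φ h1 h2 h3 => ?_⟩
  have : b ≤ φ := hmin φ (by rw [mem_edgesIoc]; exact ⟨⟨h1, h2.le.trans hb.1.2⟩, h3⟩)
  linarith

theorem exists_last_edge (Λ : AdmissiblePath n) {t θ : ℝ} (h : θ ≤ t) (he : Λ.IsEdge θ) :
    ∃ a, θ ≤ a ∧ a ≤ t ∧ Λ.IsEdge a ∧ ∀ φ, a < φ → φ ≤ t → ¬ Λ.IsEdge φ := by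
  obtain ⟨a, ha, hmax⟩ := (Λ.edgesIcc θ t).exists_max_image id ⟨θ, by simp [h, he]⟩
  rw [mem_edgesIcc] at ha
  refine ⟨a, ha.1.1, ha.1.2, ha.2, fun φ h1 h2 h3 => ?_⟩
  have : φ ≤ a := hmax φ (by rw [mem_edgesIcc]; exact ⟨⟨ha.1.1.trans h1.le, h2⟩, h3⟩)
  linarith

theorem exists_last_edge_lt (Λ : AdmissiblePath n) {t θ : ℝ} (h : θ < t) (he : Λ.IsEdge θ) :
    ∃ a, θ ≤ a ∧ a < t ∧ Λ.IsEdge a ∧ ∀ φ, a < φ → φ < t → ¬ Λ.IsEdge φ := by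
  obtain ⟨ε, h0, -, hε⟩ := Λ.exists_isolating t (sub_pos.mpr h)
  by_cases hθ : θ ≤ t - ε
  · obtain ⟨a, h1, h2, h3, h4⟩ := Λ.exists_last_edge hθ he
    refine ⟨a, h1, by linarith, h3, fun φ h5 h6 => ?_⟩
    by_cases h7 : φ ≤ t - ε
    · exact h4 φ h5 h7
    · exact hε φ (by linarith) (by linarith) h6.ne
  · exact absurd he (hε θ (by linarith) (by linarith) h.ne)

theorem exists_edge_lt (Λ : AdmissiblePath n) {θ : ℝ} (t : ℝ) (he : Λ.IsEdge θ) :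
    ∃ a, a ≤ t ∧ Λ.IsEdge a ∧ ∀ φ, a < φ → φ ≤ t → ¬ Λ.IsEdge φ := by
  obtain ⟨k, h1, h2⟩ := exists_int_add_mem_Ico n (t - 2 * π * n) θ
  obtain ⟨a, -, h⟩ := Λ.exists_last_edge (t := t) (by linarith) ((isEdge_add_int_mul k).mpr he)
  exact ⟨a, h⟩

theorem exists_edge_gt (Λ : AdmissiblePath n) {θ : ℝ} (t : ℝ) (he : Λ.IsEdge θ) :
    ∃ b, t < b ∧ Λ.IsEdge b ∧ ∀ φ, t < φ → φ < b → ¬ Λ.IsEdge φ := by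
  obtain ⟨k, h1, h2⟩ := exists_int_add_mem_Ico n (t + 1) θ
  obtain ⟨b, hb, -, h⟩ := Λ.exists_first_edge (s := t) (by linarith) ((isEdge_add_int_mul k).mpr he)
  exact ⟨b, hb, h⟩

end AdmissiblePath

/-! ### The index as a sum over the edges -/

/-- The lattice distance between the lines in direction `θ` through the corners of `Λ` and `Λ'` at
time `θ`.  It is a positive multiple of the value of `detDir θ` that controls nesting, and it does
not depend on whether the positions just before or just after `θ` are compared. -/
def height (Λ Λ' : AdmissiblePath n) (θ : ℝ) : ℤ := cross (dirVec θ) (Λ'.pos θ - Λ.pos θ)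

/-- The contribution to the index `I(α, β)` of the edges of `α` and `β` at the angle `θ`. -/
def indexTerm (α β : Generator n) (θ : ℝ) : ℤ :=
  α.path.mult (θ : Angle n) * (height α.path β.path θ + 1)
    + β.path.mult (θ : Angle n) * (height α.path β.path θ - 1)
    - (if (θ : Angle n) ∈ α.order then 1 else 0) + (if (θ : Angle n) ∈ β.order then 1 else 0)

theorem height_add_int_mul {Λ Λ' : AdmissiblePath n} (h : Λ'.period = Λ.period) (θ : ℝ) (k : ℤ) :
    height Λ Λ' (θ + k * (2 * π * n)) = height Λ Λ' θ := by
  rw [height, dirVec_add_int_mul, pos_sub_pos_add_int_mul h, height]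

theorem indexTerm_add_int_mul {α β : Generator n} (h : β.path.period = α.path.period) (θ : ℝ)
    (k : ℤ) : indexTerm α β (θ + k * (2 * π * n)) = indexTerm α β θ := by
  simp only [indexTerm, height_add_int_mul h, coe_add_int_mul]

theorem cross_left_sub_left (Λ Λ' : AdmissiblePath n) (θ : ℝ) :
    cross (dirVec θ) (Λ'.left θ - Λ.left θ) = height Λ Λ' θ := by
  simp only [left, height, cross_sub, cross_nsmul, cross_self]; ring

/-- Twice the area swept out by the chord between the two paths at a common jump. -/
theorem twiceSegment_jump (Λ Λ' : AdmissiblePath n) (θ : ℝ) :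
    twiceSegment (Λ.left θ) (Λ.pos θ) + (twiceSegment (Λ.pos θ) (Λ'.pos θ)
      - twiceSegment (Λ.left θ) (Λ'.left θ)) - twiceSegment (Λ'.left θ) (Λ'.pos θ) =
      (Λ.mult (θ : Angle n) + Λ'.mult (θ : Angle n)) * height Λ Λ' θ := by
  simp only [left, height, cross, twiceSegment, Prod.fst_sub, Prod.snd_sub, Prod.smul_fst,
    Prod.smul_snd]
  simp only [nsmul_eq_mul]
  ring

variable [NeZero n]

/-- The edges of `α` and `β` in one period. -/
def periodEdges (α β : Generator n) : Finset ℝ :=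
  α.path.edgesIoc 0 (2 * π * n) ∪ β.path.edgesIoc 0 (2 * π * n)

theorem mem_periodEdges {α β : Generator n} {θ : ℝ} : θ ∈ periodEdges α β ↔
    (0 < θ ∧ θ ≤ 2 * π * n) ∧ (α.path.IsEdge θ ∨ β.path.IsEdge θ) := by
  simp only [periodEdges, Finset.mem_union, mem_edgesIoc]; tauto

theorem exists_int_add_mem_Ioc (n : ℕ) [NeZero n] (t : ℝ) :
    ∃ k : ℤ, 0 < t + k * (2 * π * n) ∧ t + k * (2 * π * n) ≤ 2 * π * n := by
  obtain ⟨k, hk, -⟩ := existsUnique_add_zsmul_mem_Ioc (instFactAngle n).out t 0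
  rw [zsmul_eq_mul, zero_add] at hk
  exact ⟨k, hk.1, hk.2⟩

theorem coe_injOn_Ioc {θ φ : ℝ} (h : (θ : Angle n) = (φ : Angle n)) (h1 : 0 < θ)
    (h2 : θ ≤ 2 * π * n) (h3 : 0 < φ) (h4 : φ ≤ 2 * π * n) : θ = φ := by
  have h' : ((-θ : ℝ) : Angle n) = ((-φ : ℝ) : Angle n) := by
    rw [AddCircle.coe_neg, AddCircle.coe_neg, h]
  have := eq_of_coe_eq_coe (a := -(2 * π * n)) h' (by linarith) (by linarith) (by linarith)
    (by linarith)
  linarith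

theorem sum_support_eq_sum_periodEdges (α β : Generator n) (g : Angle n → ℤ) :
    ∑ x ∈ α.path.mult.support ∪ β.path.mult.support, g x =
      ∑ θ ∈ periodEdges α β, g (θ : Angle n) := by
  symm
  refine Finset.sum_bij (fun θ _ => (θ : Angle n)) ?_ ?_ ?_ fun _ _ => rfl
  · intro θ hθ
    rw [mem_periodEdges, isEdge_iff_mem_support, isEdge_iff_mem_support] at hθ
    exact Finset.mem_union.mpr hθ.2
  · intro θ hθ φ hφ h
    rw [mem_periodEdges] at hθ hφ
    exact coe_injOn_Ioc h hθ.1.1 hθ.1.2 hφ.1.1 hφ.1.2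
  · intro x hx
    obtain ⟨t, rfl⟩ := QuotientAddGroup.mk_surjective x
    obtain ⟨k, h1, h2⟩ := exists_int_add_mem_Ioc n t
    refine ⟨t + k * (2 * π * n), ?_, coe_add_int_mul t k⟩
    rw [mem_periodEdges, isEdge_add_int_mul, isEdge_add_int_mul, isEdge_iff_mem_support,
      isEdge_iff_mem_support]
    exact ⟨⟨h1, h2⟩, Finset.mem_union.mp hx⟩

theorem length_order_eq_sum {α : Generator n} {S : Finset (Angle n)}
    (hS : ∀ x ∈ α.order, x ∈ S) :
    (α.order.length : ℤ) = ∑ x ∈ S, if x ∈ α.order then 1 else 0 := by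
  rw [Finset.sum_boole, ← List.toFinset_card_of_nodup α.nodup]
  congr 2
  ext x
  simp only [List.mem_toFinset, Finset.mem_filter]
  exact ⟨fun h => ⟨hS x h, h⟩, fun h => h.2⟩

theorem twicePath_eq_sum (Λ : AdmissiblePath n) {E : Finset ℝ}
    (h1 : ∀ θ ∈ E, 0 < θ ∧ θ ≤ 2 * π * n)
    (h2 : ∀ θ, 0 < θ → θ ≤ 2 * π * n → Λ.IsEdge θ → θ ∈ E) :
    twicePath Λ = ∑ θ ∈ E, twiceSegment (Λ.left θ) (Λ.pos θ) := by
  rw [twicePath]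
  refine finsum_mem_eq_sum_of_inter_support_eq _ ?_
  ext θ
  simp only [Set.mem_inter_iff, Set.mem_Ioc, Function.mem_support, Finset.mem_coe]
  constructor
  · rintro ⟨h, h'⟩
    refine ⟨h2 θ h.1 h.2 fun h0 => h' ?_, h'⟩
    rw [left, h0, zero_smul, sub_zero, twiceSegment, sub_self, mul_zero]
  · rintro ⟨h, h'⟩
    exact ⟨h1 θ h, h'⟩

/-- The index is the sum of the contributions of the edges.  The area term comes from sweeping the
chord from `α` to `β` along the paths. -/
theorem relIndex_eq_sum (α β : Generator n) :
    relIndex α β = ∑ θ ∈ periodEdges α β, indexTerm α β θ := by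
  set E := periodEdges α β with hE
  have hE1 : ∀ θ ∈ E, 0 < θ ∧ θ ≤ 2 * π * n := fun θ hθ => (mem_periodEdges.mp hθ).1
  have hEα : ∀ θ, 0 < θ → θ ≤ 2 * π * n → α.path.IsEdge θ → θ ∈ E := fun θ h1 h2 h3 =>
    mem_periodEdges.mpr ⟨⟨h1, h2⟩, Or.inl h3⟩
  have hEβ : ∀ θ, 0 < θ → θ ≤ 2 * π * n → β.path.IsEdge θ → θ ∈ E := fun θ h1 h2 h3 =>
    mem_periodEdges.mpr ⟨⟨h1, h2⟩, Or.inr h3⟩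
  have hchord := sum_jumps_eq E (fun θ => twiceSegment (α.path.pos θ) (β.path.pos θ))
    (fun θ => twiceSegment (α.path.left θ) (β.path.left θ)) (a := 0) (b := 2 * π * n)
    (fun s t h0 hst hT hn => by
      rw [α.path.pos_eq_of_not_isEdge hst fun θ h1 h2 h3 =>
          hn θ ⟨h1, h2⟩ (hEα θ (h0.trans_lt h1) (h2.trans hT) h3),
        β.path.pos_eq_of_not_isEdge hst fun θ h1 h2 h3 =>
          hn θ ⟨h1, h2⟩ (hEβ θ (h0.trans_lt h1) (h2.trans hT) h3)])
    (fun s t h0 hst hT hn => by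
      rw [α.path.left_eq_of_not_isEdge hst fun θ h1 h2 h3 =>
          hn θ ⟨h1, h2⟩ (hEα θ (h0.trans_lt h1) (h2.le.trans hT) h3),
        β.path.left_eq_of_not_isEdge hst fun θ h1 h2 h3 =>
          hn θ ⟨h1, h2⟩ (hEβ θ (h0.trans_lt h1) (h2.le.trans hT) h3)])
    (2 * π * n) le_rfl 0 le_rfl (instFactAngle n).out.le
  rw [Finset.filter_true_of_mem hE1] at hchord
  have hper : ∀ Λ : AdmissiblePath n, Λ.pos (2 * π * n) = Λ.pos 0 + Λ.period := fun Λ => by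
    rw [← Λ.periodic 0, zero_add]
  simp only [hper] at hchord
  have hℓ : ∀ {Λ : AdmissiblePath n} (_ : Λ.mult.support ⊆
      α.path.mult.support ∪ β.path.mult.support),
      ((Λ.mult.sum fun _ m => m : ℕ) : ℤ) = ∑ θ ∈ E, (Λ.mult (θ : Angle n) : ℤ) := fun {Λ} hΛ => by
    rw [hE, ← sum_support_eq_sum_periodEdges α β fun x => (Λ.mult x : ℤ), Finsupp.sum_of_support_subset _ hΛ _ (by simp)]
    push_cast; rfl
  rw [relIndex, twicePath_eq_sum α.path hE1 hEα, twicePath_eq_sum β.path hE1 hEβ,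
    hℓ Finset.subset_union_left, hℓ Finset.subset_union_right,
    length_order_eq_sum (S := α.path.mult.support ∪ β.path.mult.support)
      fun x hx => Finset.mem_union_left _ (α.edges x hx),
    length_order_eq_sum (S := α.path.mult.support ∪ β.path.mult.support)
      fun x hx => Finset.mem_union_right _ (β.edges x hx),
    sum_support_eq_sum_periodEdges, sum_support_eq_sum_periodEdges]
  have hterm : ∀ θ ∈ E, indexTerm α β θ = twiceSegment (α.path.left θ) (α.path.pos θ)
      + (twiceSegment (α.path.pos θ) (β.path.pos θ)
        - twiceSegment (α.path.left θ) (β.path.left θ))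
      - twiceSegment (β.path.left θ) (β.path.pos θ)
      + (α.path.mult (θ : Angle n) - if (θ : Angle n) ∈ α.order then 1 else 0)
      - (β.path.mult (θ : Angle n) - if (θ : Angle n) ∈ β.order then 1 else 0) := fun θ _ => by
    rw [twiceSegment_jump, indexTerm]; ring
  rw [Finset.sum_congr rfl hterm]
  simp only [Finset.sum_add_distrib, Finset.sum_sub_distrib] at hchord ⊢
  linear_combination -hchord

/-! ### Consequences of nesting -/

section Nesting

variable {Λ Λ' : AdmissiblePath n}

theorem height_nonneg (hn : IsLeftOf Λ' Λ) {θ : ℝ} (h : IsRationalAngle θ) :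
    0 ≤ height Λ Λ' θ :=
  (cross_nonneg_iff h _).mpr (hn θ)

/-- Where the lines through the corners coincide, the displacement just before `θ` is a nonnegative
multiple of the direction, since the displacement stays on the left. -/
theorem exists_left_sub_left_eq (hn : IsLeftOf Λ' Λ) {θ : ℝ} (h : IsRationalAngle θ)
    (h0 : height Λ Λ' θ = 0) : ∃ k : ℤ, 0 ≤ k ∧ Λ'.left θ - Λ.left θ = k • dirVec θ := by
  rw [← cross_left_sub_left] at h0
  obtain ⟨k, hk⟩ := exists_zsmul_of_cross_eq_zero (dirVec_isCoprime h) h0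
  refine ⟨k, ?_, hk⟩
  obtain ⟨ε, hε, hπ, h1, h2⟩ := Λ.exists_isolating₂ Λ' θ Real.pi_pos
  have h3 := hn (θ - ε)
  rw [← Λ.left_eq_of_not_isEdge (s := θ - ε) (t := θ) (by linarith)
      fun φ h4 h5 => h1 φ h4.le (by linarith) h5.ne,
    ← Λ'.left_eq_of_not_isEdge (s := θ - ε) (t := θ) (by linarith)
      fun φ h4 h5 => h2 φ h4.le (by linarith) h5.ne, hk, detDir_zsmul] at h3
  have h4 := detDir_dirVec_pos (t := θ - ε) h (by linarith) (by linarith)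
  exact_mod_cast nonneg_of_mul_nonneg_left h3 h4

theorem exists_pos_sub_pos_eq (hn : IsLeftOf Λ' Λ) {θ : ℝ} (h : IsRationalAngle θ)
    (h0 : height Λ Λ' θ = 0) : ∃ k : ℤ, k ≤ 0 ∧ Λ'.pos θ - Λ.pos θ = k • dirVec θ := by
  obtain ⟨k, hk⟩ := exists_zsmul_of_cross_eq_zero (dirVec_isCoprime h) h0
  refine ⟨k, ?_, hk⟩
  obtain ⟨ε, hε, hπ, h1, h2⟩ := Λ.exists_isolating₂ Λ' θ Real.pi_pos
  have h3 := hn (θ + ε)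
  rw [Λ.pos_eq_of_not_isEdge (s := θ) (t := θ + ε) (by linarith)
      fun φ h4 h5 => h1 φ (by linarith) h5 h4.ne',
    Λ'.pos_eq_of_not_isEdge (s := θ) (t := θ + ε) (by linarith)
      fun φ h4 h5 => h2 φ (by linarith) h5 h4.ne', hk, detDir_zsmul] at h3
  have h4 := detDir_dirVec_neg (t := θ + ε) h (by linarith) (by linarith)
  by_contra hc
  push Not at hc
  have h5 : (0 : ℝ) < k := by exact_mod_cast hc
  nlinarith

theorem pos_sub_pos_eq_left_sub_left_add (Λ Λ' : AdmissiblePath n) (θ : ℝ) :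
    Λ'.pos θ - Λ.pos θ = (Λ'.left θ - Λ.left θ) +
      ((Λ'.mult (θ : Angle n) : ℤ) - (Λ.mult (θ : Angle n) : ℤ)) • dirVec θ := by
  simp only [left, sub_smul, natCast_zsmul]; abel

theorem zsmul_dirVec_injective {θ : ℝ} (h : IsRationalAngle θ) {k l : ℤ}
    (e : k • dirVec θ = l • dirVec θ) : k = l := by
  rw [← sub_eq_zero, ← sub_smul, smul_eq_zero] at e
  exact sub_eq_zero.mp (e.resolve_right (dirVec_ne_zero h))

/-- The displacements before and after an angle where the lines through the corners coincide. -/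
theorem exists_displacements (hn : IsLeftOf Λ' Λ) {θ : ℝ} (h : IsRationalAngle θ)
    (h0 : height Λ Λ' θ = 0) : ∃ k l : ℤ, 0 ≤ k ∧ l ≤ 0 ∧
      Λ'.left θ - Λ.left θ = k • dirVec θ ∧ Λ'.pos θ - Λ.pos θ = l • dirVec θ ∧
      (Λ.mult (θ : Angle n) : ℤ) - Λ'.mult (θ : Angle n) = k - l := by
  obtain ⟨k, hk, ek⟩ := exists_left_sub_left_eq hn h h0
  obtain ⟨l, hl, el⟩ := exists_pos_sub_pos_eq hn h h0
  refine ⟨k, l, hk, hl, ek, el, ?_⟩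
  have := pos_sub_pos_eq_left_sub_left_add Λ Λ' θ
  rw [ek, el, ← add_smul] at this
  have := zsmul_dirVec_injective h this
  linarith

/-- If the displacement vanishes on neither side of an edge at height `0`, then both paths have
edges there or the edge of `Λ` is longer by at least two units. -/
theorem two_le_mult_sub (hn : IsLeftOf Λ' Λ) {θ : ℝ} (h : IsRationalAngle θ)
    (h0 : height Λ Λ' θ = 0) (h1 : Λ'.left θ ≠ Λ.left θ) (h2 : Λ'.pos θ ≠ Λ.pos θ) :
    (Λ'.mult (θ : Angle n) : ℤ) + 2 ≤ Λ.mult (θ : Angle n) := by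
  obtain ⟨k, l, hk, hl, ek, el, e⟩ := exists_displacements hn h h0
  have hk0 : k ≠ 0 := fun h => h1 (by rwa [h, zero_smul, sub_eq_zero] at ek)
  have hl0 : l ≠ 0 := fun h => h2 (by rwa [h, zero_smul, sub_eq_zero] at el)
  omega

/-- Half a turn without edges of `Λ`: the displacement stays on the left at the beginning and at
the end only if it is parallel to the direction and `Λ'` has no edges in between. -/
theorem detDir_eq_zero_of_half_turn (hn : IsLeftOf Λ' Λ) {s : ℝ}
    (hs : ∀ θ, s < θ → θ ≤ s + π → ¬ Λ.IsEdge θ) :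
    detDir s (Λ'.pos s - Λ.pos s) = 0 ∧ ∀ θ, s < θ → θ < s + π → ¬ Λ'.IsEdge θ := by
  have h1 := hn s
  have h2 := hn (s + π)
  rw [detDir_add_pi, Λ.pos_eq_of_not_isEdge (by linarith [Real.pi_pos]) hs] at h2
  simp only [detDir_sub] at h1 h2 ⊢
  have hnn : ∀ θ, s < θ → θ ≤ s + π → Λ'.IsEdge θ → 0 ≤ detDirHom s (dirVec θ) :=
    fun θ h3 h4 h5 => by
      obtain ⟨ρ, hρ, e⟩ := exists_detDir_dirVec h5.isRationalAngle
      rw [detDirHom_apply, e]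
      exact mul_nonneg hρ.le (sin_nonneg_of_nonneg_of_le_pi (by linarith) (by linarith))
  have h3 := Λ'.map_pos_le (detDirHom s) (by linarith [Real.pi_pos]) hnn
  simp only [detDirHom_apply] at h3
  refine ⟨by linarith, fun θ h4 h5 h6 => ?_⟩
  have := Λ'.map_pos_lt (detDirHom s) hnn h4 h5.le h6
    (detDir_dirVec_pos h6.isRationalAngle h4 (by linarith))
  simp only [detDirHom_apply] at this
  linarith

/-- Nested paths coincide along a kink. -/
theorem pos_eq_of_kink (hn : IsLeftOf Λ' Λ) {a b : ℝ} (hab : a + π < b)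
    (h : ∀ θ, a < θ → θ < b → ¬ Λ.IsEdge θ) {t : ℝ} (h1 : a ≤ t) (h2 : t < b) :
    Λ'.pos t = Λ.pos t := by
  have hpi := Real.pi_pos
  have hs : ∀ s, a ≤ s → s + π < b → detDir s (Λ'.pos s - Λ.pos s) = 0 ∧
      ∀ θ, s < θ → θ < s + π → ¬ Λ'.IsEdge θ := fun s h3 h4 =>
    detDir_eq_zero_of_half_turn hn fun θ h5 h6 => h θ (by linarith) (by linarith)
  have hno : ∀ θ, a < θ → θ < b → ¬ Λ'.IsEdge θ := fun θ h3 h4 h5 => by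
    rcases lt_or_ge θ (a + π) with h6 | h6
    · exact (hs a le_rfl hab).2 θ h3 h6 h5
    · refine (hs (θ - π + min (b - θ) π / 2) ?_ ?_).2 θ ?_ ?_ h5 <;>
      · have h7 : 0 < min (b - θ) π := lt_min (by linarith) hpi
        have h8 := min_le_left (b - θ) π
        have h9 := min_le_right (b - θ) π
        linarith
  have hconst : ∀ s, a ≤ s → s < b → Λ'.pos s - Λ.pos s = Λ'.pos a - Λ.pos a :=
    fun s h3 h4 => by
      rw [Λ'.pos_eq_of_not_isEdge h3 fun θ h5 h6 => hno θ h5 (by linarith),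
        Λ.pos_eq_of_not_isEdge h3 fun θ h5 h6 => h θ h5 (by linarith)]
  set ε := min (b - (a + π)) π / 2 with hε
  have h7 : 0 < min (b - (a + π)) π := lt_min (by linarith) hpi
  have h8 := min_le_left (b - (a + π)) π
  have h9 := min_le_right (b - (a + π)) π
  have e1 := (hs a le_rfl hab).1
  have e2 := (hs (a + ε) (by linarith) (by linarith)).1
  rw [hconst _ (by linarith) (by linarith)] at e2
  have := eq_zero_of_detDir_eq_zero (by linarith) (by linarith) e1 e2
  rw [← sub_eq_zero, hconst t h1 h2, this]

/-- Between two edges of `Λ`, nested paths coincide everywhere if they coincide somewhere. -/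
theorem pos_eq_of_pos_eq (hn : IsLeftOf Λ' Λ) {a b : ℝ} (hab : b ≤ a + π)
    (h : ∀ θ, a < θ → θ < b → ¬ Λ.IsEdge θ) {t₀ : ℝ} (h1 : a ≤ t₀) (h2 : t₀ < b)
    (h0 : Λ'.pos t₀ = Λ.pos t₀) {t : ℝ} (h3 : a ≤ t) (h4 : t < b) : Λ'.pos t = Λ.pos t := by
  have hΛ : ∀ s, a ≤ s → s < b → Λ.pos s = Λ.pos a := fun s h5 h6 =>
    Λ.pos_eq_of_not_isEdge h5 fun θ h7 h8 => h θ h7 (by linarith)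
  have hno : ∀ θ, a < θ → θ < b → ¬ Λ'.IsEdge θ := fun θ h5 h6 h7 => by
    rcases lt_or_ge t₀ θ with h8 | h8
    · -- compare with the direction of a time after the edge
      set s := (θ + b) / 2
      have hs := hn s
      have hlt := Λ'.map_pos_lt (-detDirHom s) (s := t₀) (t := s) (θ₀ := θ)
        (fun φ h9 h10 h11 => by
          obtain ⟨ρ, hρ, e⟩ := exists_detDir_dirVec h11.isRationalAngle
          rw [AddMonoidHom.neg_apply, detDirHom_apply, e, neg_nonneg]
          exact mul_nonpos_of_nonneg_of_nonpos hρ.le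
            (sin_nonpos_of_nonpos_of_neg_pi_le (by linarith) (by simp only [s]; linarith)))
        h8 (by simp only [s]; linarith) h7
        (by
          rw [AddMonoidHom.neg_apply, detDirHom_apply, neg_pos]
          exact detDir_dirVec_neg h7.isRationalAngle (by simp only [s]; linarith)
            (by simp only [s]; linarith))
      rw [hΛ s (by simp only [s]; linarith) (by simp only [s]; linarith), ← hΛ t₀ h1 h2, ← h0,
        detDir_sub] at hs
      simp only [AddMonoidHom.neg_apply, detDirHom_apply] at hlt
      linarith
    · set s := (a + θ) / 2
      have hs := hn s
      have hlt := Λ'.map_pos_lt (detDirHom s) (s := s) (t := t₀) (θ₀ := θ)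
        (fun φ h9 h10 h11 => by
          obtain ⟨ρ, hρ, e⟩ := exists_detDir_dirVec h11.isRationalAngle
          rw [detDirHom_apply, e]
          exact mul_nonneg hρ.le
            (sin_nonneg_of_nonneg_of_le_pi (by linarith) (by simp only [s]; linarith)))
        (by simp only [s]; linarith) h8 h7
        (by
          rw [detDirHom_apply]
          exact detDir_dirVec_pos h7.isRationalAngle (by simp only [s]; linarith)
            (by simp only [s]; linarith))
      rw [hΛ s (by simp only [s]; linarith) (by simp only [s]; linarith), ← hΛ t₀ h1 h2, ← h0,
        detDir_sub] at hs
      simp only [detDirHom_apply] at hlt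
      linarith
  have hΛ' : ∀ s, a ≤ s → s < b → Λ'.pos s = Λ'.pos a := fun s h5 h6 =>
    Λ'.pos_eq_of_not_isEdge h5 fun θ h7 h8 => hno θ h7 (by linarith)
  rw [hΛ t h3 h4, hΛ' t h3 h4, ← hΛ t₀ h1 h2, ← hΛ' t₀ h1 h2, h0]

end Nesting

section IndexTerm

variable {α β : Generator n}

theorem isEdge_of_mem_order {θ : ℝ} (h : (θ : Angle n) ∈ α.order) : α.path.IsEdge θ :=
  isEdge_iff_mem_support.mpr (α.edges _ h)

theorem ite_mem_order_le_mult (α : Generator n) (θ : ℝ) :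
    (if (θ : Angle n) ∈ α.order then (1 : ℤ) else 0) ≤ α.path.mult (θ : Angle n) := by
  split_ifs with h
  · have := isEdge_of_mem_order h
    rw [IsEdge] at this
    omega
  · positivity

theorem indexTerm_eq_zero_of_not_isEdge {θ : ℝ} (h1 : ¬ α.path.IsEdge θ)
    (h2 : ¬ β.path.IsEdge θ) : indexTerm α β θ = 0 := by
  have h3 : (θ : Angle n) ∉ α.order := fun h => h1 (isEdge_of_mem_order h)
  have h4 : (θ : Angle n) ∉ β.order := fun h => h2 (isEdge_of_mem_order h)
  simp only [IsEdge, not_not] at h1 h2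
  simp [indexTerm, h1, h2, h3, h4]

theorem indexTerm_of_height_eq_zero {θ : ℝ} (h : height α.path β.path θ = 0) :
    indexTerm α β θ = α.path.mult (θ : Angle n) - β.path.mult (θ : Angle n)
      - (if (θ : Angle n) ∈ α.order then 1 else 0)
      + (if (θ : Angle n) ∈ β.order then 1 else 0) := by
  rw [indexTerm, h]; ring

/-- Where the displacement vanishes on both sides, the edges agree and contribute nothing. -/
theorem indexTerm_eq_zero_of_agree (hl : LabelsMatch α β) {θ : ℝ}
    (h1 : β.path.left θ = α.path.left θ) (h2 : β.path.pos θ = α.path.pos θ) :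
    indexTerm α β θ = 0 := by
  by_cases hr : IsRationalAngle θ
  · have hm := pos_sub_pos_eq_left_sub_left_add α.path β.path θ
    rw [h1, h2, sub_self, sub_self, zero_add, eq_comm, smul_eq_zero,
      or_iff_left (dirVec_ne_zero hr)] at hm
    have hm' : β.path.mult (θ : Angle n) = α.path.mult (θ : Angle n) := by omega
    by_cases he : α.path.IsEdge θ
    · have hag := (hl θ).1 ⟨he, by rwa [IsEdge, hm'], h1.symm, h2.symm⟩
      rw [indexTerm_of_height_eq_zero (by rw [height, h2, sub_self, cross_zero]), hm']
      simp only [hag]; ring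
    · exact indexTerm_eq_zero_of_not_isEdge he (by rwa [IsEdge, hm'])
  · exact indexTerm_eq_zero_of_not_isEdge (fun h => hr h.isRationalAngle)
      fun h => hr h.isRationalAngle

theorem indexTerm_nonneg (hn : IsLeftOf β.path α.path) (hl : LabelsMatch α β) (θ : ℝ) :
    0 ≤ indexTerm α β θ := by
  by_cases hr : IsRationalAngle θ
  swap
  · exact (indexTerm_eq_zero_of_not_isEdge (fun h => hr h.isRationalAngle)
      fun h => hr h.isRationalAngle).ge
  have h1 := ite_mem_order_le_mult α θ
  have h2 : 0 ≤ (if (θ : Angle n) ∈ β.order then (1 : ℤ) else 0) := by split_ifs <;> norm_num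
  rcases (height_nonneg hn hr).eq_or_lt with h0 | h0
  · obtain ⟨k, l, hk, hl', ek, el, e⟩ := exists_displacements hn hr h0.symm
    rcases (show 0 ≤ k - l by omega).eq_or_lt with h3 | h3
    · have hk0 : k = 0 := by omega
      have hl0 : l = 0 := by omega
      rw [hk0, zero_smul, sub_eq_zero] at ek
      rw [hl0, zero_smul, sub_eq_zero] at el
      exact (indexTerm_eq_zero_of_agree hl ek el).ge
    · rw [indexTerm_of_height_eq_zero h0.symm]
      have : (if (θ : Angle n) ∈ α.order then (1 : ℤ) else 0) ≤ 1 := by split_ifs <;> norm_num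
      omega
  · rw [indexTerm]
    have h3 : (0 : ℤ) ≤ α.path.mult (θ : Angle n) := by positivity
    have h4 : (0 : ℤ) ≤ β.path.mult (θ : Angle n) := by positivity
    nlinarith [mul_nonneg h3 h0.le, mul_nonneg h4 (show 0 ≤ height α.path β.path θ - 1 by omega)]

/-- An edge of `α` with nonzero displacements on both sides contributes at least `1`. -/
theorem one_le_indexTerm (hn : IsLeftOf β.path α.path) {θ : ℝ} (he : α.path.IsEdge θ)
    (h1 : β.path.left θ ≠ α.path.left θ) (h2 : β.path.pos θ ≠ α.path.pos θ) :
    1 ≤ indexTerm α β θ := by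
  have hr := he.isRationalAngle
  have h3 : (if (θ : Angle n) ∈ α.order then (1 : ℤ) else 0) ≤ 1 := by split_ifs <;> norm_num
  have h4 : 0 ≤ (if (θ : Angle n) ∈ β.order then (1 : ℤ) else 0) := by split_ifs <;> norm_num
  rcases (height_nonneg hn hr).eq_or_lt with h0 | h0
  · have := two_le_mult_sub hn hr h0.symm h1 h2
    rw [indexTerm_of_height_eq_zero h0.symm]
    omega
  · have h5 : (1 : ℤ) ≤ α.path.mult (θ : Angle n) := by
      rw [IsEdge] at he; omega
    have h6 : (0 : ℤ) ≤ β.path.mult (θ : Angle n) := by positivity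
    rw [indexTerm]
    nlinarith [mul_nonneg (show (0 : ℤ) ≤ α.path.mult (θ : Angle n) - 1 by omega) h0.le,
      mul_nonneg h6 (show 0 ≤ height α.path β.path θ - 1 by omega)]

/-- If the contributions are nonnegative and add up to `1`, exactly one of them is nonzero. -/
theorem exists_indexTerm_eq_one (hp : β.path.period = α.path.period)
    (hn : IsLeftOf β.path α.path) (hl : LabelsMatch α β) (hi : relIndex α β = 1) :
    ∃ θ₀, indexTerm α β θ₀ = 1 ∧
      ∀ θ : ℝ, (θ : Angle n) ≠ (θ₀ : Angle n) → indexTerm α β θ = 0 := by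
  rw [relIndex_eq_sum] at hi
  have hnn := indexTerm_nonneg hn hl
  obtain ⟨θ₀, h0, hne⟩ := Finset.exists_ne_zero_of_sum_ne_zero (s := periodEdges α β)
    (f := indexTerm α β) (by rw [hi]; norm_num)
  rw [← Finset.add_sum_erase _ _ h0] at hi
  have h1 := hnn θ₀
  have h2 : 0 ≤ ∑ θ ∈ (periodEdges α β).erase θ₀, indexTerm α β θ :=
    Finset.sum_nonneg fun θ _ => hnn θ
  have h3 : ∑ θ ∈ (periodEdges α β).erase θ₀, indexTerm α β θ = 0 := by omega
  refine ⟨θ₀, by omega, fun θ hθ => ?_⟩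
  obtain ⟨k, hk1, hk2⟩ := exists_int_add_mem_Ioc n θ
  rw [← indexTerm_add_int_mul hp θ k]
  by_cases he : θ + k * (2 * π * n) ∈ periodEdges α β
  · refine (Finset.sum_eq_zero_iff_of_nonneg fun θ _ => hnn θ).mp h3 _
      (Finset.mem_erase.mpr ⟨fun h => hθ ?_, he⟩)
    rw [← h, coe_add_int_mul]
  · rw [mem_periodEdges] at he
    exact indexTerm_eq_zero_of_not_isEdge (fun h => he ⟨⟨hk1, hk2⟩, Or.inl h⟩)
      fun h => he ⟨⟨hk1, hk2⟩, Or.inr h⟩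

end IndexTerm

/-! ### Rounding a corner -/

theorem exists_cross_eq_one {v : ℤ × ℤ} (h : IsCoprime v.1 v.2) : ∃ w, cross v w = 1 := by
  obtain ⟨a, b, hab⟩ := h
  exact ⟨(-b, a), by simp only [cross]; linear_combination hab⟩

/-- The lattice points of the triangle, other than its corner `c`, in barycentric coordinates. -/
theorem mem_roundingPoints_iff {c w : ℤ × ℤ} {θ₁ θ₂ : ℝ} :
    w ∈ roundingPoints c θ₁ θ₂ ↔ w ≠ c ∧ ∃ s t : ℝ, 0 ≤ s ∧ 0 ≤ t ∧ s + t ≤ 1 ∧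
      ((w - c).1 : ℝ) = t * (dirVec θ₂).1 - s * (dirVec θ₁).1 ∧
      ((w - c).2 : ℝ) = t * (dirVec θ₂).2 - s * (dirVec θ₁).2 := by
  refine and_congr_right fun _ => ⟨fun h => ?_, ?_⟩
  · set S : Set (ℝ × ℝ) := {p | ∃ s t : ℝ, 0 ≤ s ∧ 0 ≤ t ∧ s + t ≤ 1 ∧
      p.1 - c.1 = t * (dirVec θ₂).1 - s * (dirVec θ₁).1 ∧
      p.2 - c.2 = t * (dirVec θ₂).2 - s * (dirVec θ₁).2} with hS
    have hconv : Convex ℝ S := by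
      rintro p ⟨s, t, hs, ht, hst, h1, h2⟩ q ⟨s', t', hs', ht', hst', h1', h2'⟩ a b ha hb hab
      refine ⟨a * s + b * s', a * t + b * t', by positivity, by positivity, ?_, ?_, ?_⟩
      · nlinarith
      · simp only [Prod.fst_add, Prod.smul_fst, smul_eq_mul]
        linear_combination a * h1 + b * h1' + c.1 * hab
      · simp only [Prod.snd_add, Prod.smul_snd, smul_eq_mul]
        linear_combination a * h2 + b * h2' + c.2 * hab
    have hsub : {toPlane (c - dirVec θ₁), toPlane c, toPlane (c + dirVec θ₂)} ⊆ S := by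
      rintro p (rfl | rfl | rfl)
      · exact ⟨1, 0, by simp, by simp, by simp, by simp [toPlane], by simp [toPlane]⟩
      · exact ⟨0, 0, by simp, by simp, by simp, by simp [toPlane], by simp [toPlane]⟩
      · exact ⟨0, 1, by simp, by simp, by simp, by simp [toPlane], by simp [toPlane]⟩
    obtain ⟨s, t, hs, ht, hst, h1, h2⟩ := convexHull_min hsub hconv h
    exact ⟨s, t, hs, ht, hst, by simpa [toPlane] using h1, by simpa [toPlane] using h2⟩
  · rintro ⟨s, t, hs, ht, hst, h1, h2⟩
    have key : toPlane w = ∑ i : Fin 3, (![s, 1 - s - t, t] i) •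
        (![toPlane (c - dirVec θ₁), toPlane c, toPlane (c + dirVec θ₂)] i) := by
      simp only [Prod.fst_sub, Prod.snd_sub, Int.cast_sub] at h1 h2
      refine Prod.ext ?_ ?_
      · simp [Fin.sum_univ_three, toPlane]; linear_combination h1
      · simp [Fin.sum_univ_three, toPlane]; linear_combination h2
    rw [key]
    refine (convex_convexHull ℝ _).sum_mem (fun i _ => ?_) ?_ fun i _ => ?_
    · fin_cases i
      · exact hs
      · simp; linarith
      · exact ht
    · simp [Fin.sum_univ_three]; ring
    · refine subset_convexHull ℝ _ ?_
      fin_cases i <;> simp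

theorem detDir_of_barycentric {u v₁ v₂ : ℤ × ℤ} {s t : ℝ} (h1 : (u.1 : ℝ) = t * v₂.1 - s * v₁.1)
    (h2 : (u.2 : ℝ) = t * v₂.2 - s * v₁.2) (φ : ℝ) :
    detDir φ u = t * detDir φ v₂ - s * detDir φ v₁ := by
  simp only [detDir, h1, h2]; ring

/-- The lattice points of the triangle other than `c` lie strictly to the left of the lines through
`c` with directions strictly between those of the two edges. -/
theorem detDir_pos_of_mem_roundingPoints {c w : ℤ × ℤ} {θ₁ θ₂ φ : ℝ} (h₁ : IsRationalAngle θ₁)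
    (h₂ : IsRationalAngle θ₂) (hpi : θ₂ - θ₁ ≤ π) (h1 : θ₁ < φ) (h2 : φ < θ₂)
    (hw : w ∈ roundingPoints c θ₁ θ₂) : 0 < detDir φ (w - c) := by
  obtain ⟨hne, s, t, hs, ht, -, e1, e2⟩ := mem_roundingPoints_iff.mp hw
  rw [detDir_of_barycentric e1 e2]
  have p1 := detDir_dirVec_neg h₁ h1 (by linarith)
  have p2 := detDir_dirVec_pos h₂ h2 (by linarith)
  rcases hs.eq_or_lt with rfl | hs
  · rcases ht.eq_or_lt with rfl | ht
    · refine absurd ?_ hne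
      simp only [zero_mul, sub_self, Int.cast_eq_zero] at e1 e2
      exact sub_eq_zero.mp (Prod.ext e1 e2)
    · nlinarith
  · nlinarith

namespace AdmissiblePath

/-- `Λ'` differs from `Λ` by a modification at the corner between `θ₁` and `θ₂` that shortens both
adjacent edges by one unit. -/
structure IsCut (Λ : AdmissiblePath n) (θ₁ θ₂ : ℝ) (Λ' : AdmissiblePath n) : Prop where
  corner : Λ.IsCorner θ₁ θ₂
  period : Λ'.period = Λ.period
  outside : ∀ t : ℝ, (t : Angle n) ∉ arc n θ₁ θ₂ → Λ'.pos t = Λ.pos t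
  mult_left : Λ'.mult (θ₁ : Angle n) + 1 = Λ.mult (θ₁ : Angle n)
  mult_right : Λ'.mult (θ₂ : Angle n) + 1 = Λ.mult (θ₂ : Angle n)

/-- All edges that `Λ'` has between `θ₁` and `θ₂` lie on lines at lattice distance `1` from the
corner of `Λ`.  This characterizes the boundary of the convex hull of the remaining lattice points
(see `IsRounding.isUnimodularCut` and `IsUnimodularCut.isRounding`). -/
structure IsUnimodularCut (Λ : AdmissiblePath n) (θ₁ θ₂ : ℝ) (Λ' : AdmissiblePath n) : Prop
    extends IsCut Λ θ₁ θ₂ Λ' where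
  unimodular : ∀ θ, θ₁ < θ → θ < θ₂ → Λ'.IsEdge θ → cross (dirVec θ) (Λ'.pos θ - Λ.pos θ₁) = 1

variable {Λ Λ' : AdmissiblePath n} {θ₁ θ₂ : ℝ}

theorem IsRounding.isCut (h : IsRounding Λ θ₁ θ₂ Λ') : IsCut Λ θ₁ θ₂ Λ' :=
  ⟨h.corner, h.period, h.outside, h.mult_left, h.mult_right⟩

theorem IsCorner.lt_add_period (h : Λ.IsCorner θ₁ θ₂) : θ₂ < θ₁ + 2 * π * n := by
  have := h.le_pi
  have := two_pi_le_period n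
  linarith [Real.pi_pos]

theorem IsCorner.pos_eq (h : Λ.IsCorner θ₁ θ₂) {t : ℝ} (h1 : θ₁ ≤ t) (h2 : t < θ₂) :
    Λ.pos t = Λ.pos θ₁ :=
  Λ.pos_eq_of_not_isEdge h1 fun θ h3 h4 => h.consecutive θ ⟨h3, h4.trans_lt h2⟩

theorem IsCorner.left_eq (h : Λ.IsCorner θ₁ θ₂) : Λ.left θ₂ = Λ.pos θ₁ :=
  Λ.left_eq_of_not_isEdge h.lt fun θ h3 h4 => h.consecutive θ ⟨h3, h4⟩

namespace IsCut

theorem pos_eq (h : IsCut Λ θ₁ θ₂ Λ') {t : ℝ} (h1 : θ₂ ≤ t) (h2 : t < θ₁ + 2 * π * n) :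
    Λ'.pos t = Λ.pos t := by
  have hlt := h.corner.lt
  rcases h1.eq_or_lt with rfl | h1
  · obtain ⟨ε, hε, hB, e1, e2⟩ := Λ.exists_isolating₂ Λ' θ₂ (sub_pos.mpr h2)
    rw [← Λ.pos_eq_of_not_isEdge (s := θ₂) (t := θ₂ + ε) (by linarith)
        fun φ h4 h5 => e1 φ (by linarith) h5 h4.ne',
      ← Λ'.pos_eq_of_not_isEdge (s := θ₂) (t := θ₂ + ε) (by linarith)
        fun φ h4 h5 => e2 φ (by linarith) h5 h4.ne']
    refine h.outside _ fun hm => ?_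
    rw [mem_arc_iff_of_mem_Ico h.corner.lt_add_period (by linarith) (by linarith)] at hm
    linarith
  · refine h.outside _ fun hm => ?_
    rw [mem_arc_iff_of_mem_Ico h.corner.lt_add_period (by linarith) (by linarith)] at hm
    linarith

theorem left_left (h : IsCut Λ θ₁ θ₂ Λ') : Λ'.left θ₁ = Λ.left θ₁ := by
  have hlt := h.corner.lt_add_period
  obtain ⟨ε, hε, hB, e1, e2⟩ := Λ.exists_isolating₂ Λ' θ₁
    (B := θ₁ + 2 * π * n - θ₂) (by linarith)
  rw [Λ.left_eq_of_not_isEdge (s := θ₁ - ε) (by linarith)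
      fun φ h4 h5 => e1 φ h4.le (by linarith) h5.ne,
    Λ'.left_eq_of_not_isEdge (s := θ₁ - ε) (by linarith)
      fun φ h4 h5 => e2 φ h4.le (by linarith) h5.ne, ← sub_eq_zero,
    ← pos_sub_pos_add_int_mul h.period (θ₁ - ε) 1, sub_eq_zero]
  exact h.pos_eq (by push_cast; linarith) (by push_cast; linarith)

theorem pos_left (h : IsCut Λ θ₁ θ₂ Λ') : Λ'.pos θ₁ - Λ.pos θ₁ = -dirVec θ₁ := by
  rw [pos_sub_pos_eq_left_sub_left_add, h.left_left, sub_self, zero_add, ← h.mult_left]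
  push_cast
  rw [sub_add_cancel_left, neg_smul, one_smul]

theorem left_right (h : IsCut Λ θ₁ θ₂ Λ') : Λ'.left θ₂ - Λ.pos θ₁ = dirVec θ₂ := by
  have h1 := pos_sub_pos_eq_left_sub_left_add Λ Λ' θ₂
  rw [h.pos_eq le_rfl h.corner.lt_add_period, sub_self, ← h.mult_right, h.corner.left_eq] at h1
  push_cast at h1
  rw [sub_add_cancel_left, neg_smul, one_smul, eq_comm, ← sub_eq_add_neg, sub_eq_zero] at h1
  exact h1

section
variable {M : Type*} [AddCommGroup M] [LinearOrder M] [IsOrderedAddMonoid M]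

theorem map_le_of_left (h : IsCut Λ θ₁ θ₂ Λ') (f : ℤ × ℤ →+ M) {t : ℝ} (h1 : θ₁ ≤ t)
    (hf : ∀ θ, θ₁ < θ → θ ≤ t → Λ'.IsEdge θ → 0 ≤ f (dirVec θ)) :
    f (-dirVec θ₁) ≤ f (Λ'.pos t - Λ.pos θ₁) := by
  rw [← h.pos_left, map_sub, map_sub]
  exact sub_le_sub_right (Λ'.map_pos_le f h1 hf) _

theorem map_le_of_right (h : IsCut Λ θ₁ θ₂ Λ') (f : ℤ × ℤ →+ M) {t : ℝ} (h2 : t < θ₂)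
    (hf : ∀ θ, t < θ → θ < θ₂ → Λ'.IsEdge θ → 0 ≤ f (dirVec θ)) :
    f (Λ'.pos t - Λ.pos θ₁) ≤ f (dirVec θ₂) := by
  obtain ⟨ε, hε, hB, e⟩ := Λ'.exists_isolating θ₂ (sub_pos.mpr h2)
  rw [← h.left_right, Λ'.left_eq_of_not_isEdge (s := θ₂ - ε) (by linarith)
      fun φ h4 h5 => e φ h4.le (by linarith) h5.ne, map_sub, map_sub]
  exact sub_le_sub_right (Λ'.map_pos_le f (by linarith)
    fun θ h3 h4 => hf θ h3 (by linarith)) _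

end

/-- Rounding a two-gon creates no edges. -/
theorem not_isEdge_of_eq_pi (h : IsCut Λ θ₁ θ₂ Λ') (hpi : θ₂ - θ₁ = π) {θ : ℝ} (h1 : θ₁ < θ)
    (h2 : θ < θ₂) : ¬ Λ'.IsEdge θ := fun he => by
  have hr := h.corner.edge_left.isRationalAngle
  have e2 : dirVec θ₂ = -dirVec θ₁ := by
    rw [show θ₂ = θ₁ + π by linarith, dirVec_add_pi hr]
  have hnn : ∀ φ, θ₁ < φ → φ < θ₂ → Λ'.IsEdge φ → 0 < detDirHom θ₁ (dirVec φ) :=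
    fun φ h3 h4 h5 => detDir_dirVec_pos h5.isRationalAngle h3 (by linarith)
  have h3 := h.map_le_of_right (detDirHom θ₁) h2
    fun φ h3 h4 h5 => (hnn φ (by linarith) h4 h5).le
  have h4 := Λ'.map_pos_lt (detDirHom θ₁) (s := θ₁) (t := θ) (θ₀ := θ)
    (fun φ h5 h6 h7 => (hnn φ h5 (by linarith) h7).le) h1 le_rfl he (hnn θ h1 h2 he)
  have h5 := h.pos_left
  have h6 := congrArg (detDirHom θ₁) h5
  rw [map_sub] at h6 h3
  rw [map_neg] at h6
  rw [e2, map_neg] at h3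
  linarith

theorem add_int_mul (h : IsCut Λ θ₁ θ₂ Λ') (k : ℤ) :
    IsCut Λ (θ₁ + k * (2 * π * n)) (θ₂ + k * (2 * π * n)) Λ' where
  corner := by
    refine ⟨(isEdge_add_int_mul k).mpr h.corner.edge_left,
      (isEdge_add_int_mul k).mpr h.corner.edge_right, by linarith [h.corner.lt],
      by linarith [h.corner.le_pi], fun θ hθ he => ?_⟩
    refine h.corner.consecutive (θ + (-k : ℤ) * (2 * π * n)) ⟨?_, ?_⟩
      ((isEdge_add_int_mul _).mpr he)
    · push_cast; linarith [hθ.1]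
    · push_cast; linarith [hθ.2]
  period := h.period
  outside t ht := h.outside t (by rwa [arc_add_int_mul] at ht)
  mult_left := by rw [coe_add_int_mul]; exact h.mult_left
  mult_right := by rw [coe_add_int_mul]; exact h.mult_right

end IsCut

theorem IsUnimodularCut.add_int_mul (h : IsUnimodularCut Λ θ₁ θ₂ Λ') (k : ℤ) :
    IsUnimodularCut Λ (θ₁ + k * (2 * π * n)) (θ₂ + k * (2 * π * n)) Λ' where
  toIsCut := h.toIsCut.add_int_mul k
  unimodular θ h1 h2 he := by
    obtain ⟨φ, rfl⟩ : ∃ φ, θ = φ + k * (2 * π * n) := ⟨θ - k * (2 * π * n), by ring⟩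
    rw [dirVec_add_int_mul, pos_add_int_mul, pos_add_int_mul, h.period, add_sub_add_right_eq_sub]
    exact h.unimodular φ (by linarith) (by linarith) ((isEdge_add_int_mul k).mp he)

/-! ### Unimodular cuts are roundings -/

/-- The path obtained by a unimodular cut stays in the triangle. -/
theorem IsUnimodularCut.mem_roundingPoints (h : IsUnimodularCut Λ θ₁ θ₂ Λ') {t : ℝ}
    (h1 : θ₁ ≤ t) (h2 : t < θ₂) : Λ'.pos t ∈ roundingPoints (Λ.pos θ₁) θ₁ θ₂ := by
  have hc := h.corner
  have hr1 := hc.edge_left.isRationalAngle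
  have hr2 := hc.edge_right.isRationalAngle
  have hle := hc.le_pi
  rcases hle.eq_or_lt with hpi | hpi
  · have e : Λ'.pos t - Λ.pos θ₁ = -dirVec θ₁ := by
      rw [Λ'.pos_eq_of_not_isEdge h1 fun θ h3 h4 =>
        h.toIsCut.not_isEdge_of_eq_pi hpi h3 (by linarith), h.toIsCut.pos_left]
    refine mem_roundingPoints_iff.mpr ⟨fun h0 => ?_, 1, 0, by simp, by simp, by simp, ?_, ?_⟩
    · rw [h0, sub_self, eq_comm, neg_eq_zero] at e
      exact dirVec_ne_zero hr1 e
    · rw [e]; simp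
    · rw [e]; simp
  set u := Λ'.pos t - Λ.pos θ₁ with hu
  set v₁ := dirVec θ₁ with hv₁
  set v₂ := dirVec θ₂ with hv₂
  have hD : 0 < cross v₁ v₂ := cross_dirVec_pos hr1 hr2 hc.lt (by linarith)
  have hx1 : ∀ θ, θ₁ < θ → θ < θ₂ → Λ'.IsEdge θ → 0 < crossHom v₁ (dirVec θ) :=
    fun θ h3 h4 h5 => cross_dirVec_pos hr1 h5.isRationalAngle h3 (by linarith)
  have a1 : 0 ≤ cross v₁ u := by
    have := h.toIsCut.map_le_of_left (crossHom v₁) h1 fun θ h3 h4 h5 =>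
      (hx1 θ h3 (by linarith) h5).le
    rwa [map_neg, crossHom_apply, ← hv₁, cross_self, neg_zero] at this
  have a2 : 0 ≤ cross v₂ u := by
    have := h.toIsCut.map_le_of_right (-crossHom v₂) h2 fun θ h3 h4 h5 => by
      rw [AddMonoidHom.neg_apply, crossHom_apply, cross_swap, neg_neg]
      exact (cross_dirVec_pos h5.isRationalAngle hr2 h4 (by linarith)).le
    rw [AddMonoidHom.neg_apply, AddMonoidHom.neg_apply, crossHom_apply, crossHom_apply, ← hv₂,
      cross_self, ← hu] at this
    omega
  have a3 : cross (v₁ + v₂) u ≤ cross v₁ v₂ := by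
    rcases le_total 0 (detDir t (v₁ + v₂)) with h0 | h0
    · have := h.toIsCut.map_le_of_left (-crossHom (v₁ + v₂)) h1 fun θ h3 h4 h5 => by
        rw [AddMonoidHom.neg_apply, crossHom_apply, cross_swap, neg_neg,
          cross_nonneg_iff h5.isRationalAngle]
        refine detDir_nonneg_of_mem_Icc (a := θ₁) (b := t) (by linarith) h3.le h4 ?_ h0
        rw [detDir_add, hv₁, detDir_dirVec_self hr1, zero_add]
        exact (detDir_dirVec_pos hr2 hc.lt (by linarith)).le
      simp only [AddMonoidHom.neg_apply, crossHom_apply, cross_neg, neg_neg, ← hv₁, add_cross,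
        cross_self, ← hu] at this
      rw [add_cross]
      rw [cross_swap v₂ v₁] at this
      linarith
    · have := h.toIsCut.map_le_of_right (crossHom (v₁ + v₂)) h2 fun θ h3 h4 h5 => by
        rw [crossHom_apply, cross_swap, ← cross_neg, cross_nonneg_iff h5.isRationalAngle]
        refine detDir_nonneg_of_mem_Icc (a := t) (b := θ₂) (by linarith) h3.le h4.le ?_ ?_
        · rw [detDir_neg]; linarith
        · rw [detDir_neg, detDir_add, hv₂, detDir_dirVec_self hr2, add_zero]
          linarith [detDir_dirVec_neg hr1 hc.lt (by linarith)]
      simp only [crossHom_apply, ← hv₂, add_cross, cross_self, ← hu, add_zero] at this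
      rw [add_cross]
      exact this
  have a4 : u ≠ 0 := fun h0 => by
    by_cases he : ∃ θ, θ₁ < θ ∧ θ ≤ t ∧ Λ'.IsEdge θ
    · obtain ⟨θ, h3, h4, h5⟩ := he
      have h6 := Λ'.map_pos_lt (crossHom v₁) (s := θ₁) (t := t)
        (fun φ h7 h8 h9 => (hx1 φ h7 (by linarith) h9).le) h3 h4 h5
        (hx1 θ h3 (by linarith) h5)
      have h7 := congrArg (crossHom v₁) h.toIsCut.pos_left
      have h8 := congrArg (crossHom v₁) (hu.symm.trans h0)
      simp only [map_sub, map_neg, crossHom_apply, ← hv₁, cross_self, map_zero] at h6 h7 h8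
      omega
    · push Not at he
      rw [hu, Λ'.pos_eq_of_not_isEdge h1 he, h.toIsCut.pos_left, neg_eq_zero] at h0
      exact dirVec_ne_zero hr1 h0
  have hDr : (0 : ℝ) < cross v₁ v₂ := by exact_mod_cast hD
  rw [add_cross] at a3
  refine mem_roundingPoints_iff.mpr ⟨fun h0 => a4 (sub_eq_zero.mpr h0),
    cross v₂ u / cross v₁ v₂, cross v₁ u / cross v₁ v₂, ?_, ?_, ?_, ?_, ?_⟩
  · exact div_nonneg (by exact_mod_cast a2) hDr.le
  · exact div_nonneg (by exact_mod_cast a1) hDr.le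
  · rw [← add_div, div_le_one hDr]
    exact_mod_cast (by omega : cross v₂ u + cross v₁ u ≤ cross v₁ v₂)
  · rw [← hu]
    field_simp
    simp only [cross]; push_cast; ring
  · rw [← hu]
    field_simp
    simp only [cross]; push_cast; ring

/-- A time `t` in the corner lies between two times at which the triangle is on the left of the
line through the position of `Λ'`, hence the triangle is on the left at time `t`. -/
theorem IsUnimodularCut.detDir_nonneg (h : IsUnimodularCut Λ θ₁ θ₂ Λ') {t : ℝ}
    (h1 : θ₁ ≤ t) (h2 : t < θ₂) {w : ℤ × ℤ} (hw : w ∈ roundingPoints (Λ.pos θ₁) θ₁ θ₂) :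
    0 ≤ detDir t (w - Λ'.pos t) := by
  have hc := h.corner
  have hr1 := hc.edge_left.isRationalAngle
  have hr2 := hc.edge_right.isRationalAngle
  have hle := hc.le_pi
  have hsplit : ∀ p, w - p = (w - Λ.pos θ₁) - (p - Λ.pos θ₁) := fun p => by abel
  obtain ⟨hne, x, y, hx, hy, hxy, e1, e2⟩ := mem_roundingPoints_iff.mp hw
  rcases hle.eq_or_lt with hpi | hpi
  · -- the only lattice points of a two-gon are its two corners
    have hv : dirVec θ₂ = -dirVec θ₁ := by
      rw [show θ₂ = θ₁ + π by linarith, dirVec_add_pi hr1]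
    rw [hv] at e1 e2
    simp only [Prod.fst_neg, Prod.snd_neg, Int.cast_neg, mul_neg] at e1 e2
    have hx0 : cross (dirVec θ₁) (w - Λ.pos θ₁) = 0 := by
      have : (cross (dirVec θ₁) (w - Λ.pos θ₁) : ℝ) = 0 := by
        simp only [cross]; push_cast; rw [e1, e2]; ring
      exact_mod_cast this
    obtain ⟨k, hk⟩ := exists_zsmul_of_cross_eq_zero (dirVec_isCoprime hr1) hx0
    have hk0 : k ≠ 0 := fun h0 => hne (by rwa [h0, zero_smul, sub_eq_zero] at hk)
    rw [hk] at e1 e2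
    simp only [Prod.smul_fst, Prod.smul_snd, smul_eq_mul, Int.cast_mul] at e1 e2
    have hk1 : (k : ℝ) = -(x + y) := by
      have hz : ((k : ℝ) + (x + y)) * (dirVec θ₁).1 = 0 := by linear_combination e1
      have hz' : ((k : ℝ) + (x + y)) * (dirVec θ₁).2 = 0 := by linear_combination e2
      by_contra hcon
      have hs : (k : ℝ) + (x + y) ≠ 0 := fun h0 => hcon (by linarith)
      refine dirVec_ne_zero hr1 (Prod.ext ?_ ?_)
      · exact_mod_cast (mul_eq_zero.mp hz).resolve_left hs
      · exact_mod_cast (mul_eq_zero.mp hz').resolve_left hs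
    have hk2 : k = -1 := by
      have h3 : (-1 : ℝ) ≤ k := by linarith
      have h4 : (k : ℝ) ≤ 0 := by linarith
      have h3' : -1 ≤ k := by exact_mod_cast h3
      have h4' : k ≤ 0 := by exact_mod_cast h4
      omega
    rw [hsplit, hk, hk2, Λ'.pos_eq_of_not_isEdge h1 fun θ h3 h4 =>
      h.toIsCut.not_isEdge_of_eq_pi hpi h3 (by linarith), h.toIsCut.pos_left]
    simp
  · have hedge : ∀ θ, θ₁ < θ → θ < θ₂ → Λ'.IsEdge θ →
        0 ≤ detDir θ (w - Λ'.pos θ) := fun θ h3 h4 h5 => by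
      have hr := h5.isRationalAngle
      have h6 := (cross_pos_iff hr _).mpr (detDir_pos_of_mem_roundingPoints hr1 hr2 hle h3 h4 hw)
      rw [← cross_nonneg_iff hr, hsplit, cross_sub, h.unimodular θ h3 h4 h5]
      omega
    obtain ⟨a, ha1, hat, ha⟩ : ∃ a, θ₁ ≤ a ∧ a ≤ t ∧ 0 ≤ detDir a (w - Λ'.pos t) := by
      by_cases he : ∃ θ, θ₁ < θ ∧ θ ≤ t ∧ Λ'.IsEdge θ
      · obtain ⟨θ, h3, h4, h5⟩ := he
        obtain ⟨a, h6, h7, h8, h9⟩ := Λ'.exists_last_edge h4 h5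
        refine ⟨a, by linarith, h7, ?_⟩
        rw [Λ'.pos_eq_of_not_isEdge h7 h9]
        exact hedge a (by linarith) (by linarith) h8
      · push Not at he
        refine ⟨θ₁, le_rfl, h1, ?_⟩
        rw [Λ'.pos_eq_of_not_isEdge h1 he, hsplit, h.toIsCut.pos_left, detDir_sub, detDir_neg,
          detDir_of_barycentric e1 e2, detDir_dirVec_self hr1]
        have := detDir_dirVec_pos hr2 hc.lt (by linarith)
        have := mul_nonneg hy this.le
        linarith
    obtain ⟨b, hb1, hbt, hb⟩ : ∃ b, t ≤ b ∧ b ≤ θ₂ ∧ 0 ≤ detDir b (w - Λ'.pos t) := by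
      by_cases he : ∃ θ, t < θ ∧ θ < θ₂ ∧ Λ'.IsEdge θ
      · obtain ⟨θ, h3, h4, h5⟩ := he
        obtain ⟨b, h6, h7, h8, h9⟩ := Λ'.exists_first_edge h3 h5
        refine ⟨b, h6.le, by linarith, ?_⟩
        have h10 := hedge b (by linarith) (by linarith) h8
        rw [← Λ'.left_eq_of_not_isEdge h6 h9, left, ← natCast_zsmul, sub_sub_eq_add_sub,
          add_sub_right_comm, detDir_add, detDir_zsmul, detDir_dirVec_self h8.isRationalAngle]
        linarith
      · push Not at he
        refine ⟨θ₂, h2.le, le_rfl, ?_⟩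
        rw [← Λ'.left_eq_of_not_isEdge h2 he, hsplit, h.toIsCut.left_right, detDir_sub,
          detDir_of_barycentric e1 e2, detDir_dirVec_self hr2]
        have := detDir_dirVec_neg hr1 hc.lt (by linarith)
        have := mul_nonneg hx (neg_pos.mpr this).le
        linarith
    exact detDir_nonneg_of_mem_Icc (by linarith) hat hb1 ha hb

/-- A lattice segment at lattice distance at least `2` from the origin spans with it a triangle
that contains a lattice point nearer to the origin: at height `f - 1` the triangle has width
`(f - 1) / f`, and the ends of this slice lie in `f⁻¹ℤ`. -/
theorem exists_lower_lattice_point {d u : ℤ × ℤ} (hd : IsCoprime d.1 d.2)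
    (hf : 2 ≤ cross d u) : ∃ (q : ℤ × ℤ) (σ τ : ℝ), cross d q = cross d u - 1 ∧ 0 ≤ τ ∧ τ ≤ σ ∧
      σ ≤ 1 ∧ (q.1 : ℝ) = σ * u.1 + τ * d.1 ∧ (q.2 : ℝ) = σ * u.2 + τ * d.2 := by
  obtain ⟨k₀, hk₀⟩ := exists_cross_eq_one hd
  set f := cross d u with hfdef
  obtain ⟨p, hp⟩ := exists_zsmul_of_cross_eq_zero (w := u - f • k₀) hd
    (by rw [cross_sub, cross_zsmul, hk₀, ← hfdef]; ring)
  rw [sub_eq_iff_eq_add] at hp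
  set i := -((-((f - 1) * p)) / f) with hi
  have hdm := Int.mul_ediv_add_emod (-((f - 1) * p)) f
  have hm0 := Int.emod_nonneg (-((f - 1) * p)) (show f ≠ 0 by omega)
  have hm1 := Int.emod_lt_of_pos (-((f - 1) * p)) (show 0 < f by omega)
  have h1 : (f - 1) * p ≤ f * i := by rw [hi]; linarith
  have h2 : f * i ≤ (f - 1) * p + (f - 1) := by rw [hi]; linarith
  have hf0 : (0 : ℝ) < f := by exact_mod_cast (show 0 < f by omega)
  have h1' : ((f : ℝ) - 1) * p ≤ f * i := by exact_mod_cast h1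
  have h2' : (f : ℝ) * i ≤ (f - 1) * p + (f - 1) := by exact_mod_cast h2
  refine ⟨i • d + (f - 1) • k₀, (f - 1) / f, i - (f - 1) * p / f, ?_, ?_, ?_, ?_, ?_, ?_⟩
  · rw [cross_add, cross_zsmul, cross_zsmul, hk₀, cross_self]; ring
  · rw [sub_nonneg, div_le_iff₀ hf0]; linarith
  · rw [sub_le_iff_le_add, ← add_div, le_div_iff₀ hf0]; linarith
  · rw [div_le_one hf0]; linarith
  · rw [hp]; simp only [Prod.fst_add, Prod.smul_fst, smul_eq_mul]; push_cast; field_simp; ring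
  · rw [hp]; simp only [Prod.snd_add, Prod.smul_snd, smul_eq_mul]; push_cast; field_simp; ring

theorem IsRounding.isUnimodularCut (h : IsRounding Λ θ₁ θ₂ Λ') : IsUnimodularCut Λ θ₁ θ₂ Λ' where
  toIsCut := h.isCut
  unimodular θ h1 h2 he := by
    have hc := h.corner
    have hr := he.isRationalAngle
    have hr1 := hc.edge_left.isRationalAngle
    have hr2 := hc.edge_right.isRationalAngle
    obtain ⟨ε, hε, hB, e⟩ := Λ'.exists_isolating θ (sub_pos.mpr h1)
    have hleft : Λ'.left θ = Λ'.pos (θ - ε) := Λ'.left_eq_of_not_isEdge (by linarith)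
      fun φ h4 h5 => e φ h4.le (by linarith) h5.ne
    obtain ⟨hw', hmin⟩ := h.inside θ ⟨h1, h2⟩
    have hw := (h.inside (θ - ε) ⟨by linarith, by linarith⟩).1
    rw [← hleft] at hw
    set c := Λ.pos θ₁
    set d := dirVec θ with hd
    set u := Λ'.left θ - c with hu
    set m := Λ'.mult (θ : Angle n) with hm
    have hm1 : (1 : ℝ) ≤ m := by
      rw [IsEdge] at he
      exact_mod_cast Nat.one_le_iff_ne_zero.mpr he
    have hu' : Λ'.pos θ - c = u + m • d := by rw [hu, ← left_add_dirVec]; abel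
    have hcr : cross d (Λ'.pos θ - c) = cross d u := by
      rw [hu', cross_add, cross_nsmul, cross_self, mul_zero, add_zero]
    rw [hcr]
    have hpos : 0 < cross d u := (cross_pos_iff hr _).mpr
      (detDir_pos_of_mem_roundingPoints hr1 hr2 hc.le_pi h1 h2 hw)
    by_contra hcon
    obtain ⟨q, σ, τ, hq, hτ0, hτσ, hσ1, q1, q2⟩ :=
      exists_lower_lattice_point (d := d) (dirVec_isCoprime hr) (show 2 ≤ cross d u by omega)
    obtain ⟨-, s, t, hs, ht, hst, s1, s2⟩ := mem_roundingPoints_iff.mp hw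
    obtain ⟨-, s', t', hs', ht', hst', s1', s2'⟩ := mem_roundingPoints_iff.mp hw'
    rw [hu'] at s1' s2'
    rw [← hu] at s1 s2
    simp only [Prod.fst_add, Prod.snd_add, Prod.smul_fst, Prod.smul_snd] at s1' s2'
    simp only [nsmul_eq_mul, Int.cast_add, Int.cast_mul, Int.cast_natCast] at s1' s2'
    have hτm : τ / m ≤ σ := (div_le_self hτ0 hm1).trans hτσ
    have hτm0 : 0 ≤ τ / m := by positivity
    have hqW : c + q ∈ roundingPoints c θ₁ θ₂ := by
      refine mem_roundingPoints_iff.mpr ⟨fun h0 => ?_, (σ - τ / m) * s + τ / m * s',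
        (σ - τ / m) * t + τ / m * t', ?_, ?_, ?_, ?_, ?_⟩
      · rw [add_eq_left] at h0
        rw [h0, cross_zero] at hq
        omega
      · exact add_nonneg (mul_nonneg (by linarith) hs) (mul_nonneg hτm0 hs')
      · exact add_nonneg (mul_nonneg (by linarith) ht) (mul_nonneg hτm0 ht')
      · have g1 := mul_le_mul_of_nonneg_left hst (show 0 ≤ σ - τ / m by linarith)
        have g2 := mul_le_mul_of_nonneg_left hst' hτm0
        linarith
      · rw [add_sub_cancel_left, q1]
        have : τ * (d.1 : ℝ) = τ / m * (m * d.1) := by field_simp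
        rw [this]
        linear_combination (σ - τ / m) * s1 + τ / m * s1'
      · rw [add_sub_cancel_left, q2]
        have : τ * (d.2 : ℝ) = τ / m * (m * d.2) := by field_simp
        rw [this]
        linear_combination (σ - τ / m) * s2 + τ / m * s2'
    have hge := (cross_nonneg_iff hr _).mpr (hmin _ hqW)
    rw [show c + q - Λ'.pos θ = q - (Λ'.pos θ - c) by abel, cross_sub, hcr, hq] at hge
    omega

theorem IsUnimodularCut.isRounding (h : IsUnimodularCut Λ θ₁ θ₂ Λ') : IsRounding Λ θ₁ θ₂ Λ' :=
  ⟨h.corner, h.period, h.outside, h.mult_left, h.mult_right, fun _ ht =>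
    ⟨h.mem_roundingPoints ht.1.le ht.2, fun _ hw => h.detDir_nonneg ht.1.le ht.2 hw⟩⟩

/-! ### Roundings are nested and unique -/

theorem IsRounding.isLeftOf (h : IsRounding Λ θ₁ θ₂ Λ') : IsLeftOf Λ' Λ := fun t => by
  have hr1 := h.corner.edge_left.isRationalAngle
  obtain ⟨k, h1, h2⟩ := exists_int_add_mem_Ico n θ₁ t
  rw [← pos_sub_pos_add_int_mul h.period t k, ← detDir_add_int_mul t n k]
  generalize t + k * (2 * π * n) = t at h1 h2
  rcases lt_or_ge t θ₂ with h3 | h3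
  · rw [h.corner.pos_eq h1 h3]
    rcases h1.eq_or_lt with rfl | h1
    · rw [h.isCut.pos_left, detDir_neg, detDir_dirVec_self hr1, neg_zero]
    · exact (detDir_pos_of_mem_roundingPoints hr1 h.corner.edge_right.isRationalAngle
        h.corner.le_pi h1 h3 (h.inside t ⟨h1, h3⟩).1).le
  · rw [h.isCut.pos_eq h3 h2, sub_self, detDir_zero]

theorem IsRounding.pos_ne (h : IsRounding Λ θ₁ θ₂ Λ') {t : ℝ} (h1 : θ₁ ≤ t) (h2 : t < θ₂) :
    Λ'.pos t ≠ Λ.pos t := by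
  rw [h.corner.pos_eq h1 h2]
  exact (h.isUnimodularCut.mem_roundingPoints h1 h2).1

theorem ext_pos {Λ Λ' : AdmissiblePath n} (hper : Λ.period = Λ'.period)
    (h : ∀ t, Λ.pos t = Λ'.pos t) : Λ = Λ' := by
  have hm : Λ.mult = Λ'.mult := by
    refine Finsupp.ext fun x => ?_
    obtain ⟨θ, rfl⟩ := QuotientAddGroup.mk_surjective x
    obtain ⟨ε, hε, -, e1, e2⟩ := Λ.exists_isolating₂ Λ' θ one_pos
    have hl : Λ.left θ = Λ'.left θ := by
      rw [Λ.left_eq_of_not_isEdge (s := θ - ε) (by linarith)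
          fun φ h4 h5 => e1 φ h4.le (by linarith) h5.ne,
        Λ'.left_eq_of_not_isEdge (s := θ - ε) (by linarith)
          fun φ h4 h5 => e2 φ h4.le (by linarith) h5.ne, h]
    by_cases hr : IsRationalAngle θ
    · have := pos_sub_pos_eq_left_sub_left_add Λ Λ' θ
      rw [h, hl, sub_self, sub_self, zero_add, eq_comm, smul_eq_zero,
        or_iff_left (dirVec_ne_zero hr)] at this
      omega
    · have h1 : ¬ Λ.IsEdge θ := fun h => hr h.isRationalAngle
      have h2 : ¬ Λ'.IsEdge θ := fun h => hr h.isRationalAngle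
      simp only [IsEdge, not_not] at h1 h2
      rw [h1, h2]
  have hp : Λ.pos = Λ'.pos := funext h
  cases Λ; cases Λ'
  simp only at hm hp hper
  subst hm hp hper
  rfl

/-- The rounding of a corner is unique: two points of a set that both have the set on the left of
the lines through them, for an interval of directions, are equal. -/
theorem IsRounding.unique {Λ'' : AdmissiblePath n} (h : IsRounding Λ θ₁ θ₂ Λ')
    (h' : IsRounding Λ θ₁ θ₂ Λ'') : Λ' = Λ'' := by
  refine ext_pos (h.period.trans h'.period.symm) fun t => ?_
  have hper := h.period.trans h'.period.symm
  obtain ⟨k, h1, h2⟩ := exists_int_add_mem_Ico n θ₁ t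
  rw [← sub_eq_zero, ← pos_sub_pos_add_int_mul hper t k]
  generalize t + k * (2 * π * n) = t at h1 h2
  rw [sub_eq_zero]
  rcases lt_or_ge t θ₂ with h3 | h3
  · have hz : ∀ s, θ₁ ≤ s → s < θ₂ → detDir s (Λ'.pos s - Λ''.pos s) = 0 := fun s h4 h5 =>
      le_antisymm (by
          rw [← neg_sub, detDir_neg, neg_nonpos]
          exact h.isUnimodularCut.detDir_nonneg h4 h5
            (h'.isUnimodularCut.mem_roundingPoints h4 h5))
        (h'.isUnimodularCut.detDir_nonneg h4 h5 (h.isUnimodularCut.mem_roundingPoints h4 h5))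
    obtain ⟨ε, hε, hB, e1, e2⟩ := Λ'.exists_isolating₂ Λ'' t (sub_pos.mpr h3)
    have h4 := hz (t + ε) (by linarith) (by linarith)
    rw [Λ'.pos_eq_of_not_isEdge (s := t) (t := t + ε) (by linarith)
        fun φ h4 h5 => e1 φ (by linarith) h5 h4.ne',
      Λ''.pos_eq_of_not_isEdge (s := t) (t := t + ε) (by linarith)
        fun φ h4 h5 => e2 φ (by linarith) h5 h4.ne'] at h4
    have hpi := h.corner.le_pi
    exact sub_eq_zero.mp (eq_zero_of_detDir_eq_zero (by linarith) (by linarith) (hz t h1 h3) h4)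
  · rw [h.isCut.pos_eq h3 h2, h'.isCut.pos_eq h3 h2]

/-- The corner is determined by its rounding. -/
theorem IsRounding.corner_unique {φ₁ φ₂ : ℝ} (h : IsRounding Λ θ₁ θ₂ Λ')
    (h' : IsRounding Λ φ₁ φ₂ Λ') :
    ∃ k : ℤ, φ₁ = θ₁ + k * (2 * π * n) ∧ φ₂ = θ₂ + k * (2 * π * n) := by
  obtain ⟨k, h1, h2⟩ := exists_int_add_mem_Ico n φ₁ θ₁
  have hk := (h.isCut.add_int_mul k).corner
  have h3 : θ₁ + k * (2 * π * n) < φ₂ := by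
    by_contra hcon
    push Not at hcon
    have := h'.isCut.pos_eq hcon h2
    rw [← sub_eq_zero, pos_sub_pos_add_int_mul h.period, sub_eq_zero] at this
    exact h.pos_ne le_rfl h.corner.lt this
  have h4 : φ₁ = θ₁ + k * (2 * π * n) := by
    by_contra hne
    exact h'.corner.consecutive _ ⟨lt_of_le_of_ne h1 hne, h3⟩ hk.edge_left
  refine ⟨k, h4, ?_⟩
  rcases lt_trichotomy φ₂ (θ₂ + k * (2 * π * n)) with h5 | h5 | h5
  · exact absurd h'.corner.edge_right (hk.consecutive _ ⟨h3, h5⟩)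
  · exact h5
  · exact absurd hk.edge_right (h'.corner.consecutive _ ⟨h4 ▸ hk.lt, h5⟩)

end AdmissiblePath

/-! ### Nonzero coefficients come from rounding one corner -/

section Components

variable {α β : Generator n}

theorem isClosed_arc (a b : ℝ) : IsClosed (arc n a b) :=
  (isCompact_Icc.image (AddCircle.continuous_mk' _)).isClosed

theorem coe_mem_disagreement {t : ℝ} (h : β.path.pos t ≠ α.path.pos t) :
    (t : Angle n) ∈ disagreement α β := by
  obtain ⟨ε, hε, -, e1, e2⟩ := α.path.exists_isolating₂ β.path t one_pos
  have hsub : (fun s : ℝ => (s : Angle n)) '' Set.Ioo t (t + ε) ⊆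
      {x | ∃ t : ℝ, (t : Angle n) = x ∧ ¬ α.path.IsEdge t ∧ ¬ β.path.IsEdge t ∧
        α.path.pos t ≠ β.path.pos t} := by
    rintro _ ⟨s, ⟨h1, h2⟩, rfl⟩
    refine ⟨s, rfl, e1 s (by linarith) h2.le h1.ne', e2 s (by linarith) h2.le h1.ne', ?_⟩
    rw [α.path.pos_eq_of_not_isEdge h1.le fun φ h4 h5 => e1 φ (by linarith) (by linarith) h4.ne',
      β.path.pos_eq_of_not_isEdge h1.le fun φ h4 h5 => e2 φ (by linarith) (by linarith) h4.ne']
    exact h.symm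
  refine closure_mono hsub (image_closure_subset_closure_image (AddCircle.continuous_mk' _) ?_)
  refine ⟨t, ?_, rfl⟩
  rw [closure_Ioo (by linarith)]
  exact ⟨le_rfl, by linarith⟩

theorem arc_subset_disagreement {a b : ℝ} (hab : a < b)
    (h : ∀ t, a ≤ t → t < b → β.path.pos t ≠ α.path.pos t) : arc n a b ⊆ disagreement α β := by
  rw [arc, ← closure_Ico hab.ne]
  refine (image_closure_subset_closure_image (AddCircle.continuous_mk' _)).trans
    (closure_minimal ?_ isClosed_closure)
  rintro _ ⟨t, ⟨h1, h2⟩, rfl⟩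
  exact coe_mem_disagreement (h t h1 h2)

theorem disagreement_subset_arc (hp : β.path.period = α.path.period) {a b : ℝ}
    (h : ∀ t, b ≤ t → t < a + 2 * π * n → β.path.pos t = α.path.pos t) :
    disagreement α β ⊆ arc n a b := by
  refine closure_minimal ?_ (isClosed_arc a b)
  rintro _ ⟨t, rfl, -, -, ht⟩
  obtain ⟨k, h1, h2⟩ := exists_int_add_mem_Ico n a t
  refine mem_arc_iff.mpr ⟨k, h1, ?_⟩
  by_contra hcon
  have := h _ (not_le.mp hcon).le h2
  rw [← sub_eq_zero, pos_sub_pos_add_int_mul hp, sub_eq_zero] at this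
  exact ht this.symm

/-- If the disagreement set is connected, the paths agree off one component of the set of times
where they disagree. -/
theorem pos_eq_off_component (hp : β.path.period = α.path.period)
    (hconn : IsPreconnected (disagreement α β)) {a b : ℝ} (hab : a < b)
    (h : ∀ t, a ≤ t → t < b → β.path.pos t ≠ α.path.pos t)
    (ha : β.path.left a = α.path.left a) (hb : β.path.pos b = α.path.pos b) {t : ℝ}
    (h1 : b ≤ t) (h2 : t < a + 2 * π * n) : β.path.pos t = α.path.pos t := by
  by_contra hne
  obtain ⟨ε, hε, -, e1, e2⟩ := α.path.exists_isolating₂ β.path a one_pos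
  obtain ⟨δ, hδ, -, d1, d2⟩ := α.path.exists_isolating₂ β.path b one_pos
  have hopen : ∀ x y : ℝ, IsOpen ((fun s : ℝ => (s : Angle n)) '' Set.Ioo x y) := fun x y =>
    QuotientAddGroup.isOpenMap_coe _ isOpen_Ioo
  have hzero : ∀ s, s ∈ Set.Ioo (a - ε) a ∪ Set.Ioo b (b + δ) →
      β.path.pos s = α.path.pos s := by
    rintro s (⟨h3, h4⟩ | ⟨h3, h4⟩)
    · rw [← α.path.left_eq_of_not_isEdge h4 fun φ h5 h6 => e1 φ (by linarith) (by linarith) h6.ne,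
        ← β.path.left_eq_of_not_isEdge h4 fun φ h5 h6 => e2 φ (by linarith) (by linarith) h6.ne, ha]
    · rw [α.path.pos_eq_of_not_isEdge h3.le fun φ h5 h6 =>
          d1 φ (by linarith) (by linarith) h5.ne',
        β.path.pos_eq_of_not_isEdge h3.le fun φ h5 h6 =>
          d2 φ (by linarith) (by linarith) h5.ne', hb]
  have hnot : ∀ s, s ∈ Set.Ioo (a - ε) a ∪ Set.Ioo b (b + δ) →
      (s : Angle n) ∉ disagreement α β := by
    intro s hs hmem
    have hO : IsOpen ((fun s : ℝ => (s : Angle n)) ''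
        (Set.Ioo (a - ε) a ∪ Set.Ioo b (b + δ))) :=
      QuotientAddGroup.isOpenMap_coe _ (isOpen_Ioo.union isOpen_Ioo)
    obtain ⟨_, ⟨s', hs', hss'⟩, ⟨t', rfl, -, -, ht'⟩⟩ :=
      mem_closure_iff.mp hmem _ hO ⟨s, hs, rfl⟩
    obtain ⟨k, rfl⟩ := coe_eq_coe_iff.mp hss'
    have := hzero s' hs'
    rw [← sub_eq_zero, ← pos_sub_pos_add_int_mul hp s' k, sub_eq_zero] at this
    exact ht' this.symm
  have hUV : disagreement α β ⊆ ((fun s : ℝ => (s : Angle n)) '' Set.Ioo (a - ε) (b + δ)) ∪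
      (arc n a b)ᶜ := by
    intro x _
    by_cases hx : x ∈ arc n a b
    · obtain ⟨s, ⟨h3, h4⟩, rfl⟩ := hx
      exact Or.inl ⟨s, ⟨by linarith, by linarith⟩, rfl⟩
    · exact Or.inr hx
  have hbt : b < t := lt_of_le_of_ne h1 fun h0 => hne (h0 ▸ hb)
  obtain ⟨_, hD, ⟨s, ⟨h3, h4⟩, rfl⟩, hs⟩ := hconn _ _ (hopen _ _) (isClosed_arc a b).isOpen_compl
    hUV ⟨(a : Angle n), coe_mem_disagreement (h a le_rfl hab), a, ⟨by linarith, by linarith⟩, rfl⟩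
    ⟨(t : Angle n), coe_mem_disagreement hne, fun hm =>
      absurd ((mem_arc_iff_of_mem_Ico (by linarith) (by linarith) h2).mp hm) (not_le.mpr hbt)⟩
  refine hnot s ?_ hD
  rcases lt_or_ge s a with h5 | h5
  · exact Or.inl ⟨h3, h5⟩
  · rcases lt_or_ge b s with h6 | h6
    · exact Or.inr ⟨h6, h4⟩
    · exact absurd ⟨s, ⟨h5, h6⟩, rfl⟩ hs

/-- A time at which nested paths differ lies in a corner of the outer path that is not a kink, and
the paths differ all along this corner. -/
theorem exists_corner_of_pos_ne (hn : IsLeftOf β.path α.path) {t₀ : ℝ}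
    (h : β.path.pos t₀ ≠ α.path.pos t₀) : ∃ a b, a ≤ t₀ ∧ t₀ < b ∧ α.path.IsCorner a b ∧
      ∀ t, a ≤ t → t < b → β.path.pos t ≠ α.path.pos t := by
  obtain ⟨θ, hθ⟩ : ∃ θ, α.path.IsEdge θ := by
    by_contra hno
    push Not at hno
    exact h (pos_eq_of_kink hn (a := t₀) (b := t₀ + π + 1) (by linarith) (fun θ _ _ => hno θ)
      le_rfl (by linarith [Real.pi_pos]))
  obtain ⟨a, ha, hae, ha'⟩ := α.path.exists_edge_lt t₀ hθ
  obtain ⟨b, hb, hbe, hb'⟩ := α.path.exists_edge_gt t₀ hθ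
  have hgap : ∀ θ, a < θ → θ < b → ¬ α.path.IsEdge θ := fun θ h1 h2 => by
    rcases le_or_gt θ t₀ with h3 | h3
    · exact ha' θ h1 h3
    · exact hb' θ h3 h2
  have hle : b ≤ a + π := by
    by_contra hcon
    exact h (pos_eq_of_kink hn (not_le.mp hcon) hgap ha hb)
  refine ⟨a, b, ha, hb, ⟨hae, hbe, by linarith, by linarith, fun θ hθ => hgap θ hθ.1 hθ.2⟩,
    fun t h1 h2 h3 => h (pos_eq_of_pos_eq hn hle hgap h1 h2 h3 ha hb)⟩

theorem left_ne_of_pos_ne {a b : ℝ} (hab : a < b)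
    (h : ∀ t, a ≤ t → t < b → β.path.pos t ≠ α.path.pos t) : β.path.left b ≠ α.path.left b := by
  obtain ⟨ε, hε, hB, e1, e2⟩ := α.path.exists_isolating₂ β.path b (sub_pos.mpr hab)
  rw [α.path.left_eq_of_not_isEdge (s := b - ε) (by linarith)
      fun φ h5 h6 => e1 φ (by linarith) (by linarith) h6.ne,
    β.path.left_eq_of_not_isEdge (s := b - ε) (by linarith)
      fun φ h5 h6 => e2 φ (by linarith) (by linarith) h6.ne]
  exact h _ (by linarith) (by linarith)

/-- Two adjacent corners of `α` cannot form a component: this would be a double rounding. -/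
theorem not_two_corners (hp : β.path.period = α.path.period)
    (hconn : IsPreconnected (disagreement α β))
    (hdr : (α.path.mult.support.filter (· ∈ disagreement α β)).card ≠ 3) {a b c : ℝ}
    (hab : α.path.IsCorner a b) (hbc : α.path.IsCorner b c)
    (h1 : ∀ t, a ≤ t → t < b → β.path.pos t ≠ α.path.pos t)
    (h2 : ∀ t, b ≤ t → t < c → β.path.pos t ≠ α.path.pos t)
    (ha : β.path.left a = α.path.left a) : β.path.pos c ≠ α.path.pos c := by
  intro hc
  have lab := hab.lt
  have lbc := hbc.lt
  have hpi := two_pi_le_period n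
  have l1 := hab.le_pi
  have l2 := hbc.le_pi
  have h : ∀ t, a ≤ t → t < c → β.path.pos t ≠ α.path.pos t := fun t h3 h4 => by
    rcases lt_or_ge t b with h5 | h5
    · exact h1 t h3 h5
    · exact h2 t h5 h4
  have hD : disagreement α β = arc n a c := Set.Subset.antisymm
    (disagreement_subset_arc hp fun t h3 h4 =>
      pos_eq_off_component hp hconn (lab.trans lbc) h ha hc h3 h4)
    (arc_subset_disagreement (lab.trans lbc) h)
  have hac : (a : Angle n) ≠ (c : Angle n) := fun h0 => by
    obtain ⟨k, rfl⟩ := coe_eq_coe_iff.mp h0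
    rw [← sub_eq_zero, pos_sub_pos_add_int_mul hp, sub_eq_zero] at hc
    exact h a le_rfl (lab.trans lbc) hc
  have hab' : (a : Angle n) ≠ (b : Angle n) := fun h0 => lab.ne
    (eq_of_coe_eq_coe (a := a) h0 le_rfl (by linarith) lab.le hab.lt_add_period)
  have hbc' : (b : Angle n) ≠ (c : Angle n) := fun h0 => lbc.ne
    (eq_of_coe_eq_coe (a := b) h0 le_rfl (by linarith) lbc.le hbc.lt_add_period)
  apply hdr
  have : α.path.mult.support.filter (· ∈ disagreement α β) =
      {(a : Angle n), (b : Angle n), (c : Angle n)} := by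
    ext x
    rw [Finset.mem_filter, hD, Finset.mem_insert, Finset.mem_insert, Finset.mem_singleton]
    constructor
    · rintro ⟨hx, s, ⟨h3, h4⟩, rfl⟩
      have hs : α.path.IsEdge s := isEdge_iff_mem_support.mpr hx
      rcases lt_trichotomy s b with h5 | rfl | h5
      · rcases h3.eq_or_lt with rfl | h3
        · exact Or.inl rfl
        · exact absurd hs (hab.consecutive s ⟨h3, h5⟩)
      · exact Or.inr (Or.inl rfl)
      · rcases h4.eq_or_lt with rfl | h4
        · exact Or.inr (Or.inr rfl)
        · exact absurd hs (hbc.consecutive s ⟨h5, h4⟩)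
    · rintro (rfl | rfl | rfl)
      · exact ⟨isEdge_iff_mem_support.mp hab.edge_left, a, ⟨le_rfl, (lab.trans lbc).le⟩, rfl⟩
      · exact ⟨isEdge_iff_mem_support.mp hab.edge_right, b, ⟨lab.le, lbc.le⟩, rfl⟩
      · exact ⟨isEdge_iff_mem_support.mp hbc.edge_right, c, ⟨(lab.trans lbc).le, le_rfl⟩, rfl⟩
  rw [this]
  exact Finset.card_eq_three.mpr ⟨_, _, _, hab', hac, hbc', rfl⟩

/-- The paths differ along exactly one corner of `α`. -/
theorem exists_component (hp : β.path.period = α.path.period) (hn : IsLeftOf β.path α.path)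
    (hl : LabelsMatch α β) (hi : relIndex α β = 1) (hconn : IsPreconnected (disagreement α β))
    (hdr : (α.path.mult.support.filter (· ∈ disagreement α β)).card ≠ 3) :
    ∃ a b, α.path.IsCorner a b ∧ β.path.left a = α.path.left a ∧
      (∀ t, a ≤ t → t < b → β.path.pos t ≠ α.path.pos t) ∧
      ∀ t, b ≤ t → t < a + 2 * π * n → β.path.pos t = α.path.pos t := by
  obtain ⟨θ₀, hθ₀, hθ⟩ := exists_indexTerm_eq_one hp hn hl hi
  obtain ⟨t₀, ht₀⟩ : ∃ t₀, β.path.pos t₀ ≠ α.path.pos t₀ := by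
    by_contra hno
    push Not at hno
    have he : β.path = α.path := ext_pos hp hno
    rw [indexTerm_eq_zero_of_agree hl (by rw [he]) (by rw [he])] at hθ₀
    exact zero_ne_one hθ₀
  -- consecutive edges cannot both have nonzero displacements on both sides
  have hpair : ∀ a b, α.path.IsCorner a b → β.path.left a ≠ α.path.left a →
      β.path.pos a ≠ α.path.pos a → β.path.left b ≠ α.path.left b →
      β.path.pos b = α.path.pos b := fun a b hab h1 h2 h3 => by
    by_contra h4
    have i1 := one_le_indexTerm hn hab.edge_left h1 h2
    have i2 := one_le_indexTerm hn hab.edge_right h3 h4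
    have e1 : (a : Angle n) = (θ₀ : Angle n) := by
      by_contra h5
      rw [hθ a h5] at i1
      exact absurd i1 (by norm_num)
    have e2 : (b : Angle n) = (θ₀ : Angle n) := by
      by_contra h5
      rw [hθ b h5] at i2
      exact absurd i2 (by norm_num)
    exact hab.lt.ne (eq_of_coe_eq_coe (a := a) (e1.trans e2.symm) le_rfl
      (by linarith [(instFactAngle n).out]) hab.lt.le hab.lt_add_period)
  obtain ⟨a, b, ha0, hb0, hab, hne⟩ := exists_corner_of_pos_ne hn ht₀
  have hbl := left_ne_of_pos_ne hab.lt hne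
  have hleft : β.path.left a = α.path.left a := by
    by_contra hal
    have hb := hpair a b hab hal (hne a le_rfl hab.lt) hbl
    obtain ⟨ε, hε, -, e1, e2⟩ := α.path.exists_isolating₂ β.path a one_pos
    have hal' := hal
    rw [α.path.left_eq_of_not_isEdge (s := a - ε) (by linarith)
        fun φ h5 h6 => e1 φ (by linarith) (by linarith) h6.ne,
      β.path.left_eq_of_not_isEdge (s := a - ε) (by linarith)
        fun φ h5 h6 => e2 φ (by linarith) (by linarith) h6.ne] at hal'
    obtain ⟨a', b', h1, h2, hab', hne'⟩ := exists_corner_of_pos_ne hn hal'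
    have hb' : b' = a := by
      rcases lt_trichotomy b' a with h3 | h3 | h3
      · exact absurd hab'.edge_right (e1 b' h2.le (by linarith) h3.ne)
      · exact h3
      · exact absurd hab.edge_left (hab'.consecutive a ⟨by linarith, h3⟩)
    subst hb'
    by_cases hl' : β.path.left a' = α.path.left a'
    · exact not_two_corners hp hconn hdr hab' hab hne' hne hl' hb
    · exact hne b' le_rfl hab.lt (hpair a' b' hab' hl' (hne' a' le_rfl hab'.lt) hal)
  have hright : β.path.pos b = α.path.pos b := by
    by_contra hbr
    obtain ⟨b', c, h1, h2, hbc, hne'⟩ := exists_corner_of_pos_ne hn hbr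
    have hb' : b' = b := by
      rcases h1.eq_or_lt with h3 | h3
      · exact h3
      · exact absurd hab.edge_right (hbc.consecutive b ⟨h3, h2⟩)
    subst hb'
    exact not_two_corners hp hconn hdr hab hbc hne hne' hleft
      (hpair b' c hbc hbl hbr (left_ne_of_pos_ne hbc.lt hne'))
  exact ⟨a, b, hab, hleft, hne, fun t h1 h2 =>
    pos_eq_off_component hp hconn hab.lt hne hleft hright h1 h2⟩

end Components

/-- A lattice triangle of twice the minimal area has a side that is not primitive. -/
theorem cross_ne_two {d u : ℤ × ℤ} (hd : IsCoprime d.1 d.2) (hu : IsCoprime u.1 u.2)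
    (hdu : IsCoprime (u + d).1 (u + d).2) : cross d u ≠ 2 := by
  have hmod : ∀ v : ℤ × ℤ, IsCoprime v.1 v.2 → ¬ ((v.1 : ZMod 2) = 0 ∧ (v.2 : ZMod 2) = 0) := by
    rintro v ⟨a, b, hab⟩ ⟨h1, h2⟩
    have := congrArg (Int.cast : ℤ → ZMod 2) hab
    push_cast at this
    rw [h1, h2] at this
    simp at this
  intro h
  have h0 : (d.1 : ZMod 2) * u.2 - d.2 * u.1 = 0 := by
    have := congrArg (Int.cast : ℤ → ZMod 2) h
    simp only [cross] at this
    push_cast at this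
    rw [this]; decide
  have h1 := hmod _ hd
  have h2 := hmod _ hu
  have h3 := hmod _ hdu
  simp only [Prod.fst_add, Prod.snd_add, Int.cast_add] at h3
  generalize (d.1 : ZMod 2) = a, (d.2 : ZMod 2) = b, (u.1 : ZMod 2) = c,
    (u.2 : ZMod 2) = e at h0 h1 h2 h3
  revert a b c e
  decide

theorem dvd_of_zsmul_eq_zsmul {v w : ℤ × ℤ} (hv : IsCoprime v.1 v.2) {k l : ℤ}
    (h : k • v = l • w) : l ∣ k := by
  obtain ⟨x, hx⟩ := exists_cross_eq_one hv
  refine ⟨cross w x, ?_⟩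
  have := congrArg (fun y => cross y x) h
  rw [cross_swap (k • v), cross_swap (l • w), cross_zsmul, cross_zsmul, cross_swap x v,
    cross_swap x w, hx] at this
  linarith

theorem perm_append_of_mem_iff {S : Set (Angle n)} {L r l : List (Angle n)} (hL : L.Nodup)
    (hr : r.Nodup) (hl : l.Nodup) (h1 : ∀ x, x ∈ r ↔ x ∈ L ∧ x ∉ S)
    (h2 : ∀ x ∈ S, x ∈ L ↔ x ∈ l) (h3 : ∀ x ∈ l, x ∈ S) : L.Perm (r ++ l) := by
  have hdis : r.Disjoint l := fun x hx hx' => ((h1 x).mp hx).2 (h3 x hx')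
  rw [List.perm_ext_iff_of_nodup hL (hr.append hl hdis)]
  intro x
  rw [List.mem_append, h1]
  by_cases hx : x ∈ S
  · simp [hx, h2 x hx]
  · simp only [hx, not_false_eq_true, and_true]
    exact ⟨Or.inl, fun h => h.resolve_right fun h' => hx (h3 x h')⟩

section Classification

variable {α β : Generator n}

/-- A pair that satisfies the index, nesting, label matching and connectedness conditions and is
not a double rounding is a term of the combinatorial differential. -/
theorem exists_isDeltaTerm (hp : β.path.period = α.path.period) (hn : IsLeftOf β.path α.path)
    (hl : LabelsMatch α β) (hi : relIndex α β = 1) (hconn : IsPreconnected (disagreement α β))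
    (hdr : (α.path.mult.support.filter (· ∈ disagreement α β)).card ≠ 3) :
    ∃ a b s, IsDeltaTerm α β a b s := by
  obtain ⟨a, b, hab, hal, hne, heq⟩ := exists_component hp hn hl hi hconn hdr
  obtain ⟨θ', hθ₀', hθ'⟩ := exists_indexTerm_eq_one hp hn hl hi
  have hlt := hab.lt
  have hT := hab.lt_add_period
  have hra := hab.edge_left.isRationalAngle
  have hrb := hab.edge_right.isRationalAngle
  -- normalize the angle with nonzero contribution
  obtain ⟨θ₀, hθ₀, hθ, h0a, h0b⟩ : ∃ θ₀, indexTerm α β θ₀ = 1 ∧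
      (∀ θ : ℝ, (θ : Angle n) ≠ (θ₀ : Angle n) → indexTerm α β θ = 0) ∧ a ≤ θ₀ ∧
        θ₀ < a + 2 * π * n := by
    obtain ⟨k, h1, h2⟩ := exists_int_add_mem_Ico n a θ'
    exact ⟨θ' + k * (2 * π * n), by rw [indexTerm_add_int_mul hp, hθ₀'],
      fun θ h => hθ' θ (by rwa [coe_add_int_mul] at h), h1, h2⟩
  have huniq : ∀ θ, a ≤ θ → θ < a + 2 * π * n → 1 ≤ indexTerm α β θ → θ = θ₀ :=
    fun θ h1 h2 h3 => by
      by_contra h4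
      rw [hθ θ fun h5 => h4 (eq_of_coe_eq_coe (a := a) h5 h1 h2 h0a h0b)] at h3
      exact absurd h3 (by norm_num)
  have hbr : β.path.pos b = α.path.pos b := heq b le_rfl hT
  set c := α.path.pos a with hc
  have hbl : α.path.left b = c := hab.left_eq
  -- the displacements at the ends of the corner
  have ha0 : height α.path β.path a = 0 := by
    rw [← cross_left_sub_left, hal, sub_self, cross_zero]
  have hb0 : height α.path β.path b = 0 := by rw [height, hbr, sub_self, cross_zero]
  obtain ⟨A, hA, hA1, hA2⟩ : ∃ A : ℤ, 1 ≤ A ∧ β.path.pos a - c = -(A • dirVec a) ∧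
      (α.path.mult (a : Angle n) : ℤ) - β.path.mult (a : Angle n) = A := by
    obtain ⟨k, l, -, hl, ek, el, e⟩ := exists_displacements hn hra ha0
    rw [hal, sub_self, eq_comm, smul_eq_zero, or_iff_left (dirVec_ne_zero hra)] at ek
    have hl0 : l ≠ 0 := fun h0 => hne a le_rfl hlt (by rwa [h0, zero_smul, sub_eq_zero] at el)
    exact ⟨-l, by omega, by rw [el, neg_smul, neg_neg], by omega⟩
  obtain ⟨B, hB, hB1, hB2⟩ : ∃ B : ℤ, 1 ≤ B ∧ β.path.left b - c = B • dirVec b ∧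
      (α.path.mult (b : Angle n) : ℤ) - β.path.mult (b : Angle n) = B := by
    obtain ⟨k, l, hk, -, ek, el, e⟩ := exists_displacements hn hrb hb0
    rw [hbr, sub_self, eq_comm, smul_eq_zero, or_iff_left (dirVec_ne_zero hrb)] at el
    have hk0 : k ≠ 0 := fun h0 =>
      left_ne_of_pos_ne hlt hne (by rwa [h0, zero_smul, sub_eq_zero] at ek)
    exact ⟨k, by omega, by rw [← ek, hbl], by omega⟩
  have hia : indexTerm α β a = A - (if (a : Angle n) ∈ α.order then 1 else 0)
      + (if (a : Angle n) ∈ β.order then 1 else 0) := by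
    rw [indexTerm_of_height_eq_zero ha0, hA2]
  have hib : indexTerm α β b = B - (if (b : Angle n) ∈ α.order then 1 else 0)
      + (if (b : Angle n) ∈ β.order then 1 else 0) := by
    rw [indexTerm_of_height_eq_zero hb0, hB2]
  have hite : ∀ (p : Prop) [Decidable p],
      (0 : ℤ) ≤ (if p then 1 else 0) ∧ (if p then (1 : ℤ) else 0) ≤ 1 := fun p _ => by split_ifs <;> norm_num
  have hbig_a : 2 ≤ A → a = θ₀ := fun h => huniq a le_rfl (by linarith) (by
    have := hite ((a : Angle n) ∈ α.order)
    have := hite ((a : Angle n) ∈ β.order)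
    omega)
  have hbig_b : 2 ≤ B → b = θ₀ := fun h => huniq b hlt.le hT (by
    have := hite ((b : Angle n) ∈ α.order)
    have := hite ((b : Angle n) ∈ β.order)
    omega)
  -- the edges of `β` inside the corner
  have hin : ∀ θ, a < θ → θ < b → ¬ α.path.IsEdge θ := fun θ h1 h2 => hab.consecutive θ ⟨h1, h2⟩
  have hpos : ∀ θ, a < θ → θ < b → α.path.pos θ = c := fun θ h1 h2 => hab.pos_eq h1.le h2
  have hh : ∀ θ, a < θ → θ < b →
      height α.path β.path θ = cross (dirVec θ) (β.path.pos θ - c) := fun θ h1 h2 => by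
    rw [height, hpos θ h1 h2]
  have hh' : ∀ θ, a < θ → θ < b →
      height α.path β.path θ = cross (dirVec θ) (β.path.left θ - c) := fun θ h1 h2 => by
    rw [← cross_left_sub_left, left_eq_pos (hin θ h1 h2), hpos θ h1 h2]
  have hm0 : ∀ θ, a < θ → θ < b → α.path.mult (θ : Angle n) = 0 := fun θ h1 h2 => by
    have := hin θ h1 h2
    rwa [IsEdge, not_not] at this
  have hge : ∀ θ, a < θ → θ < b → β.path.IsEdge θ → 1 ≤ height α.path β.path θ :=
    fun θ h1 h2 h3 => by
      rcases (height_nonneg hn h3.isRationalAngle).eq_or_lt with h4 | h4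
      · obtain ⟨k, l, hk, hl, -, -, e⟩ := exists_displacements hn h3.isRationalAngle h4.symm
        rw [hm0 θ h1 h2] at e
        rw [IsEdge] at h3
        omega
      · omega
  have hint : ∀ θ, a < θ → θ < b → indexTerm α β θ =
      β.path.mult (θ : Angle n) * (height α.path β.path θ - 1)
        + (if (θ : Angle n) ∈ β.order then 1 else 0) := fun θ h1 h2 => by
    have h3 : (θ : Angle n) ∉ α.order := fun h => hin θ h1 h2 (isEdge_of_mem_order h)
    rw [indexTerm, hm0 θ h1 h2, if_neg h3]
    push_cast; ring
  have hbig : ∀ θ, a < θ → θ < b → β.path.IsEdge θ → 2 ≤ height α.path β.path θ → θ = θ₀ :=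
    fun θ h1 h2 h3 h4 => huniq θ h1.le (by linarith) (by
      rw [hint θ h1 h2]
      have h5 : (1 : ℤ) ≤ β.path.mult (θ : Angle n) := by rw [IsEdge] at h3; omega
      have h6 := mul_le_mul h5 (show 1 ≤ height α.path β.path θ - 1 by omega) zero_le_one
        (by omega)
      linarith [(hite ((θ : Angle n) ∈ β.order)).1])
  have hdvd : ∀ {k x : ℤ}, 1 ≤ k * x → 2 ≤ k → 2 ≤ k * x := fun {k x} h1 h2 => by
    have : 0 < x := pos_of_mul_pos_right (by omega : 0 < k * x) (by omega)
    nlinarith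
  -- both edges of the corner are shortened by one unit
  have hA1' : A = 1 := by
    by_contra hA'
    have h1 := hbig_a (by omega)
    by_cases he : ∃ θ, a < θ ∧ θ < b ∧ β.path.IsEdge θ
    · obtain ⟨θ, h2, h3, h4⟩ := he
      obtain ⟨φ, h5, h6, h7, h8⟩ := β.path.exists_first_edge h2 h4
      have h9 := hge φ h5 (by linarith) h7
      rw [hh' φ h5 (by linarith), β.path.left_eq_of_not_isEdge h5 h8, hA1, cross_neg, cross_zsmul,
        ← mul_neg] at h9
      have h10 := hdvd h9 (by omega)
      rw [mul_neg, ← cross_zsmul, ← cross_neg, ← hA1, ← β.path.left_eq_of_not_isEdge h5 h8,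
        ← hh' φ h5 (by linarith)] at h10
      have := hbig φ h5 (by linarith) h7 h10
      linarith
    · push Not at he
      have h2 : B • dirVec b = (-A) • dirVec a := by
        rw [← hB1, neg_smul, ← hA1, β.path.left_eq_of_not_isEdge hlt he]
      have h3 := Int.le_of_dvd (by omega) (neg_dvd.mp (dvd_of_zsmul_eq_zsmul
        (dirVec_isCoprime hrb) h2))
      have := hbig_b (by omega)
      linarith
  have hB1' : B = 1 := by
    by_contra hB'
    have h1 := hbig_b (by omega)
    by_cases he : ∃ θ, a < θ ∧ θ < b ∧ β.path.IsEdge θ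
    · obtain ⟨θ, h2, h3, h4⟩ := he
      obtain ⟨φ, h5, h6, h7, h8⟩ := β.path.exists_last_edge_lt h3 h4
      have h9 := hge φ (by linarith) h6 h7
      rw [hh φ (by linarith) h6, ← β.path.left_eq_of_not_isEdge h6 h8, hB1, cross_zsmul] at h9
      have h10 := hdvd h9 (by omega)
      rw [← cross_zsmul, ← hB1, β.path.left_eq_of_not_isEdge h6 h8,
        ← hh φ (by linarith) h6] at h10
      have := hbig φ (by linarith) h6 h7 h10
      linarith
    · push Not at he
      have h2 : (-A) • dirVec a = B • dirVec b := by
        rw [← hB1, neg_smul, ← hA1, β.path.left_eq_of_not_isEdge hlt he]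
      have h3 := dvd_neg.mp (dvd_of_zsmul_eq_zsmul (dirVec_isCoprime hra) h2)
      have := Int.le_of_dvd (by omega) h3
      omega
  subst hA1' hB1'
  rw [one_smul] at hA1 hB1
  -- the edges of `β` in the corner are at lattice distance one from it
  have huni : ∀ θ, a < θ → θ < b → β.path.IsEdge θ → height α.path β.path θ = 1 := by
    intro θ h1 h2 h3
    by_contra h4
    have h5 := hge θ h1 h2 h3
    have h6 := hbig θ h1 h2 h3 (by omega)
    have hother : ∀ φ, a < φ → φ < b → β.path.IsEdge φ → φ ≠ θ →
        height α.path β.path φ = 1 := fun φ h7 h8 h9 h10 => by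
      by_contra h11
      have h12 := hge φ h7 h8 h9
      exact h10 ((hbig φ h7 h8 h9 (by omega)).trans h6.symm)
    have h7 := hint θ h1 h2
    rw [h6, hθ₀, ← h6] at h7
    have h8 : (1 : ℤ) ≤ β.path.mult (θ : Angle n) := by rw [IsEdge] at h3; omega
    have h9 := (hite ((θ : Angle n) ∈ β.order)).1
    have hm : (β.path.mult (θ : Angle n) : ℤ) = 1 := by
      have h10 := mul_le_mul_of_nonneg_left (show 1 ≤ height α.path β.path θ - 1 by omega)
        (show (0 : ℤ) ≤ β.path.mult (θ : Angle n) by omega)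
      linarith
    have hht : height α.path β.path θ = 2 := by rw [hm, one_mul] at h7; omega
    have hcop : IsCoprime (β.path.left θ - c).1 (β.path.left θ - c).2 := by
      by_cases he : ∃ φ, a < φ ∧ φ < θ ∧ β.path.IsEdge φ
      · obtain ⟨φ, g1, g2, g3⟩ := he
        obtain ⟨ψ, g4, g5, g6, g7⟩ := β.path.exists_last_edge_lt g2 g3
        have g8 := hother ψ (by linarith) (by linarith) g6 g5.ne
        rw [hh ψ (by linarith) (by linarith), ← β.path.left_eq_of_not_isEdge g5 g7] at g8
        exact isCoprime_of_cross_eq_one_right g8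
      · push Not at he
        rw [β.path.left_eq_of_not_isEdge h1 he, hA1]
        exact (dirVec_isCoprime hra).neg_neg
    have hcop' : IsCoprime (β.path.pos θ - c).1 (β.path.pos θ - c).2 := by
      by_cases he : ∃ φ, θ < φ ∧ φ < b ∧ β.path.IsEdge φ
      · obtain ⟨φ, g1, g2, g3⟩ := he
        obtain ⟨ψ, g4, g5, g6, g7⟩ := β.path.exists_first_edge g1 g3
        have g8 := hother ψ (by linarith) (by linarith) g6 g4.ne'
        rw [hh' ψ (by linarith) (by linarith), β.path.left_eq_of_not_isEdge g4 g7] at g8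
        exact isCoprime_of_cross_eq_one_right g8
      · push Not at he
        rw [← β.path.left_eq_of_not_isEdge h2 he, hB1]
        exact dirVec_isCoprime hrb
    have hsum : β.path.pos θ - c = (β.path.left θ - c) + dirVec θ := by
      rw [← left_add_dirVec, ← natCast_zsmul, hm, one_smul]; abel
    rw [hsum] at hcop'
    rw [hh' θ h1 h2] at hht
    exact cross_ne_two (dirVec_isCoprime h3.isRationalAngle) hcop hcop' hht
  have hcut : IsUnimodularCut α.path a b β.path := by
    refine ⟨⟨hab, hp, fun t ht => ?_, by omega, by omega⟩, fun θ h1 h2 h3 => ?_⟩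
    · obtain ⟨k, h1, h2⟩ := exists_int_add_mem_Ico n a t
      rw [← coe_add_int_mul t k, mem_arc_iff_of_mem_Ico hT h1 h2, not_le] at ht
      rw [← sub_eq_zero, ← pos_sub_pos_add_int_mul hp t k, sub_eq_zero]
      exact heq _ ht.le h2
    · rw [← hc, ← hh θ h1 h2]
      exact huni θ h1 h2 h3
  refine ⟨a, b, ?_⟩
  -- the labels
  have hAarc : ∀ x ∈ arc n a b, x ∈ α.order → x = (a : Angle n) ∨ x = (b : Angle n) := by
    rintro _ ⟨t, ⟨h1, h2⟩, rfl⟩ hx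
    have ht := isEdge_of_mem_order hx
    rcases h1.eq_or_lt with rfl | h1
    · exact Or.inl rfl
    rcases h2.eq_or_lt with rfl | h2
    · exact Or.inr rfl
    exact absurd ht (hin t h1 h2)
  have hout : ∀ x ∉ arc n a b, x ∈ α.order ↔ x ∈ β.order := by
    intro x hx
    obtain ⟨t, rfl, h1, h2⟩ := exists_coe_eq_mem_Ico a x
    rw [mem_arc_iff_of_mem_Ico hT h1 h2, not_le] at hx
    have e1 := heq t hx.le h2
    have e2 : β.path.left t = α.path.left t := by
      obtain ⟨ε, hε, hB, i1, i2⟩ := α.path.exists_isolating₂ β.path t (sub_pos.mpr hx)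
      rw [α.path.left_eq_of_not_isEdge (s := t - ε) (by linarith)
          fun φ h5 h6 => i1 φ (by linarith) (by linarith) h6.ne,
        β.path.left_eq_of_not_isEdge (s := t - ε) (by linarith)
          fun φ h5 h6 => i2 φ (by linarith) (by linarith) h6.ne]
      exact heq _ (by linarith) (by linarith)
    have hm := pos_sub_pos_eq_left_sub_left_add α.path β.path t
    rw [e1, e2, sub_self, sub_self, zero_add, eq_comm, smul_eq_zero] at hm
    constructor
    · intro h
      have he := isEdge_of_mem_order h
      have hm' := hm.resolve_right (dirVec_ne_zero he.isRationalAngle)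
      exact ((hl t).1 ⟨he, by rw [IsEdge] at he ⊢; omega, e2.symm, e1.symm⟩).mp h
    · intro h
      have he := isEdge_of_mem_order h
      have hm' := hm.resolve_right (dirVec_ne_zero he.isRationalAngle)
      exact ((hl t).1 ⟨by rw [IsEdge] at he ⊢; omega, he, e2.symm, e1.symm⟩).mpr h
  have hBarc : ∀ t, a < t → t < b → ((t : Angle n) ∈ β.order ↔ t = θ₀) := by
    intro t h1 h2
    have h3 := hint t h1 h2
    have h4 : (β.path.mult (t : Angle n) : ℤ) * (height α.path β.path t - 1) = 0 := by
      by_cases h5 : β.path.IsEdge t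
      · rw [huni t h1 h2 h5, sub_self, mul_zero]
      · rw [IsEdge, not_not] at h5
        rw [h5, Nat.cast_zero, zero_mul]
    rw [h4, zero_add] at h3
    constructor
    · intro h
      rw [if_pos h] at h3
      exact huniq t h1.le (by linarith) h3.ge
    · intro h
      rw [h, hθ₀, ← h] at h3
      by_contra h5
      rw [if_neg h5] at h3
      exact one_ne_zero h3
  have hBarc' : ∀ x ∈ arc n a b, x ∈ β.order →
      x = (a : Angle n) ∨ x = (b : Angle n) ∨ (x = (θ₀ : Angle n) ∧ a < θ₀ ∧ θ₀ < b) := by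
    rintro _ ⟨t, ⟨h1, h2⟩, rfl⟩ hx
    rcases h1.eq_or_lt with rfl | h1
    · exact Or.inl rfl
    rcases h2.eq_or_lt with rfl | h2
    · exact Or.inr (Or.inl rfl)
    obtain rfl := (hBarc t h1 h2).mp hx
    exact Or.inr (Or.inr ⟨rfl, h1, h2⟩)
  have habne : (a : Angle n) ≠ (b : Angle n) := fun h0 => hlt.ne
    (eq_of_coe_eq_coe (a := a) h0 le_rfl (by linarith) hlt.le hT)
  have hamem : (a : Angle n) ∈ arc n a b := ⟨a, ⟨le_rfl, hlt.le⟩, rfl⟩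
  have hbmem : (b : Angle n) ∈ arc n a b := ⟨b, ⟨hlt.le, le_rfl⟩, rfl⟩
  set r := α.order.filter (· ∉ arc n a b) with hr
  have hrn : r.Nodup := α.nodup.filter _
  have hrA : ∀ x, x ∈ r ↔ x ∈ α.order ∧ x ∉ arc n a b := fun x => by simp [hr]
  have hrB : ∀ x, x ∈ r ↔ x ∈ β.order ∧ x ∉ arc n a b := fun x => by
    rw [hrA]; exact and_congr_left fun h => hout x h
  have hrarc : ∀ x ∈ r, x ∉ arc n a b := fun x hx => ((hrA x).mp hx).2
  have hlost : ∀ t, indexTerm α β t = 1 - (if (t : Angle n) ∈ α.order then 1 else 0)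
      + (if (t : Angle n) ∈ β.order then 1 else 0) → t ≠ θ₀ → a ≤ t → t < a + 2 * π * n →
      (t : Angle n) ∈ α.order ∧ (t : Angle n) ∉ β.order := fun t h1 h2 h3 h4 => by
    rw [hθ t fun h => h2 (eq_of_coe_eq_coe (a := a) h h3 h4 h0a h0b)] at h1
    split_ifs at h1 with h5 h6 <;> first | exact ⟨h5, h6⟩ | (norm_num at h1)
  have hkept : ∀ t, indexTerm α β t = 1 - (if (t : Angle n) ∈ α.order then 1 else 0)
      + (if (t : Angle n) ∈ β.order then 1 else 0) → t = θ₀ →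
      ((t : Angle n) ∈ α.order ↔ (t : Angle n) ∈ β.order) := fun t h1 h2 => by
    rw [h2, hθ₀, ← h2] at h1
    split_ifs at h1 with h5 h6 h6 <;> first | (norm_num at h1; done) | simp [h5, h6]
  rcases lt_trichotomy θ₀ b with h0 | h0 | h0
  · rcases h0a.eq_or_lt with h0a | h0a
    · -- the edge at `a` keeps its label
      have hb := hlost b hib (by rw [← h0a]; exact hlt.ne') hlt.le hT
      have hak := hkept a hia h0a
      by_cases haA : (a : Angle n) ∈ α.order
      · refine ⟨_, hcut.isRounding, r, hrarc, Or.inr (Or.inr ⟨(a : Angle n), hamem,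
          perm_append_of_mem_iff (S := arc n a b) α.nodup hrn (by simp [habne]) hrA ?_ ?_,
          perm_append_of_mem_iff (S := arc n a b) β.nodup hrn (by simp) hrB ?_ ?_, rfl⟩)⟩
        · intro x hx
          simp only [List.mem_cons, List.not_mem_nil, or_false]
          exact ⟨hAarc x hx, by rintro (rfl | rfl); exacts [haA, hb.1]⟩
        · simp only [List.mem_cons, List.not_mem_nil, or_false]
          rintro x (rfl | rfl); exacts [hamem, hbmem]
        · intro x hx
          rw [List.mem_singleton]
          refine ⟨fun h => ?_, fun h => h ▸ hak.mp haA⟩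
          rcases hBarc' x hx h with h | h | h
          · exact h
          · exact absurd (h ▸ ‹x ∈ β.order›) hb.2
          · exact absurd h.2.1 h0a.ge.not_gt
        · simpa using hamem
      · refine ⟨_, hcut.isRounding, r, hrarc, Or.inr (Or.inl ⟨
          perm_append_of_mem_iff (S := arc n a b) α.nodup hrn (by simp) hrA ?_ ?_, ?_, rfl⟩)⟩
        · intro x hx
          rw [List.mem_singleton]
          refine ⟨fun h => (hAarc x hx h).resolve_left fun h' => haA (h' ▸ h), fun h => h ▸ hb.1⟩
        · simpa using hbmem
        · rw [← List.append_nil r]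
          refine perm_append_of_mem_iff (S := arc n a b) β.nodup hrn (by simp) hrB
            (fun x hx => ?_) (by simp)
          refine ⟨fun h => ?_, fun h => absurd h (by simp)⟩
          rcases hBarc' x hx h with h' | h' | h'
          · exact absurd (hak.mpr (h' ▸ h)) haA
          · exact absurd (h' ▸ h) hb.2
          · exact absurd h'.2.1 h0a.ge.not_gt
    · -- an edge inside the corner is labeled `h`
      have ha := hlost a hia h0a.ne le_rfl (by linarith)
      have hb := hlost b hib h0.ne' hlt.le hT
      have h0B := (hBarc θ₀ h0a h0).mpr rfl
      have h0mem : (θ₀ : Angle n) ∈ arc n a b := ⟨θ₀, ⟨h0a.le, h0.le⟩, rfl⟩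
      refine ⟨_, hcut.isRounding, r, hrarc, Or.inr (Or.inr ⟨(θ₀ : Angle n), h0mem,
        perm_append_of_mem_iff (S := arc n a b) α.nodup hrn (by simp [habne]) hrA ?_ ?_,
        perm_append_of_mem_iff (S := arc n a b) β.nodup hrn (by simp) hrB ?_ ?_, rfl⟩)⟩
      · intro x hx
        simp only [List.mem_cons, List.not_mem_nil, or_false]
        exact ⟨hAarc x hx, by rintro (rfl | rfl); exacts [ha.1, hb.1]⟩
      · simp only [List.mem_cons, List.not_mem_nil, or_false]
        rintro x (rfl | rfl); exacts [hamem, hbmem]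
      · intro x hx
        rw [List.mem_singleton]
        refine ⟨fun h => ?_, fun h => h ▸ h0B⟩
        rcases hBarc' x hx h with h' | h' | h'
        · exact absurd (h' ▸ h) ha.2
        · exact absurd (h' ▸ h) hb.2
        · exact h'.1
      · simpa using h0mem
  · -- the edge at `b` keeps its label
    have ha := hlost a hia (by rw [h0]; exact hlt.ne) le_rfl (by linarith)
    have hbk := hkept b hib h0.symm
    by_cases hbA : (b : Angle n) ∈ α.order
    · refine ⟨_, hcut.isRounding, r, hrarc, Or.inr (Or.inr ⟨(b : Angle n), hbmem,
        perm_append_of_mem_iff (S := arc n a b) α.nodup hrn (by simp [habne]) hrA ?_ ?_,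
        perm_append_of_mem_iff (S := arc n a b) β.nodup hrn (by simp) hrB ?_ ?_, rfl⟩)⟩
      · intro x hx
        simp only [List.mem_cons, List.not_mem_nil, or_false]
        exact ⟨hAarc x hx, by rintro (rfl | rfl); exacts [ha.1, hbA]⟩
      · simp only [List.mem_cons, List.not_mem_nil, or_false]
        rintro x (rfl | rfl); exacts [hamem, hbmem]
      · intro x hx
        rw [List.mem_singleton]
        refine ⟨fun h => ?_, fun h => h ▸ hbk.mp hbA⟩
        rcases hBarc' x hx h with h' | h' | h'
        · exact absurd (h' ▸ h) ha.2
        · exact h'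
        · exact absurd h'.2.2 h0.ge.not_gt
      · simpa using hbmem
    · refine ⟨_, hcut.isRounding, r, hrarc, Or.inl ⟨
        perm_append_of_mem_iff (S := arc n a b) α.nodup hrn (by simp) hrA ?_ ?_, ?_, rfl⟩⟩
      · intro x hx
        rw [List.mem_singleton]
        refine ⟨fun h => (hAarc x hx h).resolve_right fun h' => hbA (h' ▸ h), fun h => h ▸ ha.1⟩
      · simpa using hamem
      · rw [← List.append_nil r]
        refine perm_append_of_mem_iff (S := arc n a b) β.nodup hrn (by simp) hrB
          (fun x hx => ?_) (by simp)
        refine ⟨fun h => ?_, fun h => absurd h (by simp)⟩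
        rcases hBarc' x hx h with h' | h' | h'
        · exact absurd (h' ▸ h) ha.2
        · exact absurd (hbk.mpr (h' ▸ h)) hbA
        · exact absurd h'.2.2 h0.ge.not_gt
  · -- off the corner the edges agree
    exfalso
    have e2 : β.path.left θ₀ = α.path.left θ₀ := by
      obtain ⟨ε, hε, hB, i1, i2⟩ := α.path.exists_isolating₂ β.path θ₀ (sub_pos.mpr h0)
      rw [α.path.left_eq_of_not_isEdge (s := θ₀ - ε) (by linarith)
          fun φ h5 h6 => i1 φ (by linarith) (by linarith) h6.ne,
        β.path.left_eq_of_not_isEdge (s := θ₀ - ε) (by linarith)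
          fun φ h5 h6 => i2 φ (by linarith) (by linarith) h6.ne]
      exact heq _ (by linarith) (by linarith)
    rw [indexTerm_eq_zero_of_agree hl e2 (heq θ₀ h0.le h0b)] at hθ₀
    exact zero_ne_one hθ₀

end Classification

/-! ### Signs of orderings -/

theorem orderSign_mul_self (l : List (Angle n)) : orderSign l * orderSign l = 1 := by
  induction l with
  | nil => simp [orderSign]
  | cons a l ih =>
    rw [orderSign, mul_mul_mul_comm, ih, mul_one, ← pow_add, ← two_mul, pow_mul]
    norm_num

theorem orderSign_eq (l : List (Angle n)) : orderSign l = 1 ∨ orderSign l = -1 :=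
  mul_self_eq_one_iff.mp (orderSign_mul_self l)

theorem orderSign_ne_zero (l : List (Angle n)) : orderSign l ≠ 0 := by
  rcases orderSign_eq l with h | h <;> rw [h] <;> norm_num

theorem reorderSign_self (l : List (Angle n)) : reorderSign l l = 1 := orderSign_mul_self l

theorem reorderSign_swap (l r : List (Angle n)) {a b : Angle n} (hab : a ≠ b) :
    reorderSign (l ++ a :: b :: r) (l ++ b :: a :: r) = -1 := by
  rw [reorderSign, orderSign_swap l r hab, neg_mul, orderSign_mul_self]

/-- The relative sign of two orderings with a common first part does not depend on the order of
this part. -/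
theorem orderSign_append_mul {r r' : List (Angle n)} (h : r.Perm r') {l l' : List (Angle n)}
    (h1 : (r ++ l).Nodup) (h2 : (r ++ l').Nodup) :
    orderSign (r ++ l) * orderSign (r ++ l') = orderSign (r' ++ l) * orderSign (r' ++ l') := by
  induction h with
  | nil => rfl
  | @cons a s s' hs ih =>
    have ih := ih (List.nodup_cons.mp h1).2 (List.nodup_cons.mp h2).2
    simp only [List.cons_append, orderSign]
    rw [(hs.append_right l).countP_eq, (hs.append_right l').countP_eq]
    linear_combination (-1) ^ ((s' ++ l).countP fun b => decide (rep b < rep a)) *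
      (-1) ^ ((s' ++ l').countP fun b => decide (rep b < rep a)) * ih
  | swap a b s =>
    have hab : b ≠ a := fun h => by simp [h] at h1
    have e : ∀ m : List (Angle n), orderSign (b :: a :: s ++ m) = -orderSign (a :: b :: s ++ m) :=
      fun m => orderSign_swap [] (s ++ m) hab
    rw [e, e, neg_mul_neg]
  | trans p q ih₁ ih₂ =>
    rw [ih₁ h1 h2, ih₂ ((p.append_right l).nodup_iff.mp h1) ((p.append_right l').nodup_iff.mp h2)]

/-- The change of labels in the rounding of the corner between `θ₁` and `θ₂`: the `h` edges `l` in
the corner are replaced by `l'`, with sign `c` if they are ordered in this way. -/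
def LabelChange (n : ℕ) (θ₁ θ₂ : ℝ) (l l' : List (Angle n)) (c : ℤ) : Prop :=
  (l = [(θ₁ : Angle n)] ∧ l' = [] ∧ c = -1) ∨ (l = [(θ₂ : Angle n)] ∧ l' = [] ∧ c = 1) ∨
    ∃ η ∈ arc n θ₁ θ₂, l = [(θ₁ : Angle n), (θ₂ : Angle n)] ∧ l' = [η] ∧ c = 1

theorem isDeltaTerm_iff {α β : Generator n} {θ₁ θ₂ : ℝ} {s : ℤ} :
    IsDeltaTerm α β θ₁ θ₂ s ↔ IsRounding α.path θ₁ θ₂ β.path ∧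
      ∃ (r l l' : List (Angle n)) (c : ℤ), (∀ η ∈ r, η ∉ arc n θ₁ θ₂) ∧
        LabelChange n θ₁ θ₂ l l' c ∧ α.order.Perm (r ++ l) ∧ β.order.Perm (r ++ l') ∧
        s = c * (reorderSign α.order (r ++ l) * reorderSign β.order (r ++ l')) := by
  refine and_congr_right fun _ => ⟨?_, ?_⟩
  · rintro ⟨r, hr, ⟨h1, h2, rfl⟩ | ⟨h1, h2, rfl⟩ | ⟨η, hη, h1, h2, rfl⟩⟩
    · exact ⟨r, _, [], -1, hr, Or.inl ⟨rfl, rfl, rfl⟩, h1, by simpa using h2, by simp⟩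
    · exact ⟨r, _, [], 1, hr, Or.inr (Or.inl ⟨rfl, rfl, rfl⟩), h1, by simpa using h2, by simp⟩
    · exact ⟨r, _, _, 1, hr, Or.inr (Or.inr ⟨η, hη, rfl, rfl, rfl⟩), h1, h2, by simp⟩
  · rintro ⟨r, l, l', c, hr, ⟨rfl, rfl, rfl⟩ | ⟨rfl, rfl, rfl⟩ | ⟨η, hη, rfl, rfl, rfl⟩, h1, h2, rfl⟩
    · exact ⟨r, hr, Or.inl ⟨h1, by simpa using h2, by simp⟩⟩
    · exact ⟨r, hr, Or.inr (Or.inl ⟨h1, by simpa using h2, by simp⟩)⟩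
    · exact ⟨r, hr, Or.inr (Or.inr ⟨η, hη, h1, h2, by simp⟩)⟩

theorem AdmissiblePath.IsCorner.coe_ne {Λ : AdmissiblePath n} {θ₁ θ₂ : ℝ} (h : Λ.IsCorner θ₁ θ₂) :
    (θ₁ : Angle n) ≠ (θ₂ : Angle n) := fun h0 =>
  h.lt.ne (eq_of_coe_eq_coe (a := θ₁) h0 le_rfl (by linarith [h.lt, h.lt_add_period]) h.lt.le
    h.lt_add_period)

theorem LabelChange.mem_arc {θ₁ θ₂ : ℝ} {l l' : List (Angle n)} {c : ℤ}
    (h : LabelChange n θ₁ θ₂ l l' c) (hlt : θ₁ ≤ θ₂) :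
    (∀ x ∈ l, x ∈ arc n θ₁ θ₂) ∧ ∀ x ∈ l', x ∈ arc n θ₁ θ₂ := by
  have h1 : (θ₁ : Angle n) ∈ arc n θ₁ θ₂ := ⟨θ₁, ⟨le_rfl, hlt⟩, rfl⟩
  have h2 : (θ₂ : Angle n) ∈ arc n θ₁ θ₂ := ⟨θ₂, ⟨hlt, le_rfl⟩, rfl⟩
  rcases h with ⟨rfl, rfl, -⟩ | ⟨rfl, rfl, -⟩ | ⟨η, hη, rfl, rfl, -⟩
  · simpa using h1
  · simpa using h2
  · simp [h1, h2, hη]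

theorem LabelChange.sign_eq {θ₁ θ₂ : ℝ} {l l' : List (Angle n)} {c : ℤ}
    (h : LabelChange n θ₁ θ₂ l l' c) : c = 1 ∨ c = -1 := by
  rcases h with ⟨-, -, h⟩ | ⟨-, -, h⟩ | ⟨-, -, -, -, h⟩ <;> simp [h]

/-- The change of labels is determined up to the order of the lists. -/
theorem LabelChange.unique {θ₁ θ₂ : ℝ} {l l' m m' : List (Angle n)} {c e : ℤ}
    (h : LabelChange n θ₁ θ₂ l l' c) (h' : LabelChange n θ₁ θ₂ m m' e)
    (hne : (θ₁ : Angle n) ≠ (θ₂ : Angle n)) (hl : l.Perm m) (hl' : l'.Perm m') :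
    l = m ∧ l' = m' ∧ c = e := by
  rcases h with ⟨rfl, rfl, rfl⟩ | ⟨rfl, rfl, rfl⟩ | ⟨η, hη, rfl, rfl, rfl⟩ <;>
    rcases h' with ⟨rfl, rfl, rfl⟩ | ⟨rfl, rfl, rfl⟩ | ⟨ζ, hζ, rfl, rfl, rfl⟩
  · simp
  · exact absurd (by simpa using hl) hne
  · exact absurd hl.length_eq (by simp)
  · exact absurd (by simpa using hl) hne.symm
  · simp
  · exact absurd hl.length_eq (by simp)
  · exact absurd hl.length_eq (by simp)
  · exact absurd hl.length_eq (by simp)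
  · have : η = ζ := by simpa using hl'
    simp [this]

theorem perm_of_append_perm_append {S : Set (Angle n)} {r l r' l' : List (Angle n)}
    (h : (r ++ l).Perm (r' ++ l')) (hr : ∀ x ∈ r, x ∉ S) (hr' : ∀ x ∈ r', x ∉ S)
    (hl : ∀ x ∈ l, x ∈ S) (hl' : ∀ x ∈ l', x ∈ S) : r.Perm r' ∧ l.Perm l' := by
  have h1 := h.filter (fun x => decide (x ∉ S))
  have h2 := h.filter (fun x => decide (x ∈ S))
  have out : ∀ m : List (Angle n), (∀ x ∈ m, x ∉ S) →
      m.filter (fun x => decide (x ∉ S)) = m ∧ m.filter (fun x => decide (x ∈ S)) = [] :=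
    fun m hm => ⟨List.filter_eq_self.mpr (by simpa using hm),
      List.filter_eq_nil_iff.mpr (by simpa using hm)⟩
  have inn : ∀ m : List (Angle n), (∀ x ∈ m, x ∈ S) →
      m.filter (fun x => decide (x ∈ S)) = m ∧ m.filter (fun x => decide (x ∉ S)) = [] :=
    fun m hm => ⟨List.filter_eq_self.mpr (by simpa using hm),
      List.filter_eq_nil_iff.mpr (by simpa using hm)⟩
  rw [List.filter_append, List.filter_append, (out r hr).1, (out r' hr').1, (inn l hl).2,
    (inn l' hl').2, List.append_nil, List.append_nil] at h1
  rw [List.filter_append, List.filter_append, (out r hr).2, (out r' hr').2, (inn l hl).1,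
    (inn l' hl').1, List.nil_append, List.nil_append] at h2
  exact ⟨h1, h2⟩

theorem IsDeltaTerm.sign_eq {α β : Generator n} {θ₁ θ₂ : ℝ} {s : ℤ}
    (h : IsDeltaTerm α β θ₁ θ₂ s) : s = 1 ∨ s = -1 := by
  obtain ⟨-, r, l, l', c, -, hc, -, -, rfl⟩ := isDeltaTerm_iff.mp h
  rcases hc.sign_eq with rfl | rfl <;> rcases orderSign_eq α.order with h1 | h1 <;>
    rcases orderSign_eq β.order with h2 | h2 <;> rcases orderSign_eq (r ++ l) with h3 | h3 <;>
    rcases orderSign_eq (r ++ l') with h4 | h4 <;> simp [reorderSign, h1, h2, h3, h4]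

theorem IsDeltaTerm.sign_unique {α β : Generator n} {θ₁ θ₂ φ₁ φ₂ : ℝ} {s t : ℤ}
    (h : IsDeltaTerm α β θ₁ θ₂ s) (h' : IsDeltaTerm α β φ₁ φ₂ t) : s = t := by
  obtain ⟨hR, r, l, l', c, hr, hc, h1, h2, rfl⟩ := isDeltaTerm_iff.mp h
  obtain ⟨hR', r', m, m', e, hr', he, h1', h2', rfl⟩ := isDeltaTerm_iff.mp h'
  obtain ⟨k, rfl, rfl⟩ := hR.corner_unique hR'
  simp only [LabelChange, arc_add_int_mul, coe_add_int_mul] at hr' he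
  have hlt := hR.corner.lt.le
  have hc' := hc.mem_arc hlt
  have he' := LabelChange.mem_arc he hlt
  obtain ⟨hp1, hp2⟩ := perm_of_append_perm_append (h1.symm.trans h1') hr hr' hc'.1 he'.1
  obtain ⟨-, hp3⟩ := perm_of_append_perm_append (h2.symm.trans h2') hr hr' hc'.2 he'.2
  obtain ⟨rfl, rfl, rfl⟩ := hc.unique he hR.corner.coe_ne hp2 hp3
  have := orderSign_append_mul hp1 (h1.nodup_iff.mp α.nodup) (h2.nodup_iff.mp β.nodup)
  simp only [reorderSign]
  linear_combination c * orderSign α.order * orderSign β.order * this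

theorem IsDeltaTerm.deltaCoeff_eq {α β : Generator n} {θ₁ θ₂ : ℝ} {s : ℤ}
    (h : IsDeltaTerm α β θ₁ θ₂ s) : deltaCoeff α β = s := by
  rcases h.sign_eq with rfl | rfl
  · rw [deltaCoeff, if_pos ⟨_, _, h⟩, if_neg, sub_zero]
    rintro ⟨φ₁, φ₂, h'⟩
    exact absurd (h.sign_unique h') (by norm_num)
  · rw [deltaCoeff, if_neg, if_pos ⟨_, _, h⟩, zero_sub]
    rintro ⟨φ₁, φ₂, h'⟩
    exact absurd (h.sign_unique h') (by norm_num)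

theorem deltaCoeff_eq_zero {α β : Generator n} (h : ¬ ∃ θ₁ θ₂ s, IsDeltaTerm α β θ₁ θ₂ s) :
    deltaCoeff α β = 0 := by
  rw [deltaCoeff, if_neg, if_neg, sub_zero]
  · rintro ⟨θ₁, θ₂, h'⟩; exact h ⟨_, _, _, h'⟩
  · rintro ⟨θ₁, θ₂, h'⟩; exact h ⟨_, _, _, h'⟩

/-! ### Coefficients of the differential -/

section Coefficients

variable (d : Chain n →ₗ[AddMonoidAlgebra ℤ (ℤ × ℤ)] Chain n)

theorem diffCoeff_eq (α β : Generator n) :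
    diffCoeff d α β =
      orderSign α.order * orderSign β.order * d (Finsupp.single α.labeled 1) β.labeled := by
  have h : Finsupp.single α.labeled (orderSign α.order) =
      orderSign α.order • Finsupp.single α.labeled (1 : ℤ) := by simp
  rw [diffCoeff, Generator.coeff, Generator.toChain, h, map_zsmul, Finsupp.smul_apply, smul_eq_mul]
  ring

theorem diffCoeff_ne_zero_iff {α β : Generator n} :
    diffCoeff d α β ≠ 0 ↔ d (Finsupp.single α.labeled 1) β.labeled ≠ 0 := by
  rw [diffCoeff_eq]
  exact ⟨right_ne_zero_of_mul, mul_ne_zero (mul_ne_zero (orderSign_ne_zero _)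
    (orderSign_ne_zero _))⟩

theorem diffCoeff_reorder {α β α' β' : Generator n} (h1 : α.labeled = α'.labeled)
    (h2 : β.labeled = β'.labeled) : diffCoeff d α β =
      reorderSign α.order α'.order * reorderSign β.order β'.order * diffCoeff d α' β' := by
  rw [diffCoeff_eq, diffCoeff_eq, h1, h2, reorderSign, reorderSign]
  linear_combination (-orderSign α.order * orderSign β.order *
    d (Finsupp.single α'.labeled 1) β'.labeled) * (orderSign_mul_self α'.order *
      orderSign β'.order ^ 2 + orderSign_mul_self β'.order)

theorem labeled_toGenerator (a : LabeledPath n) : a.toGenerator.labeled = a := by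
  cases a
  simp [LabeledPath.toGenerator, Generator.labeled]

theorem labeled_eq_of_perm {α β : Generator n} (h : α.path = β.path)
    (hp : α.order.Perm β.order) : α.labeled = β.labeled := by
  cases α; cases β
  simp only at h hp
  subst h
  simp [Generator.labeled, List.toFinset_eq_of_perm _ _ hp]

theorem perm_of_labeled_eq {α β : Generator n} (h : α.labeled = β.labeled) :
    α.path = β.path ∧ α.order.Perm β.order := by
  have h1 : α.order.toFinset = β.order.toFinset := congrArg LabeledPath.hEdges h
  refine ⟨congrArg LabeledPath.path h, (List.perm_ext_iff_of_nodup α.nodup β.nodup).mpr fun x => ?_⟩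
  rw [← List.mem_toFinset, h1, List.mem_toFinset]

/-- If there are at most two ways to get from `γ` to `β` in two steps, `∂² = 0` says that their
contributions cancel. -/
theorem diffCoeff_add_eq_zero (hd : d ∘ₗ d = 0) {γ β σ τ : Generator n}
    (hne : σ.labeled ≠ τ.labeled)
    (h : ∀ ρ : Generator n, diffCoeff d γ ρ ≠ 0 → diffCoeff d ρ β ≠ 0 →
      ρ.labeled = σ.labeled ∨ ρ.labeled = τ.labeled) :
    diffCoeff d γ σ * diffCoeff d σ β + diffCoeff d γ τ * diffCoeff d τ β = 0 := by
  set x := d (Finsupp.single γ.labeled 1) with hx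
  have h0 : d x = 0 := by
    rw [hx]; exact congrArg (fun f => f (Finsupp.single γ.labeled 1)) hd
  have hsum : d x = ∑ b ∈ x.support, x b • d (Finsupp.single b 1) := by
    conv_lhs => rw [← Finsupp.sum_single x, Finsupp.sum, map_sum]
    refine Finset.sum_congr rfl fun b _ => ?_
    rw [← map_zsmul]; simp
  have hβ : ∑ b ∈ x.support, x b * d (Finsupp.single b 1) β.labeled = 0 := by
    have := congrArg (fun y => y β.labeled) (hsum.symm.trans h0)
    simpa [Finsupp.finsetSum_apply] using this
  have hterm : ∀ b, b ≠ σ.labeled → b ≠ τ.labeled →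
      x b * d (Finsupp.single b 1) β.labeled = 0 := fun b h1 h2 => by
    by_contra h3
    rcases h b.toGenerator
      ((diffCoeff_ne_zero_iff d).mpr (by rw [labeled_toGenerator]; exact left_ne_zero_of_mul h3))
      ((diffCoeff_ne_zero_iff d).mpr (by rw [labeled_toGenerator]; exact right_ne_zero_of_mul h3))
      with h4 | h4
    · exact h1 (by rwa [labeled_toGenerator] at h4)
    · exact h2 (by rwa [labeled_toGenerator] at h4)
  have hpair : ∑ b ∈ x.support, x b * d (Finsupp.single b 1) β.labeled =
      ∑ b ∈ {σ.labeled, τ.labeled}, x b * d (Finsupp.single b 1) β.labeled := by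
    rw [← Finset.sum_filter_add_sum_filter_not x.support
      (· ∈ ({σ.labeled, τ.labeled} : Finset (LabeledPath n)))]
    rw [Finset.sum_eq_zero (s := x.support.filter
      (· ∉ ({σ.labeled, τ.labeled} : Finset (LabeledPath n)))) fun b hb => ?_, add_zero]
    · refine Finset.sum_subset (fun b hb => (Finset.mem_filter.mp hb).2) fun b hb hb' => ?_
      have : b ∉ x.support := fun h' => hb' (Finset.mem_filter.mpr ⟨h', hb⟩)
      rw [Finsupp.notMem_support_iff.mp this, zero_mul]
    · have := (Finset.mem_filter.mp hb).2
      simp only [Finset.mem_insert, Finset.mem_singleton, not_or] at this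
      exact hterm b this.1 this.2
  rw [hpair, Finset.sum_pair hne] at hβ
  simp only [diffCoeff_eq]
  have e1 := orderSign_mul_self σ.order
  have e2 := orderSign_mul_self τ.order
  linear_combination (orderSign γ.order * orderSign β.order) * hβ +
    orderSign γ.order * orderSign β.order *
      (x σ.labeled * d (Finsupp.single σ.labeled 1) β.labeled) * e1 +
    orderSign γ.order * orderSign β.order *
      (x τ.labeled * d (Finsupp.single τ.labeled 1) β.labeled) * e2

/-- The differential is determined by its coefficients. -/
theorem eq_delta_of_diffCoeff_eq (h : ∀ α β : Generator n, diffCoeff d α β = deltaCoeff α β)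
    (x : Chain n) : d x = delta n x := by
  have hsingle : ∀ a : LabeledPath n, d (Finsupp.single a 1) = delta n (Finsupp.single a 1) := by
    intro a
    rw [delta, Finsupp.linearCombination_single, one_smul]
    have hterm : ∀ b : LabeledPath n, deltaCoeff a.toGenerator b.toGenerator •
        b.toGenerator.toChain = Finsupp.single b
          (orderSign a.toGenerator.order * d (Finsupp.single a 1) b) := fun b => by
      rw [← h, diffCoeff_eq, Generator.toChain, labeled_toGenerator, labeled_toGenerator,
        Finsupp.smul_single, smul_eq_mul]
      congr 1
      linear_combination (orderSign a.toGenerator.order * d (Finsupp.single a 1) b) *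
        orderSign_mul_self b.toGenerator.order
    rw [finsum_congr hterm, finsum_eq_sum_of_support_subset (s := (d (Finsupp.single a 1)).support),
      Finset.smul_sum]
    · conv_lhs => rw [← Finsupp.sum_single (d (Finsupp.single a 1)), Finsupp.sum]
      refine Finset.sum_congr rfl fun b _ => ?_
      rw [Finsupp.smul_single, smul_eq_mul, ← mul_assoc, orderSign_mul_self, one_mul]
    · intro b hb
      rw [Function.mem_support] at hb
      rw [Finset.mem_coe, Finsupp.mem_support_iff]
      rintro h0
      exact hb (by rw [h0, mul_zero, Finsupp.single_zero])
  rw [← Finsupp.sum_single x, Finsupp.sum, map_sum, map_sum]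
  refine Finset.sum_congr rfl fun b _ => ?_
  have e : Finsupp.single b (x b) = x b • Finsupp.single b (1 : ℤ) := by simp
  rw [e, map_zsmul, map_zsmul, hsingle]

end Coefficients

/-! ### Constructions of paths -/

theorem coe_eq_coe_iff_of_mem_Ico {a θ φ : ℝ} (h1 : a ≤ θ) (h2 : θ < a + 2 * π * n) (h3 : a ≤ φ)
    (h4 : φ < a + 2 * π * n) : (θ : Angle n) = (φ : Angle n) ↔ θ = φ :=
  ⟨fun h => eq_of_coe_eq_coe h h1 h2 h3 h4, fun h => h ▸ rfl⟩

namespace AdmissiblePath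

/-- The path with a single edge, of multiplicity one, at the angle `θ`, which is at the origin
during `[θ, θ + 2πn)`. -/
def singleEdge (n : ℕ) [NeZero n] (θ : ℝ) (h : IsRationalAngle θ) : AdmissiblePath n where
  period := dirVec θ
  mult := Finsupp.single (θ : Angle n) 1
  rational φ hφ := by
    obtain ⟨k, rfl⟩ := coe_eq_coe_iff.mp (Finsupp.single_apply_ne_zero.mp hφ).1.symm
    exact IsDirection.isRationalAngle (v := dirVec θ)
      (by rw [isDirection_add_int_mul]; exact isDirection_dirVec h)
  pos t := ⌊(t - θ) / (2 * π * n)⌋ • dirVec θ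
  jump s t hst := by
    have hT : (0 : ℝ) < 2 * π * n := (instFactAngle n).out
    set T : ℝ := 2 * π * n with hTdef
    have hinj : Function.Injective fun k : ℤ => θ + k * T := fun k l h => by
      have : (k : ℝ) * T = l * T := by simpa using h
      exact_mod_cast mul_right_cancel₀ hT.ne' this
    rw [finsum_mem_eq_sum_of_inter_support_eq (t :=
      (Finset.Ioc ⌊(s - θ) / T⌋ ⌊(t - θ) / T⌋).image fun k : ℤ => θ + k * T),
      Finset.sum_image hinj.injOn]
    · have hterm : ∀ k ∈ Finset.Ioc ⌊(s - θ) / T⌋ ⌊(t - θ) / T⌋,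
          Finsupp.single (θ : Angle n) 1 ((θ + k * T : ℝ) : Angle n) • dirVec (θ + k * T) =
            dirVec θ := fun k _ => by
        rw [hTdef, coe_add_int_mul, dirVec_add_int_mul, Finsupp.single_eq_same, one_smul]
      rw [Finset.sum_congr rfl hterm, Finset.sum_const, Int.card_Ioc, ← sub_smul,
        ← natCast_zsmul, Int.toNat_of_nonneg]
      rw [sub_nonneg]
      exact Int.floor_le_floor (by gcongr)
    · ext φ
      simp only [Set.mem_inter_iff, Set.mem_Ioc, Function.mem_support, Finset.coe_image,
        Set.mem_image, Finset.mem_coe, Finset.mem_Ioc]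
      refine and_congr_left fun hφ => ?_
      obtain ⟨k, rfl⟩ := coe_eq_coe_iff.mp
        (Finsupp.single_apply_ne_zero.mp (left_ne_zero_of_smul hφ)).1.symm
      have hk : (∃ l : ℤ, (⌊(s - θ) / T⌋ < l ∧ l ≤ ⌊(t - θ) / T⌋) ∧ θ + l * T = θ + k * T) ↔
          ⌊(s - θ) / T⌋ < k ∧ k ≤ ⌊(t - θ) / T⌋ :=
        ⟨fun ⟨l, h1, h2⟩ => hinj h2 ▸ h1, fun h => ⟨k, h, rfl⟩⟩
      rw [hk, Int.floor_lt, Int.le_floor, div_lt_iff₀ hT, le_div_iff₀ hT]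
      constructor <;> rintro ⟨h1, h2⟩ <;> constructor <;> linarith
  periodic t := by
    have hT : (0 : ℝ) < 2 * π * n := (instFactAngle n).out
    have : (t + 2 * π * n - θ) / (2 * π * n) = (t - θ) / (2 * π * n) + 1 := by
      rw [add_sub_right_comm, add_div, div_self hT.ne']
    rw [this, Int.floor_add_one, add_smul, one_smul]

theorem singleEdge_pos_of_mem_Ico {θ t : ℝ} (h : IsRationalAngle θ) (h1 : θ ≤ t)
    (h2 : t < θ + 2 * π * n) : (singleEdge n θ h).pos t = 0 := by
  have hT : (0 : ℝ) < 2 * π * n := (instFactAngle n).out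
  have : ⌊(t - θ) / (2 * π * n)⌋ = 0 := by
    rw [Int.floor_eq_zero_iff]
    exact ⟨div_nonneg (by linarith) hT.le, by rw [div_lt_one hT]; linarith⟩
  simp [singleEdge, this]

theorem singleEdge_pos_of_lt {θ t : ℝ} (h : IsRationalAngle θ) (h1 : t < θ)
    (h2 : θ ≤ t + 2 * π * n) : (singleEdge n θ h).pos t = -dirVec θ := by
  have := (singleEdge n θ h).periodic t
  rw [singleEdge_pos_of_mem_Ico h (by linarith) (by linarith)] at this
  exact (neg_eq_of_add_eq_zero_left this.symm).symm

theorem finite_jumps (Λ : AdmissiblePath n) (s t : ℝ) :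
    (Set.Ioc s t ∩ Function.support fun θ : ℝ => Λ.mult (θ : Angle n) • dirVec θ).Finite :=
  (Λ.finite_edges s t).subset fun _ h => ⟨⟨h.1.1.le, h.1.2⟩, left_ne_zero_of_smul h.2⟩

/-- The sum of two paths, which has the edges of both. -/
def add (A B : AdmissiblePath n) : AdmissiblePath n where
  period := A.period + B.period
  mult := A.mult + B.mult
  rational θ h := by
    by_cases hA : A.mult (θ : Angle n) = 0
    · exact B.rational θ fun hB => h (by rw [Finsupp.add_apply, hA, hB])
    · exact A.rational θ hA
  pos t := A.pos t + B.pos t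
  jump s t hst := by
    simp only [Finsupp.add_apply, add_smul]
    rw [finsum_mem_add_distrib' (A.finite_jumps s t) (B.finite_jumps s t), ← A.jump s t hst,
      ← B.jump s t hst]
    abel
  periodic t := by rw [A.periodic, B.periodic]; abel

/-- The difference of two paths, where the edges of `C` are among those of `A`. -/
def sub (A C : AdmissiblePath n) (h : C.mult ≤ A.mult) : AdmissiblePath n where
  period := A.period - C.period
  mult := A.mult - C.mult
  rational θ h := A.rational θ fun hA => h (by rw [Finsupp.tsub_apply, hA, Nat.zero_sub])
  pos t := A.pos t - C.pos t
  jump s t hst := by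
    have key : ∀ θ : ℝ, A.mult (θ : Angle n) • dirVec θ =
        (A.mult - C.mult) (θ : Angle n) • dirVec θ + C.mult (θ : Angle n) • dirVec θ := fun θ => by
      rw [← add_smul, Finsupp.tsub_apply, Nat.sub_add_cancel (h _)]
    have hfin : (Set.Ioc s t ∩ Function.support fun θ : ℝ =>
        (A.mult - C.mult) (θ : Angle n) • dirVec θ).Finite := by
      refine (A.finite_edges s t).subset fun θ h => ⟨⟨h.1.1.le, h.1.2⟩, fun hA => ?_⟩
      exact left_ne_zero_of_smul h.2 (by rw [Finsupp.tsub_apply, hA, Nat.zero_sub])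
    have hA := A.jump s t hst
    simp only [key] at hA
    rw [finsum_mem_add_distrib' hfin (C.finite_jumps s t), ← C.jump s t hst] at hA
    rw [eq_sub_of_add_eq hA.symm]
    abel
  periodic t := by rw [A.periodic, C.periodic]; abel

theorem exists_left_eq (Λ : AdmissiblePath n) (θ : ℝ) :
    ∃ ε, 0 < ε ∧ ∀ δ, 0 < δ → δ ≤ ε → Λ.left θ = Λ.pos (θ - δ) := by
  obtain ⟨ε, hε, -, e⟩ := Λ.exists_isolating θ one_pos
  exact ⟨ε, hε, fun δ h1 h2 => Λ.left_eq_of_not_isEdge (by linarith)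
    fun φ h4 h5 => e φ (by linarith) (by linarith) h5.ne⟩

/-- The positions determine the multiplicities. -/
theorem mult_add_mult_eq {A B C D : AdmissiblePath n}
    (h : ∀ t, A.pos t - B.pos t = C.pos t - D.pos t) (x : Angle n) :
    A.mult x + D.mult x = C.mult x + B.mult x := by
  obtain ⟨θ, rfl⟩ := QuotientAddGroup.mk_surjective x
  by_cases hr : IsRationalAngle θ
  · obtain ⟨a, ha, hA⟩ := A.exists_left_eq θ
    obtain ⟨b, hb, hB⟩ := B.exists_left_eq θ
    obtain ⟨c, hc, hC⟩ := C.exists_left_eq θ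
    obtain ⟨e, he, hD⟩ := D.exists_left_eq θ
    obtain ⟨δ, h0, h1, h2, h3, h4⟩ : ∃ δ, 0 < δ ∧ δ ≤ a ∧ δ ≤ b ∧ δ ≤ c ∧ δ ≤ e :=
      ⟨min (min a b) (min c e), by positivity, (min_le_left _ _).trans (min_le_left _ _),
        (min_le_left _ _).trans (min_le_right _ _), (min_le_right _ _).trans (min_le_left _ _),
        (min_le_right _ _).trans (min_le_right _ _)⟩
    have e1 := pos_sub_pos_eq_left_sub_left_add B A θ
    have e2 := pos_sub_pos_eq_left_sub_left_add D C θ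
    rw [h, e2, hA δ h0 h1, hB δ h0 h2, hC δ h0 h3, hD δ h0 h4, h, add_right_inj] at e1
    have := zsmul_dirVec_injective hr e1
    omega
  · have h0 : ∀ Λ : AdmissiblePath n, Λ.mult (θ : Angle n) = 0 := fun Λ => by
      by_contra h'
      exact hr (Λ.rational θ h')
    simp only [h0]

namespace IsCut

variable {Λ Λ' : AdmissiblePath n} {θ₁ θ₂ : ℝ}

theorem mult_eq (h : IsCut Λ θ₁ θ₂ Λ') {θ : ℝ} (h1 : θ₂ < θ) (h2 : θ < θ₁ + 2 * π * n) :
    Λ'.mult (θ : Angle n) = Λ.mult (θ : Angle n) := by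
  by_cases hr : IsRationalAngle θ
  · obtain ⟨a, ha, hA⟩ := Λ.exists_left_eq θ
    obtain ⟨b, hb, hB⟩ := Λ'.exists_left_eq θ
    obtain ⟨δ, h0, h3, h4, h5⟩ : ∃ δ, 0 < δ ∧ δ ≤ a ∧ δ ≤ b ∧ δ ≤ θ - θ₂ :=
      ⟨min (min a b) (θ - θ₂), lt_min (by positivity) (by linarith),
        (min_le_left _ _).trans (min_le_left _ _),
        (min_le_left _ _).trans (min_le_right _ _), min_le_right _ _⟩
    have e1 := pos_sub_pos_eq_left_sub_left_add Λ Λ' θ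
    rw [h.pos_eq h1.le h2, hA δ h0 h3, hB δ h0 h4, h.pos_eq (by linarith) (by linarith), sub_self,
      sub_self, zero_add] at e1
    have := zsmul_dirVec_injective hr ((zero_smul ℤ _).trans e1)
    omega
  · have h0 : ∀ Λ : AdmissiblePath n, Λ.mult (θ : Angle n) = 0 := fun Λ => by
      by_contra h'
      exact hr (Λ.rational θ h')
    simp only [h0]

theorem mult_eq_zero (h : IsCut Λ θ₁ θ₂ Λ') {θ : ℝ} (h1 : θ₁ < θ) (h2 : θ < θ₂) :
    Λ.mult (θ : Angle n) = 0 := by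
  by_contra h'
  exact h.corner.consecutive θ ⟨h1, h2⟩ h'

/-- A cut shortens only the two edges adjacent to the corner, by one unit each. -/
theorem mult_le (h : IsCut Λ θ₁ θ₂ Λ') : Λ.mult ≤
    Finsupp.single (θ₁ : Angle n) 1 + Finsupp.single (θ₂ : Angle n) 1 + Λ'.mult := fun x => by
  obtain ⟨θ, rfl, h1, h2⟩ := exists_coe_eq_mem_Ico θ₁ x
  rw [Finsupp.add_apply, Finsupp.add_apply]
  have hml := h.mult_left
  have hmr := h.mult_right
  rcases h1.eq_or_lt with rfl | h1
  · rw [Finsupp.single_eq_same]; omega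
  rcases lt_trichotomy θ θ₂ with h3 | rfl | h3
  · rw [h.mult_eq_zero h1 h3]; omega
  · rw [Finsupp.single_eq_same]; omega
  · rw [h.mult_eq h3 h2]; omega

end IsCut

/-- Whether a modification of a path at a corner is a rounding depends only on the displacement. -/
theorem IsUnimodularCut.transfer {Λ Λ' M M' : AdmissiblePath n} {θ₁ θ₂ : ℝ}
    (h : IsUnimodularCut Λ θ₁ θ₂ Λ') (hM : M.IsCorner θ₁ θ₂)
    (hpos : ∀ t, M'.pos t - M.pos t = Λ'.pos t - Λ.pos t) : IsUnimodularCut M θ₁ θ₂ M' where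
  corner := hM
  period := by
    have h1 := hpos (0 + 2 * π * n)
    have h2 := hpos 0
    rw [M.periodic, M'.periodic, Λ.periodic, Λ'.periodic, h.period] at h1
    rw [← sub_eq_zero]
    calc M'.period - M.period = (M'.pos 0 + M'.period - (M.pos 0 + M.period)) -
          (M'.pos 0 - M.pos 0) := by abel
      _ = 0 := by rw [h1, h2]; abel
  outside t ht := by
    rw [← sub_eq_zero, hpos, h.outside t ht, sub_self]
  mult_left := by
    have := mult_add_mult_eq hpos (θ₁ : Angle n)
    have := h.mult_left
    omega
  mult_right := by
    have := mult_add_mult_eq hpos (θ₂ : Angle n)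
    have := h.mult_right
    omega
  unimodular θ h1 h2 he := by
    have hm := mult_add_mult_eq hpos (θ : Angle n)
    have h3 := h.toIsCut.mult_eq_zero h1 h2
    have h4 : M.mult (θ : Angle n) = 0 := by
      by_contra h'
      exact hM.consecutive θ ⟨h1, h2⟩ h'
    rw [← hM.pos_eq h1.le h2, hpos, h.corner.pos_eq h1.le h2]
    exact h.unimodular θ h1 h2 fun h0 => he (by omega)

end AdmissiblePath

/-! ### Locality for roundings -/

theorem IsDeltaTerm.add_int_mul {α β : Generator n} {θ₁ θ₂ : ℝ} {s : ℤ}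
    (h : IsDeltaTerm α β θ₁ θ₂ s) (k : ℤ) :
    IsDeltaTerm α β (θ₁ + k * (2 * π * n)) (θ₂ + k * (2 * π * n)) s := by
  obtain ⟨hR, h⟩ := h
  refine ⟨(hR.isUnimodularCut.add_int_mul k).isRounding, ?_⟩
  simpa only [arc_add_int_mul, coe_add_int_mul] using h

theorem isDeltaTerm_of_order {α β : Generator n} {θ₁ θ₂ : ℝ} {r l l' : List (Angle n)} {c s : ℤ}
    (hR : IsRounding α.path θ₁ θ₂ β.path) (hr : ∀ η ∈ r, η ∉ arc n θ₁ θ₂)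
    (hc : LabelChange n θ₁ θ₂ l l' c) (hα : α.order.Perm (r ++ l)) (hβ : β.order = r ++ l')
    (hs : s = c * reorderSign α.order (r ++ l)) : IsDeltaTerm α β θ₁ θ₂ s :=
  isDeltaTerm_iff.mpr ⟨hR, r, l, l', c, hr, hc, hα, hβ ▸ List.Perm.refl _, by
    rw [hs, hβ, reorderSign_self, mul_one]⟩

/-- For a rounding, an edge of the new path partially agrees with one of the old path unless it is
created by the rounding. -/
theorem partiallyAgree_iff {α β : Generator n} {θ₁ θ₂ θ : ℝ} (h : IsCut α.path θ₁ θ₂ β.path)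
    (h1 : θ₁ ≤ θ) (h2 : θ < θ₁ + 2 * π * n) :
    PartiallyAgree α β θ ↔ ¬ (θ₁ < θ ∧ θ < θ₂) ∧ β.path.IsEdge θ := by
  have hml := h.mult_left
  have hmr := h.mult_right
  have e : PartiallyAgree α β θ ↔ α.path.IsEdge θ ∧ β.path.IsEdge θ ∧
    cross (dirVec θ) (β.path.pos θ - α.path.pos θ) = 0 := Iff.rfl
  rw [e]
  refine ⟨fun ⟨ha, hb, _⟩ => ⟨fun h3 => h.corner.consecutive θ h3 ha, hb⟩, fun ⟨h3, hb⟩ => ?_⟩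
  rcases h1.eq_or_lt with rfl | h1
  · exact ⟨h.corner.edge_left, hb, by rw [h.pos_left, cross_neg, cross_self, neg_zero]⟩
  rcases lt_trichotomy θ θ₂ with h4 | rfl | h4
  · exact absurd ⟨h1, h4⟩ h3
  · exact ⟨h.corner.edge_right, hb, by rw [h.pos_eq le_rfl h2, sub_self, cross_zero]⟩
  · exact ⟨by rwa [IsEdge, ← h.mult_eq h4 h2], hb, by rw [h.pos_eq h4.le h2, sub_self, cross_zero]⟩

theorem IsDeltaTerm.labelsMatch {α β : Generator n} {θ₁ θ₂ : ℝ} {s : ℤ}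
    (h : IsDeltaTerm α β θ₁ θ₂ s) : LabelsMatch α β := fun θ => by
  wlog h0 : θ₁ ≤ θ ∧ θ < θ₁ + 2 * π * n generalizing θ₁ θ₂
  · obtain ⟨k, h1, h2⟩ := exists_int_add_mem_Ico n θ₁ θ
    exact this (h.add_int_mul (-k)) ⟨by push_cast; linarith, by push_cast; linarith⟩
  obtain ⟨h1, h2⟩ := h0
  obtain ⟨hR, r, l, l', c, hr, hc, hα, hβ, -⟩ := isDeltaTerm_iff.mp h
  have hcut := hR.isCut
  have hla := hc.mem_arc hcut.corner.lt.le
  have hmem := mem_arc_iff_of_mem_Ico hcut.corner.lt_add_period h1 h2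
  constructor
  · rintro ⟨ha, hb, e1, e2⟩
    have h3 : θ₂ < θ := by
      rcases h1.eq_or_lt with rfl | h1
      · have := hcut.pos_left
        rw [e2, sub_self, eq_comm, neg_eq_zero] at this
        exact absurd this (dirVec_ne_zero ha.isRationalAngle)
      rcases lt_trichotomy θ θ₂ with h4 | rfl | h4
      · exact absurd ha (hcut.corner.consecutive θ ⟨h1, h4⟩)
      · have := hcut.left_right
        rw [← e1, hcut.corner.left_eq, sub_self, eq_comm] at this
        exact absurd this (dirVec_ne_zero ha.isRationalAngle)
      · exact h4
    have h4 : (θ : Angle n) ∉ arc n θ₁ θ₂ := fun h => absurd (hmem.mp h) (not_le.mpr h3)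
    rw [hα.mem_iff, hβ.mem_iff, List.mem_append, List.mem_append,
      or_iff_left fun h => h4 (hla.1 _ h), or_iff_left fun h => h4 (hla.2 _ h)]
  · intro hpa hθ
    rw [hα.mem_iff, List.mem_append]
    rw [hβ.mem_iff, List.mem_append] at hθ
    refine hθ.imp_right fun hθ => ?_
    rcases hc with ⟨rfl, rfl, -⟩ | ⟨rfl, rfl, -⟩ | ⟨η, hη, rfl, rfl, -⟩
    · exact absurd hθ List.not_mem_nil
    · exact absurd hθ List.not_mem_nil
    · have h3 := hmem.mp (hla.2 _ hθ)
      have h4 := ((partiallyAgree_iff hcut h1 h2).mp hpa).1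
      rcases h1.eq_or_lt with rfl | h1
      · simp
      · rcases h3.eq_or_lt with rfl | h3
        · simp
        · exact absurd ⟨h1, h3⟩ h4

/-- A coefficient for a rounding equals the one for the same rounding of a path that consists of
the two edges adjacent to the corner. -/
theorem diffCoeff_eq_of_reduction {d : Chain n →ₗ[AddMonoidAlgebra ℤ (ℤ × ℤ)] Chain n}
    (hloc : AxiomLocality d) {α β α' β' : Generator n} {θ₁ θ₂ : ℝ} {s : ℤ}
    (h : IsDeltaTerm α β θ₁ θ₂ s)
    (hm : α'.path.mult = Finsupp.single (θ₁ : Angle n) 1 + Finsupp.single (θ₂ : Angle n) 1)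
    (hpos : ∀ t, α.path.pos t - β.path.pos t = α'.path.pos t - β'.path.pos t)
    {L : List (Angle n)}
    (hL : ∀ x ∈ L, x ∉ arc n θ₁ θ₂ ∨ x = (θ₁ : Angle n) ∨ x = (θ₂ : Angle n))
    (hα : α.order = L ++ α'.order) (hβ : β.order = L ++ β'.order) :
    diffCoeff d α β = diffCoeff d α' β' := by
  have hR := h.1
  have key : ∀ θ : ℝ, (PartiallyAgree α β θ → β'.path.mult (θ : Angle n) = 0) ∧
      (¬ PartiallyAgree α β θ →
        α'.path.mult (θ : Angle n) = α.path.mult (θ : Angle n)) := fun θ => by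
    clear hL
    wlog h0 : θ₁ ≤ θ ∧ θ < θ₁ + 2 * π * n generalizing θ₁ θ₂
    · obtain ⟨k, h1, h2⟩ := exists_int_add_mem_Ico n θ₁ θ
      refine this (h.add_int_mul (-k)) ?_ (h.add_int_mul (-k)).1
        ⟨by push_cast; linarith, by push_cast; linarith⟩
      rw [coe_add_int_mul, coe_add_int_mul, hm]
    obtain ⟨h1, h2⟩ := h0
    have hcut := hR.isCut
    have hlt := hcut.corner.lt
    have hT := hcut.corner.lt_add_period
    have hpa := partiallyAgree_iff hcut h1 h2
    have hmult := mult_add_mult_eq hpos (θ : Angle n)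
    have hml := hcut.mult_left
    have hmr := hcut.mult_right
    rw [hpa, IsEdge]
    have hm' : α'.path.mult (θ : Angle n) = (if θ = θ₁ then 1 else 0) + if θ = θ₂ then 1 else 0 := by
      rw [hm, Finsupp.add_apply, Finsupp.single_apply, Finsupp.single_apply]
      simp only [eq_comm (a := θ)]
      simp only [coe_eq_coe_iff_of_mem_Ico le_rfl (hlt.trans hT) h1 h2,
        coe_eq_coe_iff_of_mem_Ico hlt.le hT h1 h2]
    rcases h1.eq_or_lt with rfl | h1
    · rw [if_pos rfl, if_neg hlt.ne] at hm'
      simp only [lt_irrefl, false_and, not_false_eq_true, true_and, not_not]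
      omega
    rw [if_neg h1.ne', zero_add] at hm'
    rcases lt_trichotomy θ θ₂ with h4 | rfl | h4
    · rw [if_neg h4.ne] at hm'
      have := hcut.mult_eq_zero h1 h4
      exact ⟨fun h' => absurd ⟨h1, h4⟩ h'.1, fun _ => by omega⟩
    · rw [if_pos rfl] at hm'
      simp only [lt_irrefl, and_false, not_false_eq_true, true_and, not_not]
      omega
    · rw [if_neg h4.ne'] at hm'
      have := hcut.mult_eq h4 h2
      simp only [h4.not_gt, and_false, not_false_eq_true, true_and, not_not]
      omega
  refine hloc α β α' β' hR.period.symm hR.isLeftOf h.labelsMatch ⟨fun θ hθ => ?_, fun θ hθ => ?_,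
    hpos, L, fun x hx => ?_, hα, hβ⟩
  · have := mult_add_mult_eq hpos (θ : Angle n)
    have := (key θ).1 hθ
    omega
  · have := mult_add_mult_eq hpos (θ : Angle n)
    have := (key θ).2 hθ
    omega
  · have hxe : x ∈ β.path.mult.support := β.edges x (by rw [hβ]; exact List.mem_append_left _ hx)
    obtain ⟨θ, rfl, h1, h2⟩ := exists_coe_eq_mem_Ico θ₁ x
    refine ⟨θ, rfl, (partiallyAgree_iff hR.isCut h1 h2).mpr
      ⟨fun ⟨h3, h4⟩ => ?_, isEdge_iff_mem_support.mpr hxe⟩⟩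
    have hlt := hR.corner.lt
    have hT := hR.corner.lt_add_period
    rcases hL _ hx with h5 | h5 | h5
    · exact h5 ⟨θ, ⟨h1, h4.le⟩, rfl⟩
    · exact h3.ne' (eq_of_coe_eq_coe h5 h1 h2 le_rfl (hlt.trans hT))
    · exact h4.ne (eq_of_coe_eq_coe h5 h1 h2 hlt.le hT)

/-! ### The auxiliary edge -/

namespace AdmissiblePath

theorem singleEdge_mult {a θ φ : ℝ} (h : IsRationalAngle θ) (h1 : a ≤ θ)
    (h2 : θ < a + 2 * π * n) (h3 : a ≤ φ) (h4 : φ < a + 2 * π * n) :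
    (singleEdge n θ h).mult (φ : Angle n) = if φ = θ then 1 else 0 := by
  rw [singleEdge, Finsupp.single_apply]
  simp only [coe_eq_coe_iff_of_mem_Ico h1 h2 h3 h4, eq_comm (a := θ)]

/-- It suffices to compare the positions during the complement of the corner in one period. -/
theorem isCut_of_pos_eq {Λ Λ' : AdmissiblePath n} {θ₁ θ₂ : ℝ} (hc : Λ.IsCorner θ₁ θ₂)
    (hp : Λ'.period = Λ.period)
    (hpos : ∀ t, θ₂ ≤ t → t < θ₁ + 2 * π * n → Λ'.pos t = Λ.pos t)
    (hl : Λ'.mult (θ₁ : Angle n) + 1 = Λ.mult (θ₁ : Angle n))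
    (hr : Λ'.mult (θ₂ : Angle n) + 1 = Λ.mult (θ₂ : Angle n)) : IsCut Λ θ₁ θ₂ Λ' where
  corner := hc
  period := hp
  outside t ht := by
    obtain ⟨k, h1, h2⟩ := exists_int_add_mem_Ico n θ₁ t
    rw [← sub_eq_zero, ← pos_sub_pos_add_int_mul hp t k, sub_eq_zero]
    refine hpos _ (le_of_not_ge fun h3 => ht ?_) h2
    rw [← coe_add_int_mul t k]
    exact ⟨_, ⟨h1, h3⟩, rfl⟩
  mult_left := hl
  mult_right := hr

/-- The rounding of a corner that is not a half turn creates an edge; the last one ends at the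
vertex of the triangle on the second edge. -/
theorem IsCut.exists_last_edge {Λ Λ' : AdmissiblePath n} {x y : ℝ} (h : IsCut Λ x y Λ')
    (hD : cross (dirVec x) (dirVec y) ≠ 0) : ∃ g, x < g ∧ g < y ∧ Λ'.IsEdge g ∧
      (∀ φ, g < φ → φ < y → ¬ Λ'.IsEdge φ) ∧ Λ'.pos g - Λ.pos x = dirVec y := by
  by_cases he : ∃ θ, x < θ ∧ θ < y ∧ Λ'.IsEdge θ
  · obtain ⟨θ, h1, h2, h3⟩ := he
    obtain ⟨g, h4, h5, h6, h7⟩ := Λ'.exists_last_edge_lt h2 h3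
    exact ⟨g, by linarith, h5, h6, h7, by rw [← Λ'.left_eq_of_not_isEdge h5 h7, h.left_right]⟩
  · push Not at he
    have h1 := h.left_right
    rw [Λ'.left_eq_of_not_isEdge h.corner.lt he, h.pos_left] at h1
    rw [← h1, cross_neg, cross_self, neg_zero] at hD
    exact absurd rfl hD

/-- The rounding moves away from the line through the corner in the direction of the first edge. -/
theorem IsCut.cross_left_nonneg {Λ Λ' : AdmissiblePath n} {x y g : ℝ} (h : IsCut Λ x y Λ')
    (hxg : x < g) (hgy : g < y) : 0 ≤ cross (dirVec x) (Λ'.left g - Λ.pos x) ∧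
      ∀ θ, x < θ → θ < g → Λ'.IsEdge θ → 0 < cross (dirVec x) (Λ'.left g - Λ.pos x) := by
  have hx := h.corner.edge_left.isRationalAngle
  have hpi := h.corner.le_pi
  have hpos : ∀ θ, x < θ → θ < g → Λ'.IsEdge θ → 0 < crossHom (dirVec x) (dirVec θ) :=
    fun θ h1 h2 h3 => cross_dirVec_pos hx h3.isRationalAngle h1 (by linarith)
  have hl : crossHom (dirVec x) (Λ'.pos x - Λ.pos x) = 0 := by
    rw [h.pos_left, map_neg, crossHom_apply, cross_self, neg_zero]
  rw [map_sub] at hl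
  obtain ⟨ε, hε, hleft⟩ := Λ'.exists_left_eq g
  rw [← crossHom_apply, map_sub]
  constructor
  · have h1 : 0 < min ε (g - x) := lt_min hε (by linarith)
    have h2 := min_le_right ε (g - x)
    rw [hleft _ h1 (min_le_left _ _)]
    have := Λ'.map_pos_le (crossHom (dirVec x)) (s := x) (t := g - min ε (g - x)) (by linarith)
      fun θ h3 h4 h5 => (hpos θ h3 (by linarith) h5).le
    linarith
  · intro θ h3 h4 h5
    have h1 : 0 < min ε (g - θ) := lt_min hε (by linarith)
    have h2 := min_le_right ε (g - θ)
    rw [hleft _ h1 (min_le_left _ _)]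
    have := Λ'.map_pos_lt (crossHom (dirVec x)) (s := x) (t := g - min ε (g - θ))
      (fun φ h6 h7 h8 => (hpos φ h6 (by linarith) h8).le) h3 (by linarith) h5 (hpos θ h3 h4 h5)
    linarith

/-- The rounding of a corner of determinant one creates a single edge, of multiplicity one. -/
theorem IsUnimodularCut.exists_unique_edge {Λ Λ' : AdmissiblePath n} {x y : ℝ}
    (h : IsUnimodularCut Λ x y Λ') (hD : cross (dirVec x) (dirVec y) = 1) :
    ∃ g ∈ Set.Ioo x y, Λ'.mult (g : Angle n) = 1 ∧
      ∀ θ ∈ Set.Ioo x y, Λ'.IsEdge θ → θ = g := by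
  obtain ⟨g, hxg, hgy, hg, hgl, hpos⟩ := h.toIsCut.exists_last_edge (by rw [hD]; norm_num)
  have hpi := h.corner.le_pi
  have hxg1 : 0 < cross (dirVec x) (dirVec g) :=
    cross_dirVec_pos h.corner.edge_left.isRationalAngle hg.isRationalAngle hxg (by linarith)
  have hm : (1 : ℤ) ≤ Λ'.mult (g : Angle n) := by exact_mod_cast Nat.one_le_iff_ne_zero.mpr hg
  obtain ⟨h1, h2⟩ := h.toIsCut.cross_left_nonneg hxg hgy
  have e : Λ'.left g - Λ.pos x = dirVec y - Λ'.mult (g : Angle n) • dirVec g := by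
    rw [← hpos, left]; abel
  rw [e, cross_sub, cross_nsmul, hD] at h1 h2
  refine ⟨g, ⟨hxg, hgy⟩, ?_, fun θ hθ he => ?_⟩
  · have : (Λ'.mult (g : Angle n) : ℤ) ≤ 1 := by nlinarith
    omega
  · rcases lt_trichotomy θ g with h3 | h3 | h3
    · have := h2 θ hθ.1 h3 he
      nlinarith
    · exact h3
    · exact absurd he (hgl θ h3 hθ.2)

/-- Let `Q` be the rounding of the path `P` with the two edges `x` and `y`.  With an edge added to
`P` at the angle `z` opposite to the last edge `g` of `Q`, there are exactly two ways to get from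
the path `A` so obtained to the path `D = Q - g`: by rounding first the corner between `x` and `y`
and then the degenerate one between `g` and `z`, or by rounding first the corner between `y` and
`z`, which creates the single edge `r`, and then the one between `x` and `r`. -/
structure IsSquare (P Q : AdmissiblePath n) (x g y r z : ℝ) (A B C D : AdmissiblePath n) :
    Prop where
  lt_xg : x < g
  lt_gy : g < y
  lt_yr : y < r
  lt_rz : r < z
  z_eq : z = g + π
  lt_period : z < x + 2 * π * n
  edges : ∀ η ∈ Q.mult.support, ∃ θ, x < θ ∧ θ ≤ g ∧ (θ : Angle n) = η
  mult_A : A.mult = Finsupp.single (x : Angle n) 1 + Finsupp.single (y : Angle n) 1 +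
    Finsupp.single (z : Angle n) 1
  mult_B : B.mult = Q.mult + Finsupp.single (z : Angle n) 1
  mult_C : C.mult = Finsupp.single (x : Angle n) 1 + Finsupp.single (r : Angle n) 1
  mult_D : D.mult + Finsupp.single (g : Angle n) 1 = Q.mult
  pos_sub : ∀ t, A.pos t - B.pos t = P.pos t - Q.pos t
  rounding_AB : IsRounding A x y B
  rounding_BD : IsRounding B g z D
  rounding_AC : IsRounding A y z C
  rounding_CD : IsRounding C x r D
  cross_AC : cross (dirVec y) (dirVec z) = 1
  cross_CD : cross (dirVec x) (dirVec r) < cross (dirVec x) (dirVec y)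
  not_rounding : ∀ R, IsRounding A z (x + 2 * π * n) R → ¬ IsLeftOf D R

/-- The direction of `y - g` for an edge `g` at lattice distance `1` is less than a half turn from
`x`, and has a smaller determinant with `x` than `y`. -/
theorem cross_sub_pos {x g y : ℤ × ℤ} (hx : IsCoprime x.1 x.2) (hxg : 0 < cross x g)
    (hgy : cross g y = 1) {m : ℕ} (hm : m ≠ 0) (h : 0 ≤ cross x (y - m • g))
    (hD : 2 ≤ cross x y) : 0 < cross x (y - g) := by
  rw [cross_sub, cross_nsmul] at h
  rw [cross_sub]
  have hm1 : (1 : ℤ) ≤ m := by exact_mod_cast Nat.one_le_iff_ne_zero.mpr hm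
  have h0 : 0 ≤ cross x y - cross x g := by nlinarith
  refine lt_of_le_of_ne h0 fun h1 => ?_
  obtain ⟨k, hk⟩ := exists_zsmul_of_cross_eq_zero (w := y - g) hx (by rw [cross_sub, h1])
  have h2 : cross g (y - g) = 1 := by rw [cross_sub, hgy, cross_self, sub_zero]
  rw [hk, cross_zsmul, cross_swap] at h2
  have h3 : cross x g ∣ 1 := ⟨-k, by linarith⟩
  have := Int.le_of_dvd one_pos h3
  omega

theorem exists_isSquare {x y : ℝ} (hx : IsRationalAngle x) (hy : IsRationalAngle y)
    {Q : AdmissiblePath n}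
    (h : IsUnimodularCut ((singleEdge n x hx).add (singleEdge n y hy)) x y Q)
    (hD : 2 ≤ cross (dirVec x) (dirVec y)) :
    ∃ g r z A B C D,
      IsSquare ((singleEdge n x hx).add (singleEdge n y hy)) Q x g y r z A B C D := by
  set P := (singleEdge n x hx).add (singleEdge n y hy) with hP
  have hxy := h.corner.lt
  have hpi : y - x < π := by
    refine lt_of_le_of_ne h.corner.le_pi fun h0 => ?_
    rw [show y = x + π by linarith, dirVec_add_pi hx, cross_neg, cross_self] at hD
    omega
  have hT := two_pi_le_period n
  have hpi0 := Real.pi_pos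
  have hPmult : ∀ φ, x ≤ φ → φ < x + 2 * π * n → P.mult (φ : Angle n) =
      (if φ = x then 1 else 0) + if φ = y then 1 else 0 := fun φ h1 h2 => by
    rw [hP, add, Finsupp.add_apply, singleEdge_mult hx le_rfl (by linarith) h1 h2,
      singleEdge_mult hy hxy.le (by linarith) h1 h2]
  have hQx : Q.mult (x : Angle n) = 0 := by
    have := h.mult_left
    rw [hPmult x le_rfl (by linarith), if_pos rfl, if_neg hxy.ne] at this
    omega
  have hQy : Q.mult (y : Angle n) = 0 := by
    have := h.mult_right
    rw [hPmult y hxy.le (by linarith), if_pos rfl, if_neg hxy.ne'] at this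
    omega
  have hQ : ∀ φ, y ≤ φ → φ < x + 2 * π * n → Q.mult (φ : Angle n) = 0 := fun φ h1 h2 => by
    rcases h1.eq_or_lt with rfl | h1
    · exact hQy
    · rw [h.toIsCut.mult_eq h1 h2, hPmult φ (by linarith) h2, if_neg (by linarith), if_neg h1.ne']
  -- the last edge of `Q`
  obtain ⟨g, hxg, hgy, hg, hgl, hQpos⟩ := h.toIsCut.exists_last_edge (by omega)
  have hgr := hg.isRationalAngle
  have hgy1 : cross (dirVec g) (dirVec y) = 1 := by
    rw [← hQpos]
    exact h.unimodular g hxg hgy hg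
  have hxg1 : 0 < cross (dirVec x) (dirVec g) := cross_dirVec_pos hx hgr hxg (by linarith)
  have hQ0 : ∀ φ, g < φ → φ < x + 2 * π * n → Q.mult (φ : Angle n) = 0 := fun φ h1 h2 => by
    rcases lt_or_ge φ y with h3 | h3
    · by_contra h4
      exact hgl φ h1 h3 h4
    · exact hQ φ h3 h2
  set z := g + π with hz
  have hzr : IsRationalAngle z := (isDirection_add_pi hgr).isRationalAngle
  have hzv : dirVec z = -dirVec g := dirVec_add_pi hgr
  have hyz : y < z := by linarith
  have hzT : z < x + 2 * π * n := by linarith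
  have hyz1 : cross (dirVec y) (dirVec z) = 1 := by rw [hzv, cross_neg, cross_swap, neg_neg, hgy1]
  -- the edge created between `y` and `z`
  obtain ⟨r, ⟨hyr, hrz⟩, hr⟩ := exists_isDirection_of_cross_pos (w := dirVec y - dirVec g) hy hzr hyz
    (isCoprime_of_cross_eq_one_right (v := dirVec g) (by rw [cross_sub, hgy1, cross_self, sub_zero]))
    (by rw [cross_sub, cross_self, cross_swap, hgy1]; norm_num)
    (by rw [hzv, cross_neg, cross_swap, neg_neg, cross_sub, hgy1, cross_self]; norm_num)
  have hrr := hr.isRationalAngle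
  have hrv := hr.dirVec_eq
  have hxr : 0 < cross (dirVec x) (dirVec r) := by
    rw [hrv]
    refine cross_sub_pos (dirVec_isCoprime hx) hxg1 hgy1 hg ?_ hD
    have h1 : dirVec y - Q.mult (g : Angle n) • dirVec g = Q.left g - P.pos x := by
      rw [← hQpos, left]; abel
    rw [h1]
    exact (h.toIsCut.cross_left_nonneg hxg hgy).1
  have hrpi : r - x ≤ π := by
    by_contra h0
    have h1 := (cross_pos_iff hx _).mp hxr
    have h2 := detDir_dirVec_pos (t := x + π) hrr (by linarith) (by linarith)
    rw [detDir_add_pi] at h2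
    linarith
  -- the paths
  have hgQ : (singleEdge n g hgr).mult ≤ Q.mult := by
    rw [singleEdge, Finsupp.single_le_iff]
    exact Nat.one_le_iff_ne_zero.mpr hg
  set A := P.add (singleEdge n z hzr) with hA
  set B := Q.add (singleEdge n z hzr) with hB
  set C := (singleEdge n x hx).add (singleEdge n r hrr) with hC
  set D := Q.sub (singleEdge n g hgr) hgQ with hDdef
  have hAmult : ∀ φ, x ≤ φ → φ < x + 2 * π * n → A.mult (φ : Angle n) =
      (if φ = x then 1 else 0) + (if φ = y then 1 else 0) + if φ = z then 1 else 0 :=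
    fun φ h1 h2 => by
      rw [hA, add, Finsupp.add_apply, hPmult φ h1 h2,
        singleEdge_mult hzr (by linarith) hzT h1 h2]
  have hBmult : ∀ φ, x ≤ φ → φ < x + 2 * π * n → B.mult (φ : Angle n) =
      Q.mult (φ : Angle n) + if φ = z then 1 else 0 := fun φ h1 h2 => by
    rw [hB, add, Finsupp.add_apply, singleEdge_mult hzr (by linarith) hzT h1 h2]
  have hCmult : ∀ φ, x ≤ φ → φ < x + 2 * π * n → C.mult (φ : Angle n) =
      (if φ = x then 1 else 0) + if φ = r then 1 else 0 := fun φ h1 h2 => by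
    rw [hC, add, Finsupp.add_apply, singleEdge_mult hx le_rfl (by linarith) h1 h2,
      singleEdge_mult hrr (by linarith) (by linarith) h1 h2]
  have hDmult : ∀ φ, x ≤ φ → φ < x + 2 * π * n → D.mult (φ : Angle n) =
      Q.mult (φ : Angle n) - if φ = g then 1 else 0 := fun φ h1 h2 => by
    rw [hDdef, sub, Finsupp.tsub_apply, singleEdge_mult hgr (by linarith) (by linarith) h1 h2]
  have hApos : ∀ t, A.pos t = (singleEdge n x hx).pos t + (singleEdge n y hy).pos t +
    (singleEdge n z hzr).pos t := fun t => rfl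
  have hBpos : ∀ t, B.pos t = Q.pos t + (singleEdge n z hzr).pos t := fun t => rfl
  have hCpos : ∀ t, C.pos t = (singleEdge n x hx).pos t + (singleEdge n r hrr).pos t :=
    fun t => rfl
  have hDpos : ∀ t, D.pos t = Q.pos t - (singleEdge n g hgr).pos t := fun t => rfl
  have hPpos : ∀ t, P.pos t = (singleEdge n x hx).pos t + (singleEdge n y hy).pos t :=
    fun t => rfl
  have hQend : ∀ t, y ≤ t → t < x + 2 * π * n → Q.pos t = 0 := fun t h1 h2 => by
    rw [h.toIsCut.pos_eq h1 h2, hPpos, singleEdge_pos_of_mem_Ico hx (by linarith) h2,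
      singleEdge_pos_of_mem_Ico hy h1 (by linarith), add_zero]
  have hAend : ∀ t, z ≤ t → t < x + 2 * π * n → A.pos t = 0 := fun t h1 h2 => by
    rw [hApos, singleEdge_pos_of_mem_Ico hx (by linarith) h2,
      singleEdge_pos_of_mem_Ico hy (by linarith) (by linarith),
      singleEdge_pos_of_mem_Ico hzr (by linarith) (by linarith), add_zero, add_zero]
  have hDend : ∀ t, y ≤ t → t < x + 2 * π * n → D.pos t = 0 := fun t h1 h2 => by
    rw [hDpos, hQend t h1 h2, singleEdge_pos_of_mem_Ico hgr (by linarith) (by linarith), sub_zero]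
  have hQper : Q.period = dirVec x + dirVec y := h.period
  -- the corners
  have cA1 : A.IsCorner x y := by
    refine ⟨?_, ?_, hxy, hpi.le, fun φ hφ => ?_⟩ <;> rw [IsEdge]
    · rw [hAmult x le_rfl (by linarith), if_pos rfl]; omega
    · rw [hAmult y hxy.le (by linarith), if_pos rfl]; omega
    · rw [hAmult φ hφ.1.le (by linarith [hφ.2]), if_neg hφ.1.ne', if_neg hφ.2.ne,
        if_neg (hφ.2.trans hyz).ne]
      omega
  have cA2 : A.IsCorner y z := by
    refine ⟨cA1.edge_right, ?_, hyz, by linarith, fun φ hφ => ?_⟩ <;> rw [IsEdge]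
    · rw [hAmult z (by linarith) (by linarith), if_pos rfl]; omega
    · rw [hAmult φ (by linarith [hφ.1]) (by linarith [hφ.2]), if_neg (hxy.trans hφ.1).ne',
        if_neg hφ.1.ne', if_neg hφ.2.ne]
      omega
  have cB : B.IsCorner g z := by
    refine ⟨?_, ?_, by linarith, by linarith, fun φ hφ => ?_⟩ <;> rw [IsEdge]
    · rw [hBmult g hxg.le (by linarith), if_neg (hgy.trans hyz).ne]
      exact hg
    · rw [hBmult z (by linarith) hzT, if_pos rfl]; omega
    · rw [hBmult φ (by linarith [hφ.1]) (by linarith [hφ.2]), if_neg hφ.2.ne,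
        hQ0 φ hφ.1 (by linarith [hφ.2])]
      omega
  have cC : C.IsCorner x r := by
    refine ⟨?_, ?_, by linarith, hrpi, fun φ hφ => ?_⟩ <;> rw [IsEdge]
    · rw [hCmult x le_rfl (by linarith), if_pos rfl]; omega
    · rw [hCmult r (by linarith) (by linarith), if_pos rfl]; omega
    · rw [hCmult φ hφ.1.le (by linarith [hφ.2]), if_neg hφ.1.ne', if_neg hφ.2.ne]
      omega
  have rAB : IsRounding A x y B := (h.transfer cA1 fun t => by
    rw [hA, hB]; simp only [add]; abel).isRounding
  have rBD : IsRounding B g z D := by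
    have hcut : IsCut B g z D := by
      refine isCut_of_pos_eq cB ?_ (fun t h1 h2 => ?_) ?_ ?_
      · change Q.period - dirVec g = Q.period + dirVec z
        rw [hzv, sub_eq_add_neg]
      · rw [hBpos, hDpos, singleEdge_pos_of_mem_Ico hgr (by linarith) h2,
          singleEdge_pos_of_mem_Ico hzr h1 (by linarith), sub_zero, add_zero]
      · rw [hBmult g hxg.le (by linarith), hDmult g hxg.le (by linarith), if_pos rfl,
          if_neg (hgy.trans hyz).ne]
        have : Q.mult (g : Angle n) ≠ 0 := hg
        omega
      · rw [hBmult z (by linarith) hzT, hDmult z (by linarith) hzT, if_pos rfl,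
          if_neg (hgy.trans hyz).ne', hQ z hyz.le hzT]
    exact IsUnimodularCut.isRounding ⟨hcut, fun θ h1 h2 h3 =>
      absurd h3 (hcut.not_isEdge_of_eq_pi (by linarith) h1 h2)⟩
  have rAC : IsRounding A y z C := by
    refine IsUnimodularCut.isRounding ⟨isCut_of_pos_eq cA2 ?_ (fun t h1 h2 => ?_) ?_ ?_,
      fun θ h1 h2 h3 => ?_⟩
    · change dirVec x + dirVec r = dirVec x + dirVec y + dirVec z
      rw [hrv, hzv]; abel
    · rw [hApos, hCpos, singleEdge_pos_of_mem_Ico hrr (by linarith) (by linarith),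
        singleEdge_pos_of_mem_Ico hy (by linarith) h2,
        singleEdge_pos_of_mem_Ico hzr h1 (by linarith), add_zero, add_zero]
    · rw [hAmult y hxy.le (by linarith), hCmult y hxy.le (by linarith), if_pos rfl,
        if_neg hxy.ne', if_neg hyr.ne, if_neg hyz.ne]
    · rw [hAmult z (by linarith) hzT, hCmult z (by linarith) hzT, if_pos rfl,
        if_neg (hxy.trans hyz).ne', if_neg hrz.ne', if_neg hyz.ne']
    · have h4 : θ = r := by
        by_contra h4
        rw [IsEdge, hCmult θ (by linarith) (by linarith), if_neg (by linarith), if_neg h4] at h3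
        exact h3 rfl
      rw [h4, hCpos, hApos, singleEdge_pos_of_mem_Ico hx (by linarith) (by linarith),
        singleEdge_pos_of_mem_Ico hrr le_rfl (by linarith),
        singleEdge_pos_of_mem_Ico hx (by linarith) (by linarith),
        singleEdge_pos_of_mem_Ico hy le_rfl (by linarith),
        singleEdge_pos_of_lt hzr hyz (by linarith), hrv, hzv]
      simp only [add_zero, zero_add, neg_neg, zero_sub, cross_neg]
      rw [← cross_neg, cross_swap, neg_cross, neg_neg, cross_sub, hgy1, cross_self, sub_zero]
  have rCD : IsRounding C x r D := by
    refine IsUnimodularCut.isRounding ⟨isCut_of_pos_eq cC ?_ (fun t h1 h2 => ?_) ?_ ?_,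
      fun θ h1 h2 h3 => ?_⟩
    · change Q.period - dirVec g = dirVec x + dirVec r
      rw [hrv, hQper]; abel
    · rw [hDend t (by linarith) h2, hCpos, singleEdge_pos_of_mem_Ico hx (by linarith) h2,
        singleEdge_pos_of_mem_Ico hrr h1 (by linarith), add_zero]
    · rw [hDmult x le_rfl (by linarith), hCmult x le_rfl (by linarith), hQx, if_pos rfl,
        if_neg (hxy.trans hyr).ne, Nat.zero_sub]
    · rw [hDmult r (by linarith) (by linarith), hCmult r (by linarith) (by linarith),
        hQ r hyr.le (by linarith), if_pos rfl, if_neg (hxy.trans hyr).ne', Nat.zero_sub]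
    · have h4 : Q.IsEdge θ := fun h0 => h3 (by
        rw [hDmult θ h1.le (by linarith), h0, Nat.zero_sub])
      have h5 : θ ≤ g := le_of_not_gt fun h5 => h4 (hQ0 θ h5 (by linarith))
      have h6 := h.unimodular θ h1 (by linarith) h4
      rw [hPpos, singleEdge_pos_of_mem_Ico hx le_rfl (by linarith),
        singleEdge_pos_of_lt hy hxy (by linarith)] at h6
      rw [hCpos, hDpos, singleEdge_pos_of_mem_Ico hx le_rfl (by linarith),
        singleEdge_pos_of_lt hrr (by linarith) (by linarith), hrv, ← h6]
      rcases h5.eq_or_lt with rfl | h5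
      · rw [singleEdge_pos_of_mem_Ico hgr le_rfl (by linarith)]
        simp only [cross_sub, cross_add, cross_neg, cross_self, cross_zero]
        ring
      · rw [singleEdge_pos_of_lt hgr h5 (by linarith)]
        congr 1; abel
  refine ⟨g, r, z, A, B, C, D, hxg, hgy, hyr, hrz, rfl, hzT, fun η hη => ?_, rfl, rfl, rfl, ?_, ?_,
    rAB, rBD, rAC, rCD, hyz1, ?_, fun R hR hDR => ?_⟩
  · obtain ⟨θ, rfl, h1, h2⟩ := exists_coe_eq_mem_Ico x η
    rw [Finsupp.mem_support_iff] at hη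
    refine ⟨θ, lt_of_le_of_ne h1 ?_, le_of_not_gt fun h3 => hη (hQ0 θ h3 h2), rfl⟩
    rintro rfl
    exact hη hQx
  · exact tsub_add_cancel_of_le hgQ
  · intro t
    rw [hA, hB]; simp only [add]; abel
  · rw [hrv, cross_sub]; omega
  · have hlt := hR.corner.lt
    have hle := hR.corner.le_pi
    have hzero : ∀ t, z ≤ t → t < x + 2 * π * n → detDir t (R.pos t) = 0 := fun t h1 h2 => by
      have h3 := hR.isLeftOf t
      have h4 := hDR t
      rw [hAend t h1 h2, sub_zero] at h3
      rw [hDend t (by linarith) h2, zero_sub, detDir_neg] at h4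
      linarith
    obtain ⟨ε, hε, hB, e⟩ := R.exists_isolating z (sub_pos.mpr hlt)
    have h3 := hzero (z + ε) (by linarith) (by linarith)
    rw [R.pos_eq_of_not_isEdge (s := z) (t := z + ε) (by linarith)
      fun φ h4 h5 => e φ (by linarith) h5 h4.ne'] at h3
    refine hR.pos_ne le_rfl hlt ?_
    rw [hAend z le_rfl hlt]
    exact eq_zero_of_detDir_eq_zero (by linarith) (by linarith) (hzero z le_rfl hlt) h3

end AdmissiblePath

/-! ### The relation from a square -/

theorem coe_notMem_arc_of_lt {a b θ : ℝ} (h1 : θ < a) (h2 : b < θ + 2 * π * n) :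
    (θ : Angle n) ∉ arc n a b := fun h => by
  have hT : (0 : ℝ) < 2 * π * n := (instFactAngle n).out
  obtain ⟨k, hk1, hk2⟩ := mem_arc_iff.mp h
  rcases le_or_gt k 0 with hk | hk
  · have : (k : ℝ) ≤ 0 := by exact_mod_cast hk
    nlinarith
  · have : (1 : ℝ) ≤ k := by exact_mod_cast hk
    nlinarith

theorem coe_notMem_arc_of_gt {a b θ : ℝ} (hab : a ≤ b) (h1 : b < θ) (h2 : θ < a + 2 * π * n) :
    (θ : Angle n) ∉ arc n a b := fun h =>
  absurd ((mem_arc_iff_of_mem_Ico (h1.trans h2) (hab.trans h1.le) h2).mp h) (not_le.mpr h1)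

/-- A term of the combinatorial differential, with respect to any lift of the corner. -/
theorem IsDeltaTerm.of_isRounding {α β : Generator n} {a b θ₁ θ₂ : ℝ} {s : ℤ}
    (h : IsDeltaTerm α β a b s) (hR : IsRounding α.path θ₁ θ₂ β.path) :
    IsDeltaTerm α β θ₁ θ₂ s := by
  obtain ⟨k, rfl, rfl⟩ := h.1.corner_unique hR
  exact h.add_int_mul k

/-- Given the labels before a rounding, the labels after it depend only on the choice of the edge
labeled `h` in the corner, if there is one. -/
theorem IsDeltaTerm.order_perm {α β γ : Generator n} {θ₁ θ₂ : ℝ} {s t : ℤ}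
    (h : IsDeltaTerm α β θ₁ θ₂ s) (h' : IsDeltaTerm α γ θ₁ θ₂ t)
    (heq : ∀ η ∈ β.order, ∀ ζ ∈ γ.order, η ∈ arc n θ₁ θ₂ → ζ ∈ arc n θ₁ θ₂ → η = ζ) :
    β.order.Perm γ.order := by
  obtain ⟨hR, r, l, l', c, hr, hc, h1, h2, -⟩ := isDeltaTerm_iff.mp h
  obtain ⟨-, r', m, m', e, hr', he, h1', h2', -⟩ := isDeltaTerm_iff.mp h'
  have hlt := hR.corner.lt.le
  have hcm := hc.mem_arc hlt
  have hem := he.mem_arc hlt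
  obtain ⟨hp1, hp2⟩ := perm_of_append_perm_append (h1.symm.trans h1') hr hr' hcm.1 hem.1
  have key : l' = m' → β.order.Perm γ.order := by
    rintro rfl
    exact h2.trans ((hp1.append_right _).trans h2'.symm)
  refine key ?_
  have hlen := hp2.length_eq
  rcases hc with ⟨rfl, rfl, -⟩ | ⟨rfl, rfl, -⟩ | ⟨η, hη, rfl, rfl, -⟩ <;>
    rcases he with ⟨rfl, rfl, -⟩ | ⟨rfl, rfl, -⟩ | ⟨ζ, hζ, rfl, rfl, -⟩ <;>
    first
    | rfl
    | rw [heq η (h2.mem_iff.mpr (by simp)) ζ (h2'.mem_iff.mpr (by simp)) hη hζ]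
    | exact absurd hlen (by simp)

/-- An `h` edge outside the corner is not affected by a rounding. -/
theorem IsDeltaTerm.mem_order_iff {α β : Generator n} {θ₁ θ₂ : ℝ} {s : ℤ}
    (h : IsDeltaTerm α β θ₁ θ₂ s) {η : Angle n} (hη : η ∉ arc n θ₁ θ₂) :
    η ∈ α.order ↔ η ∈ β.order := by
  obtain ⟨hR, r, l, l', c, hr, hc, h1, h2, -⟩ := isDeltaTerm_iff.mp h
  have hcm := hc.mem_arc hR.corner.lt.le
  rw [h1.mem_iff, h2.mem_iff, List.mem_append, List.mem_append,
    or_iff_left fun h => hη (hcm.1 _ h), or_iff_left fun h => hη (hcm.2 _ h)]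

/-- The ordering of the `h` edges of a path replaced by another one. -/
def Generator.reorder (α : Generator n) (o : List (Angle n)) (h : α.order.Perm o) :
    Generator n where
  path := α.path
  order := o
  nodup := h.nodup_iff.mp α.nodup
  edges θ hθ := α.edges θ (h.mem_iff.mpr hθ)

namespace AdmissiblePath.IsSquare

variable {P Q A B C D : AdmissiblePath n} {x g y r z : ℝ}

theorem mem_support_C (h : IsSquare P Q x g y r z A B C D) {η : Angle n}
    (hη : η ∈ C.mult.support) : η = (x : Angle n) ∨ η = (r : Angle n) := by
  by_contra hcon
  push Not at hcon
  rw [Finsupp.mem_support_iff, h.mult_C, Finsupp.add_apply, Finsupp.single_eq_of_ne hcon.1,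
    Finsupp.single_eq_of_ne hcon.2] at hη
  exact hη rfl

theorem mem_support_A (h : IsSquare P Q x g y r z A B C D) {η : Angle n} :
    η ∈ A.mult.support ↔ η = (x : Angle n) ∨ η = (y : Angle n) ∨ η = (z : Angle n) := by
  rw [Finsupp.mem_support_iff, h.mult_A, Finsupp.add_apply, Finsupp.add_apply,
    Finsupp.single_apply, Finsupp.single_apply, Finsupp.single_apply]
  by_cases h1 : (x : Angle n) = η <;> by_cases h2 : (y : Angle n) = η <;>
    by_cases h3 : (z : Angle n) = η <;> simp [h1, h2, h3, eq_comm (a := η)]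

theorem mem_support_B (h : IsSquare P Q x g y r z A B C D) {η : Angle n} :
    η ∈ B.mult.support ↔ η ∈ Q.mult.support ∨ η = (z : Angle n) := by
  rw [Finsupp.mem_support_iff, Finsupp.mem_support_iff, h.mult_B, Finsupp.add_apply,
    Finsupp.single_apply]
  by_cases h3 : (z : Angle n) = η <;> simp [h3, eq_comm (a := η)]

theorem mem_support_D (h : IsSquare P Q x g y r z A B C D) {η : Angle n}
    (hη : η ∈ Q.mult.support) (hg : η ≠ (g : Angle n)) : η ∈ D.mult.support := by
  rw [Finsupp.mem_support_iff] at hη ⊢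
  rwa [← h.mult_D, Finsupp.add_apply, Finsupp.single_eq_of_ne hg, add_zero] at hη

theorem x_notMem_arc (h : IsSquare P Q x g y r z A B C D) : (x : Angle n) ∉ arc n y z :=
  coe_notMem_arc_of_lt (by linarith [h.lt_xg, h.lt_gy]) h.lt_period

theorem z_notMem_arc (h : IsSquare P Q x g y r z A B C D) : (z : Angle n) ∉ arc n x y :=
  coe_notMem_arc_of_gt (by linarith [h.lt_xg, h.lt_gy]) (by linarith [h.lt_yr, h.lt_rz])
    h.lt_period

theorem eq_or_notMem_arc (h : IsSquare P Q x g y r z A B C D) {η : Angle n}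
    (hη : η ∈ Q.mult.support) : η = (g : Angle n) ∨ η ∉ arc n g z := by
  obtain ⟨θ, h1, h2, rfl⟩ := h.edges η hη
  rcases h2.eq_or_lt with rfl | h2
  · exact Or.inl rfl
  · exact Or.inr (coe_notMem_arc_of_lt h2 (by linarith [h.lt_period]))

theorem ne_z (h : IsSquare P Q x g y r z A B C D) {η : Angle n} (hη : η ∈ arc n x y) :
    η ≠ (z : Angle n) := fun h' => h.z_notMem_arc (h' ▸ hη)

end AdmissiblePath.IsSquare

/-- The only intermediate generators between those at the ends of a square are the two at its other
corners: the third corner of the path at its beginning cannot be rounded, and the labels of the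
intermediate generators are determined by those at the ends. -/
theorem diffCoeff_square {d : Chain n →ₗ[AddMonoidAlgebra ℤ (ℤ × ℤ)] Chain n} (hd : d ∘ₗ d = 0)
    (hclass : ∀ α β : Generator n, diffCoeff d α β ≠ 0 → ∃ a b s, IsDeltaTerm α β a b s)
    {P Q : AdmissiblePath n} {x g y r z : ℝ} {γ σ τ δ : Generator n}
    (h : IsSquare P Q x g y r z γ.path σ.path τ.path δ.path) {s₁ s₂ s₃ : ℤ}
    (h₁ : IsDeltaTerm γ σ x y s₁) (h₂ : IsDeltaTerm σ δ g z s₂) (h₃ : IsDeltaTerm γ τ y z s₃) :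
    diffCoeff d γ σ * diffCoeff d σ δ + diffCoeff d γ τ * diffCoeff d τ δ = 0 := by
  have hxg := h.lt_xg
  have hgy := h.lt_gy
  have hyr := h.lt_yr
  have hrz := h.lt_rz
  have hT := h.lt_period
  refine diffCoeff_add_eq_zero d hd (fun h0 => ?_) fun ρ hρ1 hρ2 => ?_
  · have h1 := (perm_of_labeled_eq h0).1
    have h2 : (x : Angle n) ∈ σ.path.mult.support := by
      rw [h1, Finsupp.mem_support_iff, h.mult_C, Finsupp.add_apply, Finsupp.single_eq_same]
      omega
    rcases h.mem_support_B.mp h2 with h3 | h3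
    · obtain ⟨θ, h4, h5, h6⟩ := h.edges _ h3
      exact h4.ne' (eq_of_coe_eq_coe (a := x) h6 h4.le (by linarith) le_rfl (by linarith))
    · exact h.x_notMem_arc (h3 ▸ ⟨z, ⟨by linarith, le_rfl⟩, rfl⟩)
  · obtain ⟨a, b, s, hs⟩ := hclass _ _ hρ1
    obtain ⟨a', b', s', hs'⟩ := hclass _ _ hρ2
    -- normalize the lift of the rounded corner
    obtain ⟨k, hk⟩ : ∃ k : ℤ, a + k * (2 * π * n) = x ∨ a + k * (2 * π * n) = y ∨
        a + k * (2 * π * n) = z := by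
      rcases h.mem_support_A.mp (isEdge_iff_mem_support.mp hs.1.corner.edge_left) with h1 | h1 | h1
      · obtain ⟨k, hk⟩ := coe_eq_coe_iff.mp h1
        exact ⟨k, Or.inl hk.symm⟩
      · obtain ⟨k, hk⟩ := coe_eq_coe_iff.mp h1
        exact ⟨k, Or.inr (Or.inl hk.symm)⟩
      · obtain ⟨k, hk⟩ := coe_eq_coe_iff.mp h1
        exact ⟨k, Or.inr (Or.inr hk.symm)⟩
    have hs := hs.add_int_mul k
    generalize b + k * (2 * π * n) = b at hs
    -- the next edge after a given one
    have next : ∀ {u v w : ℝ}, γ.path.IsCorner u v → γ.path.IsEdge w → u < w →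
        (∀ θ ∈ Set.Ioo u w, ¬ γ.path.IsEdge θ) → v = w := fun {u v w} hc hw huw hcon => by
      rcases lt_trichotomy v w with h1 | h1 | h1
      · exact absurd hc.edge_right (hcon _ ⟨hc.lt, h1⟩)
      · exact h1
      · exact absurd hw (hc.consecutive _ ⟨huw, h1⟩)
    have cxy := h.rounding_AB.corner
    have cyz := h.rounding_AC.corner
    rcases hk with hk | hk | hk <;> rw [hk] at hs
    · left
      rw [next hs.1.corner cxy.edge_right cxy.lt cxy.consecutive] at hs
      have hpath : ρ.path = σ.path := hs.1.unique h.rounding_AB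
      have hs' := hs'.of_isRounding (hpath ▸ h.rounding_BD)
      refine labeled_eq_of_perm hpath (hs.order_perm h₁ fun η hη ζ hζ h1 h2 => ?_)
      have hη' := (h.mem_support_B.mp (hpath ▸ ρ.edges η hη)).resolve_right (h.ne_z h1)
      have hζ' := (h.mem_support_B.mp (σ.edges ζ hζ)).resolve_right (h.ne_z h2)
      obtain ⟨-, q, l, l', c, hq, hc, p1, p2, -⟩ := isDeltaTerm_iff.mp hs
      obtain ⟨-, q', m, m', e, hq', he, p1', p2', -⟩ := isDeltaTerm_iff.mp h₁
      -- at most one `h` edge in the corner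
      have one : ∀ {l l' : List (Angle n)} {c : ℤ}, LabelChange n x y l l' c →
          ∀ u ∈ l', ∀ v ∈ l', u = v := by
        rintro _ _ _ (⟨rfl, rfl, -⟩ | ⟨rfl, rfl, -⟩ | ⟨ξ, -, rfl, rfl, -⟩) u hu v hv
        · exact absurd hu List.not_mem_nil
        · exact absurd hu List.not_mem_nil
        · rw [List.mem_singleton.mp hu, List.mem_singleton.mp hv]
      have inl : ∀ {ω : Generator n} {q l' : List (Angle n)}, ω.order.Perm (q ++ l') →
          (∀ u ∈ q, u ∉ arc n x y) → ∀ u ∈ ω.order, u ∈ arc n x y → u ∈ l' :=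
        fun hp hq u hu hu' => by
          rw [hp.mem_iff, List.mem_append] at hu
          exact hu.resolve_left fun h => hq u h hu'
      rcases h.eq_or_notMem_arc hη' with hηg | hηg
      · rcases h.eq_or_notMem_arc hζ' with hζg | hζg
        · rw [hηg, hζg]
        · have : ζ ∈ ρ.order := (hs'.mem_order_iff hζg).mpr ((h₂.mem_order_iff hζg).mp hζ)
          exact one hc _ (inl p2 hq _ hη h1) _ (inl p2 hq _ this h2)
      · have : η ∈ σ.order := (h₂.mem_order_iff hηg).mpr ((hs'.mem_order_iff hηg).mp hη)
        exact one he _ (inl p2' hq' _ this h1) _ (inl p2' hq' _ hζ h2)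
    · right
      rw [next hs.1.corner cyz.edge_right cyz.lt cyz.consecutive] at hs
      have hpath : ρ.path = τ.path := hs.1.unique h.rounding_AC
      refine labeled_eq_of_perm hpath (hs.order_perm h₃ fun η hη ζ hζ h1 h2 => ?_)
      rcases h.mem_support_C (hpath ▸ ρ.edges η hη) with h3 | h3
      · exact absurd (h3 ▸ h1) h.x_notMem_arc
      · rcases h.mem_support_C (τ.edges ζ hζ) with h4 | h4
        · exact absurd (h4 ▸ h2) h.x_notMem_arc
        · rw [h3, h4]
    · exfalso
      have hb : b = x + 2 * π * n := by
        have e : x + 2 * π * n = x + (1 : ℤ) * (2 * π * n) := by push_cast; ring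
        refine next hs.1.corner ?_ hT fun θ hθ he => ?_
        · rw [e, isEdge_add_int_mul]; exact cxy.edge_left
        · rcases h.mem_support_A.mp (isEdge_iff_mem_support.mp he) with h1 | h1 | h1
          · exact absurd (eq_of_coe_eq_coe (a := x) h1 (by linarith [hθ.1]) hθ.2 le_rfl
              (by linarith)) (by linarith [hθ.1])
          · exact absurd (eq_of_coe_eq_coe (a := x) h1 (by linarith [hθ.1]) hθ.2 (by linarith)
              (by linarith)) (by linarith [hθ.1])
          · exact hθ.1.ne' (eq_of_coe_eq_coe (a := x) h1 (by linarith [hθ.1]) hθ.2 (by linarith) hT)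
      rw [hb] at hs
      exact h.not_rounding _ hs.1 hs'.1.isLeftOf

/-! ### Coefficients of roundings -/

theorem reorderSign_pair {a b : Angle n} (h : a ≠ b) : reorderSign [a, b] [b, a] = -1 :=
  reorderSign_swap [] [] h

theorem reorderSign_rotate {a b c : Angle n} (hab : a ≠ b) (hac : a ≠ c) :
    reorderSign [a, b, c] [b, c, a] = 1 := by
  have h1 : orderSign [a, b, c] = -orderSign [b, a, c] := orderSign_swap [] [c] hab
  have h2 : orderSign [b, a, c] = -orderSign [b, c, a] := orderSign_swap [b] [] hac
  rw [reorderSign, h1, h2, neg_neg, orderSign_mul_self]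

section Induction

variable {d : Chain n →ₗ[AddMonoidAlgebra ℤ (ℤ × ℤ)] Chain n}

theorem diffCoeff_of_half_turn (hdeg : AxiomDegenerateRounding d) {α β : Generator n}
    {θ₁ θ₂ : ℝ} {s : ℤ} (h : IsDeltaTerm α β θ₁ θ₂ s) (hpi : θ₂ - θ₁ = π) :
    diffCoeff d α β = s := by
  rw [hdeg α β ⟨θ₁, θ₂, ⟨s, h⟩, hpi⟩, h.deltaCoeff_eq]

theorem diffCoeff_of_cross_eq_one (hsimple : AxiomSimpleRounding d) {α β : Generator n}
    {θ₁ θ₂ : ℝ} {s : ℤ} (h : IsDeltaTerm α β θ₁ θ₂ s)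
    (hD : cross (dirVec θ₁) (dirVec θ₂) = 1) : diffCoeff d α β = s := by
  rw [hsimple α β ⟨θ₁, θ₂, ⟨s, h⟩, h.1.isUnimodularCut.exists_unique_edge hD⟩, h.deltaCoeff_eq]

/-- The coefficient for the rounding of a path with two edges, given the coefficients for roundings
of smaller determinant: it is determined by the relation from a square. -/
theorem diffCoeff_of_isSquare (hd : d ∘ₗ d = 0)
    (hclass : ∀ α β : Generator n, diffCoeff d α β ≠ 0 → ∃ a b s, IsDeltaTerm α β a b s)
    (hloc : AxiomLocality d) (hsimple : AxiomSimpleRounding d)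
    (hdeg : AxiomDegenerateRounding d) {α β : Generator n} {x g y r z : ℝ}
    {A B C D : AdmissiblePath n} (h : IsSquare α.path β.path x g y r z A B C D)
    (hα : α.path.mult = Finsupp.single (x : Angle n) 1 + Finsupp.single (y : Angle n) 1)
    (ih : ∀ (τ δ : Generator n) (s : ℤ), IsDeltaTerm τ δ x r s → diffCoeff d τ δ = s)
    {c : ℤ} (hc : LabelChange n x y α.order β.order c) : diffCoeff d α β = c := by
  have hxg := h.lt_xg
  have hgy := h.lt_gy
  have hyr := h.lt_yr
  have hrz := h.lt_rz
  have hT := h.lt_period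
  -- the relation, for generators with the paths of the square
  have rel : ∀ (γ σ τ δ : Generator n) (L : List (Angle n)), γ.path = A → σ.path = B →
      τ.path = C → δ.path = D → γ.order = L ++ α.order → σ.order = L ++ β.order →
      (∀ η ∈ L, η ∉ arc n x y) → ∀ s₂ s₃ s₄ : ℤ, IsDeltaTerm σ δ g z s₂ →
      IsDeltaTerm γ τ y z s₃ → IsDeltaTerm τ δ x r s₄ →
      diffCoeff d α β * s₂ + s₃ * s₄ = 0 := by
    rintro γ σ τ δ L rfl rfl rfl rfl h1 h2 hL s₂ s₃ s₄ t₂ t₃ t₄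
    have t₁ : IsDeltaTerm γ σ x y c := isDeltaTerm_of_order h.rounding_AB hL hc
      (h1 ▸ List.Perm.refl _) h2 (by rw [h1, reorderSign_self, mul_one])
    have := diffCoeff_square hd hclass h t₁ t₂ t₃
    rwa [diffCoeff_eq_of_reduction hloc t₁ hα h.pos_sub (fun η hη => Or.inl (hL η hη)) h1 h2,
      diffCoeff_of_half_turn hdeg t₂ (by linarith [h.z_eq]),
      diffCoeff_of_cross_eq_one hsimple t₃ h.cross_AC, ih _ _ _ t₄] at this
  have ne : ∀ {u v : ℝ}, x ≤ u → u < v → v < x + 2 * π * n → (u : Angle n) ≠ (v : Angle n) :=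
    fun h1 h2 h3 h4 => h2.ne (eq_of_coe_eq_coe (a := x) h4 h1 (h2.trans h3) (h1.trans h2.le) h3)
  have xy := ne le_rfl (hxg.trans hgy) (by linarith)
  have xz := ne le_rfl (show x < z by linarith) hT
  have yz := ne (show x ≤ y by linarith) (show y < z by linarith) hT
  have xr := ne le_rfl (show x < r by linarith) (by linarith)
  have xA : (x : Angle n) ∈ A.mult.support := h.mem_support_A.mpr (Or.inl rfl)
  have yA : (y : Angle n) ∈ A.mult.support := h.mem_support_A.mpr (Or.inr (Or.inl rfl))
  have zA : (z : Angle n) ∈ A.mult.support := h.mem_support_A.mpr (Or.inr (Or.inr rfl))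
  have zB : (z : Angle n) ∈ B.mult.support := h.mem_support_B.mpr (Or.inr rfl)
  have xC : (x : Angle n) ∈ C.mult.support :=
    isEdge_iff_mem_support.mp h.rounding_CD.corner.edge_left
  have rC : (r : Angle n) ∈ C.mult.support :=
    isEdge_iff_mem_support.mp h.rounding_CD.corner.edge_right
  have rarc : (r : Angle n) ∈ arc n y z := ⟨r, ⟨hyr.le, hrz.le⟩, rfl⟩
  have xarc := h.x_notMem_arc
  have zarc := h.z_notMem_arc
  rcases hc with ⟨hl, hl', rfl⟩ | ⟨hl, hl', rfl⟩ | ⟨η, hη, hl, hl', rfl⟩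
  · -- only `x` is labeled `h`
    have := rel
      ⟨A, [(z : Angle n), (x : Angle n)], by simp [xz.symm],
        by simp [-Finsupp.mem_support_iff, zA, xA]⟩
      ⟨B, [(z : Angle n)], by simp, by simp [-Finsupp.mem_support_iff, zB]⟩
      ⟨C, [(x : Angle n)], by simp, by simp [-Finsupp.mem_support_iff, xC]⟩
      ⟨D, [], by simp, by simp⟩ [(z : Angle n)] rfl rfl rfl rfl (by simp [hl]) (by simp [hl'])
      (by simpa using zarc) 1 (-1) (-1)
      (isDeltaTerm_of_order (r := []) h.rounding_BD (by simp) (Or.inr (Or.inl ⟨rfl, rfl, rfl⟩))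
        (List.Perm.refl _) rfl (by rw [List.nil_append, reorderSign_self]; rfl))
      (isDeltaTerm_of_order (r := [(x : Angle n)]) h.rounding_AC (by simpa using xarc)
        (Or.inr (Or.inl ⟨rfl, rfl, rfl⟩)) (List.Perm.swap _ _ _) rfl
        (by rw [List.singleton_append, reorderSign_pair xz.symm]; rfl))
      (isDeltaTerm_of_order (r := []) h.rounding_CD (by simp) (Or.inl ⟨rfl, rfl, rfl⟩)
        (List.Perm.refl _) rfl (by rw [List.nil_append, reorderSign_self]; rfl))
    linarith
  · -- only `y` is labeled `h`
    have := rel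
      ⟨A, [(z : Angle n), (y : Angle n)], by simp [yz.symm],
        by simp [-Finsupp.mem_support_iff, zA, yA]⟩
      ⟨B, [(z : Angle n)], by simp, by simp [-Finsupp.mem_support_iff, zB]⟩
      ⟨C, [(r : Angle n)], by simp, by simp [-Finsupp.mem_support_iff, rC]⟩
      ⟨D, [], by simp, by simp⟩ [(z : Angle n)] rfl rfl rfl rfl (by simp [hl]) (by simp [hl'])
      (by simpa using zarc) 1 (-1) 1
      (isDeltaTerm_of_order (r := []) h.rounding_BD (by simp) (Or.inr (Or.inl ⟨rfl, rfl, rfl⟩))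
        (List.Perm.refl _) rfl (by rw [List.nil_append, reorderSign_self]; rfl))
      (isDeltaTerm_of_order (r := []) h.rounding_AC (by simp)
        (Or.inr (Or.inr ⟨_, rarc, rfl, rfl, rfl⟩)) (List.Perm.swap _ _ _) rfl
        (by rw [List.nil_append, reorderSign_pair yz.symm]; rfl))
      (isDeltaTerm_of_order (r := []) h.rounding_CD (by simp) (Or.inr (Or.inl ⟨rfl, rfl, rfl⟩))
        (List.Perm.refl _) rfl (by rw [List.nil_append, reorderSign_self]; rfl))
    linarith
  · have hηQ : η ∈ β.path.mult.support := β.edges η (by simp [hl'])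
    have hηz := h.ne_z hη
    have hηB : η ∈ B.mult.support := h.mem_support_B.mpr (Or.inl hηQ)
    by_cases hηg : η = (g : Angle n)
    · -- the last edge is labeled `h`, and is removed together with the auxiliary one
      subst hηg
      have := rel
        ⟨A, [(x : Angle n), (y : Angle n)], by simp [xy],
          by simp [-Finsupp.mem_support_iff, xA, yA]⟩
        ⟨B, [(g : Angle n)], by simp, by simp [-Finsupp.mem_support_iff, hηB]⟩
        ⟨C, [(x : Angle n)], by simp, by simp [-Finsupp.mem_support_iff, xC]⟩
        ⟨D, [], by simp, by simp⟩ [] rfl rfl rfl rfl (by simp [hl]) (by simp [hl'])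
        (by simp) (-1) (-1) (-1)
        (isDeltaTerm_of_order (r := []) h.rounding_BD (by simp) (Or.inl ⟨rfl, rfl, rfl⟩)
          (List.Perm.refl _) rfl (by rw [List.nil_append, reorderSign_self]; rfl))
        (isDeltaTerm_of_order (r := [(x : Angle n)]) h.rounding_AC (by simpa using xarc)
          (Or.inl ⟨rfl, rfl, rfl⟩) (List.Perm.refl _) rfl
          (by rw [List.singleton_append, reorderSign_self]; rfl))
        (isDeltaTerm_of_order (r := []) h.rounding_CD (by simp) (Or.inl ⟨rfl, rfl, rfl⟩)
          (List.Perm.refl _) rfl (by rw [List.nil_append, reorderSign_self]; rfl))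
      linarith
    · have hηarc := (h.eq_or_notMem_arc hηQ).resolve_left hηg
      have hηxr : η ∈ arc n x r := by
        obtain ⟨θ, h1, h2, rfl⟩ := h.edges η hηQ
        exact ⟨θ, ⟨h1.le, by linarith⟩, rfl⟩
      have hηD := h.mem_support_D hηQ hηg
      have := rel ⟨A, [(z : Angle n), (x : Angle n), (y : Angle n)],
          by simp [xz.symm, yz.symm, xy], by simp [-Finsupp.mem_support_iff, zA, xA, yA]⟩
        ⟨B, [(z : Angle n), η], by simp [hηz.symm], by simp [-Finsupp.mem_support_iff, zB, hηB]⟩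
        ⟨C, [(x : Angle n), (r : Angle n)], by simp [xr],
          by simp [-Finsupp.mem_support_iff, xC, rC]⟩
        ⟨D, [η], by simp, by simp [-Finsupp.mem_support_iff, hηD]⟩ [(z : Angle n)] rfl rfl rfl rfl
        (by simp [hl]) (by simp [hl']) (by simpa using zarc) (-1) 1 1
        (isDeltaTerm_of_order (r := [η]) h.rounding_BD (by simpa using hηarc)
          (Or.inr (Or.inl ⟨rfl, rfl, rfl⟩)) (List.Perm.swap _ _ _) rfl
          (by rw [List.singleton_append, reorderSign_pair hηz.symm]; rfl))
        (isDeltaTerm_of_order (r := [(x : Angle n)]) h.rounding_AC (by simpa using xarc)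
          (Or.inr (Or.inr ⟨_, rarc, rfl, rfl, rfl⟩))
          ((List.Perm.swap _ _ _).trans ((List.Perm.swap _ _ _).cons _)) rfl
          (by rw [List.singleton_append, reorderSign_rotate xz.symm yz.symm]; rfl))
        (isDeltaTerm_of_order (r := []) h.rounding_CD (by simp)
          (Or.inr (Or.inr ⟨η, hηxr, rfl, rfl, rfl⟩)) (List.Perm.refl _) rfl
          (by rw [List.nil_append, reorderSign_self]; rfl))
      linarith

/-- The coefficient for a rounding. The proof is by induction on the determinant of the two edges;
locality reduces the rounding to that of a path consisting only of these edges. -/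
theorem diffCoeff_of_isDeltaTerm (hd : d ∘ₗ d = 0)
    (hclass : ∀ α β : Generator n, diffCoeff d α β ≠ 0 → ∃ a b s, IsDeltaTerm α β a b s)
    (hloc : AxiomLocality d) (hsimple : AxiomSimpleRounding d)
    (hdeg : AxiomDegenerateRounding d) {α β : Generator n} {x y : ℝ} {s : ℤ}
    (h : IsDeltaTerm α β x y s) : diffCoeff d α β = s := by
  induction hN : (cross (dirVec x) (dirVec y)).toNat using Nat.strong_induction_on
    generalizing α β x y s with
  | _ N ih =>
  obtain ⟨hR, q, l, l', c, hq, hc, h1, h2, hs⟩ := isDeltaTerm_iff.mp h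
  have hcorner := hR.corner
  have hx := hcorner.edge_left.isRationalAngle
  have hy := hcorner.edge_right.isRationalAngle
  have hxy := hcorner.lt
  have hxyT := hcorner.lt_add_period
  rcases hcorner.le_pi.eq_or_lt with hpi | hpi
  · exact diffCoeff_of_half_turn hdeg h hpi
  have hpos := cross_dirVec_pos hx hy hxy (by linarith)
  by_cases hD1 : cross (dirVec x) (dirVec y) = 1
  · exact diffCoeff_of_cross_eq_one hsimple h hD1
  have hD : 2 ≤ cross (dirVec x) (dirVec y) := by omega
  -- the path with two edges, and its rounding
  set P := (singleEdge n x hx).add (singleEdge n y hy) with hP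
  have hPm : P.mult = Finsupp.single (x : Angle n) 1 + Finsupp.single (y : Angle n) 1 := rfl
  set Q := (P.add β.path).sub α.path hR.isCut.mult_le with hQ
  have hPQ : ∀ t, Q.pos t - P.pos t = β.path.pos t - α.path.pos t := fun t => by
    rw [hQ]; simp only [sub, add]; abel
  have hPc : P.IsCorner x y := by
    refine ⟨?_, ?_, hxy, hpi.le, fun θ hθ => ?_⟩ <;> rw [IsEdge, hPm, Finsupp.add_apply]
    · rw [Finsupp.single_eq_same]; omega
    · rw [Finsupp.single_eq_same]; omega
    · rw [Finsupp.single_eq_of_ne fun h => hθ.1.ne' (eq_of_coe_eq_coe (a := x) h hθ.1.le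
          (hθ.2.trans hxyT) le_rfl (hxy.trans hxyT)),
        Finsupp.single_eq_of_ne fun h => hθ.2.ne (eq_of_coe_eq_coe (a := x) h hθ.1.le
          (hθ.2.trans hxyT) hxy.le hxyT)]
      omega
  have hcut := hR.isUnimodularCut.transfer hPc hPQ
  obtain ⟨g, r, z, A, B, C, D, hsq⟩ := exists_isSquare hx hy hcut hD
  have hxP : (x : Angle n) ∈ P.mult.support := isEdge_iff_mem_support.mp hPc.edge_left
  have hyP : (y : Angle n) ∈ P.mult.support := isEdge_iff_mem_support.mp hPc.edge_right
  have hxry : ∀ (τ δ : Generator n) (s : ℤ), IsDeltaTerm τ δ x r s → diffCoeff d τ δ = s :=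
    fun τ δ s hs => ih _ (by
      have := hsq.cross_CD
      omega) hs rfl
  -- the coefficient when the common `h` edges come first
  have key : ∀ (σ τ : Generator n) (L m m' : List (Angle n)) (e : ℤ), σ.path = α.path →
      τ.path = β.path → α.order.Perm σ.order → β.order.Perm τ.order → σ.order = L ++ m →
      τ.order = L ++ m' → (∀ η ∈ L, η ∉ arc n x y ∨ η = (x : Angle n) ∨ η = (y : Angle n)) →
      LabelChange n x y m m' e → (∀ η ∈ m', η ∈ Q.mult.support) →
      diffCoeff d α β = e * (reorderSign α.order (L ++ m) * reorderSign β.order (L ++ m')) := by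
    intro σ τ L m m' e hσ hτ hασ hβτ hσo hτo hL he hm'
    have hmP : ∀ η ∈ m, η ∈ P.mult.support := by
      rcases he with ⟨rfl, -, -⟩ | ⟨rfl, -, -⟩ | ⟨-, -, rfl, -, -⟩ <;>
        simp [-Finsupp.mem_support_iff, hxP, hyP]
    have hmn : m.Nodup := (List.nodup_append.mp (hσo ▸ σ.nodup)).2.1
    have hmn' : m'.Nodup := (List.nodup_append.mp (hτo ▸ τ.nodup)).2.1
    have hterm : ∃ s, IsDeltaTerm σ τ x y s := by
      refine ⟨_, isDeltaTerm_iff.mpr ⟨by rw [hσ, hτ]; exact hR, q, l, l', c, hq, hc,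
        hασ.symm.trans h1, hβτ.symm.trans h2, rfl⟩⟩
    obtain ⟨u, hu⟩ := hterm
    rw [diffCoeff_reorder d (labeled_eq_of_perm hσ.symm hασ) (labeled_eq_of_perm hτ.symm hβτ),
      diffCoeff_eq_of_reduction hloc hu (α' := ⟨P, m, hmn, hmP⟩) (β' := ⟨Q, m', hmn', hm'⟩) hPm
        (fun t => by
          rw [hσ, hτ, ← neg_sub, ← neg_sub (Q.pos t), hPQ]) hL hσo hτo,
      diffCoeff_of_isSquare (α := ⟨P, m, hmn, hmP⟩) (β := ⟨Q, m', hmn', hm'⟩) hd hclass hloc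
        hsimple hdeg hsq hPm hxry he, hσo, hτo]
    ring
  have hxl : LabelChange n x y [(x : Angle n)] [] (-1) := Or.inl ⟨rfl, rfl, rfl⟩
  have hyl : LabelChange n x y [(y : Angle n)] [] 1 := Or.inr (Or.inl ⟨rfl, rfl, rfl⟩)
  rw [hs]
  by_cases hl' : ∀ η ∈ l', η ∈ Q.mult.support
  · exact key (α.reorder _ h1) (β.reorder _ h2) q l l' c rfl rfl h1 h2 rfl rfl
      (fun η hη => Or.inl (hq η hη)) hc hl'
  -- otherwise an edge adjacent to the corner is labeled `h` before and after the rounding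
  push Not at hl'
  obtain ⟨η, hη, hηQ⟩ := hl'
  rcases hc with ⟨rfl, rfl, -⟩ | ⟨rfl, rfl, -⟩ | ⟨ζ, hζ, rfl, rfl, rfl⟩
  · exact absurd hη List.not_mem_nil
  · exact absurd hη List.not_mem_nil
  obtain rfl := List.mem_singleton.mp hη
  have hηxy : η = (x : Angle n) ∨ η = (y : Angle n) := by
    obtain ⟨θ, ⟨h3, h4⟩, rfl⟩ := hζ
    rcases h3.eq_or_lt with rfl | h3
    · exact Or.inl rfl
    rcases h4.eq_or_lt with rfl | h4
    · exact Or.inr rfl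
    exfalso
    have h5 : β.path.mult (θ : Angle n) ≠ 0 :=
      Finsupp.mem_support_iff.mp (β.edges _ (h2.mem_iff.mpr (by simp)))
    have h6 := mult_add_mult_eq hPQ (θ : Angle n)
    have h7 := hR.isCut.mult_eq_zero h3 h4
    exact hηQ (Finsupp.mem_support_iff.mpr fun h8 => by
      have h8 : Q.mult (θ : Angle n) = 0 := h8
      omega)
  have hqL : ∀ ζ ∈ q ++ [η], ζ ∉ arc n x y ∨ ζ = (x : Angle n) ∨ ζ = (y : Angle n) :=
    fun ζ hζ => by
      rcases List.mem_append.mp hζ with h3 | h3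
      · exact Or.inl (hq ζ h3)
      · rw [List.mem_singleton.mp h3]; exact Or.inr hηxy
  rcases hηxy with rfl | rfl
  · have := key (α.reorder _ h1) (β.reorder _ h2) (q ++ [(x : Angle n)]) [(y : Angle n)] [] 1
      rfl rfl h1 h2 (by simp [Generator.reorder]) (by simp [Generator.reorder]) hqL hyl (by simp)
    simpa using this
  · have h3 : α.order.Perm (q ++ [(y : Angle n), (x : Angle n)]) :=
      h1.trans ((List.Perm.swap _ _ _).append_left q)
    have := key (α.reorder _ h3) (β.reorder _ h2) (q ++ [(y : Angle n)]) [(x : Angle n)] [] (-1)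
      rfl rfl h3 h2 (by simp [Generator.reorder]) (by simp [Generator.reorder]) hqL hxl (by simp)
    rw [this, List.append_nil, List.append_assoc, List.singleton_append]
    simp only [reorderSign]
    rw [orderSign_swap q [] hcorner.coe_ne.symm]
    ring

end Induction

end PolygonComplex

end

theorem proposition9p1 (n : ℕ) [NeZero n]
    (d : PolygonComplex.Chain n →ₗ[AddMonoidAlgebra ℤ (ℤ × ℤ)] PolygonComplex.Chain n)
    (h_differential : d ∘ₗ d = 0)
    (h_index : PolygonComplex.AxiomIndex d)
    (h_nesting : PolygonComplex.AxiomNesting d)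
    (h_labelMatching : PolygonComplex.AxiomLabelMatching d)
    (h_connectedness : PolygonComplex.AxiomConnectedness d)
    (h_noDoubleRounding : PolygonComplex.AxiomNoDoubleRounding d)
    (h_locality : PolygonComplex.AxiomLocality d)
    (h_simpleRounding : PolygonComplex.AxiomSimpleRounding d)
    (h_degenerateRounding : PolygonComplex.AxiomDegenerateRounding d) :
    ∀ x : PolygonComplex.Chain n, d x = PolygonComplex.delta n x := by
  have hclass : ∀ α β : PolygonComplex.Generator n, PolygonComplex.diffCoeff d α β ≠ 0 →
      ∃ a b s, PolygonComplex.IsDeltaTerm α β a b s := fun α β h => by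
    obtain ⟨hp, hi⟩ := h_index α β h
    exact PolygonComplex.exists_isDeltaTerm hp.symm (h_nesting α β hp h)
      (h_labelMatching α β hp h) hi (h_connectedness α β hp h) (h_noDoubleRounding α β hp h)
  refine PolygonComplex.eq_delta_of_diffCoeff_eq d fun α β => ?_
  by_cases h : ∃ a b s, PolygonComplex.IsDeltaTerm α β a b s
  · obtain ⟨a, b, s, hs⟩ := h
    rw [hs.deltaCoeff_eq, PolygonComplex.diffCoeff_of_isDeltaTerm h_differential hclass h_locality
      h_simpleRounding h_degenerateRounding hs]
  · rw [PolygonComplex.deltaCoeff_eq_zero h]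
    by_contra h0
    exact h (hclass α β h0)
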